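/- Let $d\ge 1$ and let ${\bf C},{\bf D}\in\mathbb{R}^{d\times d}$ with ${\bf D}$ symmetric positive definite and ${\bf D}={\bf C}_s:=\frac12({\bf C}+{\bf C}^T)$ (so ${\bf C}$ is positive stable). Let $d_{\min}>0$ be the minimal eigenvalue of ${\bf D}$, and let $f_\infty(x)=(2\pi)^{-d/2}e^{-|x|^2/2}$ be the unit-mass equilibrium of the Fokker–Planck equation $$\partial_t g(t,x)=\operatorname{div}\big({\bf D}\nabla g(t,x)+{\bf C}x\,g(t,x)\big),\qquad t>0,\ x\in\mathbb{R}^d. \tag{FP}$$ Let $g_0\in L^2(\mathbb{R}^d,f_\infty^{-1})$ be real-valued and let $g$ be the classical solution of (FP) with initial datum $g_0$, i.e. $g\in C^\infty((0,\infty)\times\mathbb{R}^d)\cap C([0,\infty);L^1(\mathbb{R}^d))$ satisfies (FP) pointwise and $g(0)=g_0$. Assume $g_0\perp V_1:=\operatorname{span}\{\partial_{x_1}f_\infty,\dots,\partial_{x_d}f_\infty\}$ in $L^2(\mathbb{R}^d,f_\infty^{-1})$, i.e. $\int_{\mathbb{R}^d}g_0\,\partial_{x_i}f_\infty\, f_\infty^{-1}\,dx=0$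 for $i=1,\dots,d$. For a symmetric positive definite matrix ${\bf P}\in\mathbb{R}^{d\times d}$ put $$I_2^{\bf P}(h|f_\infty):=\int_{\mathbb{R}^d}\nabla\Big(\frac{h}{f_\infty}\Big)^T{\bf P}\,\nabla\Big(\frac{h}{f_\infty}\Big)f_\infty\,dx\in[0,\infty].$$ Suppose that $\lambda>0$ and that ${\bf C}^T{\bf P}+{\bf P}{\bf C}-2\lambda{\bf P}$ is positive semi-definite. Then for every $t>0$ both $I_2^{\bf D}(g(t)|f_\infty)$ and $I_2^{\bf P}(g(t)|f_\infty)$ are finite, $t\mapsto I_2^{\bf P}(g(t)|f_\infty)$ is differentiable at $t$, and $$\frac{d}{dt}I_2^{\bf P}(g(t)|f_\infty)\le -2(\lambda+d_{\min})\,I_2^{\bf P}(g(t)|f_\infty).$$ Consequently, for every $t_0>0$ and every $t\ge t_0$, $$I_2^{\bf P}(g(t)|f_\infty)\le I_2^{\bf P}(g(t_0)|f_\infty)\,e^{-2(\lambda+d_{\min})(t-t_0)}.$$ -/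

import Mathlib

open MeasureTheory Filter Topology Set
open scoped ENNReal ContDiff Matrix

namespace FokkerPlanck

/-- The standard Gaussian density on `ℝ^d`, the unit-mass equilibrium `f_∞` of the
Fokker–Planck equation whose matrices satisfy `D = (C + Cᵀ) / 2`. -/
noncomputable def finf (d : ℕ) (x : EuclideanSpace ℝ (Fin d)) : ℝ :=
  (2 * Real.pi) ^ (-(d : ℝ) / 2) * Real.exp (-‖x‖ ^ 2 / 2)

/-- The divergence `∑ i, ∂_i F_i` of a vector field. -/
noncomputable def divergence {d : ℕ}
    (F : EuclideanSpace ℝ (Fin d) → EuclideanSpace ℝ (Fin d))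
    (x : EuclideanSpace ℝ (Fin d)) : ℝ :=
  ∑ i, fderiv ℝ (fun y => F y i) x (EuclideanSpace.single i (1 : ℝ))

/-- The Fokker–Planck operator `L f = div (D ∇f + C x f)`. -/
noncomputable def fokkerPlanckOp {d : ℕ} (D C : Matrix (Fin d) (Fin d) ℝ)
    (f : EuclideanSpace ℝ (Fin d) → ℝ) : EuclideanSpace ℝ (Fin d) → ℝ :=
  divergence fun x => WithLp.toLp 2 (D *ᵥ (gradient f x).ofLp + f x • (C *ᵥ x.ofLp))

/-- `g` is the classical solution of `∂_t g = div (D ∇g + C x g)`, `t > 0`, with initial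
datum `g₀`: it is smooth on `(0,∞) × ℝ^d`, satisfies the equation there pointwise, belongs to
`C([0,∞); L¹(ℝ^d))`, and equals `g₀` at time `0`. Values at negative times are irrelevant. -/
structure IsSolution {d : ℕ} (D C : Matrix (Fin d) (Fin d) ℝ)
    (g₀ : EuclideanSpace ℝ (Fin d) → ℝ) (g : ℝ → EuclideanSpace ℝ (Fin d) → ℝ) : Prop where
  smooth : ContDiffOn ℝ ∞ (fun p : ℝ × EuclideanSpace ℝ (Fin d) => g p.1 p.2) (Ioi 0 ×ˢ univ)
  equation : ∀ t : ℝ, 0 < t → ∀ x, HasDerivAt (fun s => g s x) (fokkerPlanckOp D C (g t) x) t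
  integrable : ∀ t : ℝ, 0 ≤ t → Integrable (g t)
  continuous : ∀ t : ℝ, 0 ≤ t →
    Tendsto (fun s => ∫ x, |g s x - g t x|) (𝓝[Ici 0] t) (𝓝 0)
  initial : g 0 =ᵐ[volume] g₀

/-- The measure `f_∞⁻¹ dx`, so that `L²(f_∞⁻¹)` is the `L²` space of this measure. -/
noncomputable def weight (d : ℕ) : Measure (EuclideanSpace ℝ (Fin d)) :=
  volume.withDensity fun x => ENNReal.ofReal (finf d x)⁻¹

/-- `V_m`, the span of all partial derivatives of order `m` of `f_∞`. -/
noncomputable def V (d m : ℕ) : Submodule ℝ (EuclideanSpace ℝ (Fin d) → ℝ) :=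
  Submodule.span ℝ (range fun (σ : Fin m → Fin d) (x : EuclideanSpace ℝ (Fin d)) =>
    iteratedFDeriv ℝ m (finf d) x fun k => EuclideanSpace.single (σ k) (1 : ℝ))

/-- The `2`-Fisher information
`I_2^P(g|f_∞) = ∫ ∇(g/f_∞)ᵀ P ∇(g/f_∞) f_∞ dx ∈ [0,∞]`, for `P` positive semi-definite. -/
noncomputable def fisherInfo {d : ℕ} (P : Matrix (Fin d) (Fin d) ℝ)
    (g : EuclideanSpace ℝ (Fin d) → ℝ) : ℝ≥0∞ :=
  ∫⁻ x, ENNReal.ofReal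
    (((gradient (fun y => g y / finf d y) x).ofLp ⬝ᵥ
      (P *ᵥ (gradient (fun y => g y / finf d y) x).ofLp)) * finf d x)

end FokkerPlanck

open FokkerPlanck

/-!
Write `γ = f_∞ dx` for the standard Gaussian measure and `h = g / f_∞`. Since `D` is the symmetric
part of `C`, conjugation by `f_∞` turns the Fokker–Planck equation into `∂_t h = L h` with the
Ornstein–Uhlenbeck generator `L = ∑ D_ij ∂_i ∂_j - (Cᵀ x) · ∇` (`IsSolution.hasSource`). The
generator commutes with `∂_i` up to the drift, so that `v = ∇h` solves `∂_t v = L v - C v`. For the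
Gram matrix `E_ij = ∫ v_i v_j dγ` this gives

  `E_ij' = -∑ l, (C_jl E_il + C_il E_lj) - 2 ∫ ∇v_iᵀ D ∇v_j dγ`,

and the Fisher information with matrix `P` is `∑ P_ij E_ij`. In its derivative the drift part is at
most `-2 λ ∑ P_ij E_ij`, because `Cᵀ P + P C - 2 λ P` and `E` are positive semi-definite. The
dissipation is at most `-2 d_min ∑ P_ij E_ij`: writing `P` as a sum of matrices `b bᵀ`, it is enough
to treat `z = b · ∇h`, for which `∇zᵀ D ∇z ≥ d_min |∇z|²`, and `∫ |∇z|² dγ ≥ ∫ z² dγ` is the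
Gaussian Poincaré inequality with constant `1` (`poincare_stdGaussian`), as soon as `z` has mean
zero (`FiniteEnergy.sum_gramRate_le`).

The mean of `∂_k h` is the first moment `m_k = ∫ x_k h dγ`. Orthogonality to `V_1` means that `m`
vanishes at time `0`, and `m' = -C m` makes `|m|²` nonincreasing, so that `m` vanishes throughout
(`IsSolution.moment_eq_zero`).

The analytic content is the justification of these identities for a solution about which only
smoothness for `t > 0` and continuity in `L¹` are assumed. Testing the equation for a product of
two solutions with cutoffs `φ(x / n)`, for which `L* φ(x / n)` is bounded although the drift is
unbounded, shows that a solution in `L²(dt dγ)` is in `L²(γ)` at every positive time and has its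
gradient in `L²(dt dγ)` (`HasSource.energy`). Applied to `h`, `∂_i h` and `∂_i ∂_j h` in turn, this
makes `E` continuously differentiable (`FiniteEnergy.hasDerivAt_gram`). That `h` itself is in
`L²(dt dγ)` follows from the initial datum: `∫ Φ(h) dγ` is nonincreasing for smooth convex `Φ` of
linear growth, `L¹` continuity carries the bound down to time `0`, and `Φ(s)` increases to `s²`
(`IsSolution.memLp_quot`).
-/

namespace FokkerPlanck

/-! ### The standard Gaussian measure and its density -/

section Gaussian

open ProbabilityTheory

variable {d : ℕ}

lemma finf_pos (x : EuclideanSpace ℝ (Fin d)) : 0 < finf d x := by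
  unfold finf; positivity

lemma contDiff_finf : ContDiff ℝ ∞ (finf d) := by
  unfold finf
  exact contDiff_const.mul
    (Real.contDiff_exp.comp (((contDiff_norm_sq ℝ).neg).div_const 2))

lemma finf_eq_prod (x : EuclideanSpace ℝ (Fin d)) :
    finf d x = ∏ i, gaussianPDFReal 0 1 (x i) := by
  simp only [gaussianPDFReal, Finset.prod_mul_distrib, ← Real.exp_sum, finf]
  congr 1
  · rw [Finset.prod_const, Finset.card_univ, Fintype.card_fin, Real.sqrt_eq_rpow,
      ← Real.rpow_neg (by positivity), ← Real.rpow_mul_natCast (by positivity)]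
    congr 1
    · simp
    · ring
  · congr 1
    rw [EuclideanSpace.real_norm_sq_eq, ← Finset.sum_div, Finset.sum_neg_distrib]
    simp

lemma pi_gaussianReal_eq_withDensity :
    Measure.pi (fun _ : Fin d => gaussianReal 0 1) =
      volume.withDensity fun x => ENNReal.ofReal (∏ i, gaussianPDFReal 0 1 (x i)) := by
  refine Measure.pi_eq fun s hs => ?_
  have hint : Integrable (fun x : Fin d → ℝ => ∏ i, gaussianPDFReal 0 1 (x i))
      ((volume : Measure (Fin d → ℝ)).restrict (univ.pi s)) := by
    rw [volume_pi, Measure.restrict_pi_pi]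
    exact Integrable.fintype_prod (fun i => (integrable_gaussianPDFReal 0 1).restrict)
  rw [withDensity_apply _ (MeasurableSet.univ_pi hs), ← ofReal_integral_eq_lintegral_ofReal hint
    (ae_of_all _ fun x => Finset.prod_nonneg fun i _ => gaussianPDFReal_nonneg _ _ _),
    volume_pi, Measure.restrict_pi_pi]
  rw [integral_fintype_prod_eq_prod (fun (_ : Fin d) (y : ℝ) => gaussianPDFReal 0 1 y),
    ENNReal.ofReal_prod_of_nonneg fun i _ => integral_nonneg fun _ => gaussianPDFReal_nonneg _ _ _]
  exact Finset.prod_congr rfl fun i _ => (gaussianReal_apply_eq_integral 0 one_ne_zero (s i)).symm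

lemma stdGaussian_eq_withDensity :
    stdGaussian (EuclideanSpace ℝ (Fin d)) =
      volume.withDensity fun x => ENNReal.ofReal (finf d x) := by
  have hm : Measurable fun x : EuclideanSpace ℝ (Fin d) => ENNReal.ofReal (finf d x) :=
    contDiff_finf.continuous.measurable.ennreal_ofReal
  rw [← map_pi_eq_stdGaussian, pi_gaussianReal_eq_withDensity]
  ext s hs
  have hpre : MeasurableSet ((WithLp.toLp 2 : (Fin d → ℝ) → _) ⁻¹' s) :=
    (PiLp.volume_preserving_toLp (Fin d)).measurable hs
  rw [Measure.map_apply (PiLp.volume_preserving_toLp (Fin d)).measurable hs,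
    withDensity_apply _ hpre, withDensity_apply _ hs,
    ← (PiLp.volume_preserving_toLp (Fin d)).setLIntegral_comp_preimage hs hm]
  simp [finf_eq_prod]

lemma lintegral_stdGaussian {φ : EuclideanSpace ℝ (Fin d) → ℝ≥0∞} (hφ : Measurable φ) :
    ∫⁻ x, φ x ∂stdGaussian (EuclideanSpace ℝ (Fin d)) =
      ∫⁻ x, φ x * ENNReal.ofReal (finf d x) := by
  rw [stdGaussian_eq_withDensity, lintegral_withDensity_eq_lintegral_mul _
    contDiff_finf.continuous.measurable.ennreal_ofReal hφ]
  simp [mul_comm]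

lemma integrable_stdGaussian_iff {φ : EuclideanSpace ℝ (Fin d) → ℝ} :
    Integrable φ (stdGaussian (EuclideanSpace ℝ (Fin d))) ↔
      Integrable fun x => φ x * finf d x := by
  rw [stdGaussian_eq_withDensity, integrable_withDensity_iff
    contDiff_finf.continuous.measurable.ennreal_ofReal (by simp)]
  simp [ENNReal.toReal_ofReal (finf_pos _).le]

lemma integral_stdGaussian (φ : EuclideanSpace ℝ (Fin d) → ℝ) :
    ∫ x, φ x ∂stdGaussian (EuclideanSpace ℝ (Fin d)) = ∫ x, φ x * finf d x := by
  rw [stdGaussian_eq_withDensity, integral_withDensity_eq_integral_toReal_smul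
    contDiff_finf.continuous.measurable.ennreal_ofReal (by simp)]
  simp [ENNReal.toReal_ofReal (finf_pos _).le, mul_comm]

/-- The `i`-th vector of the standard basis. -/
noncomputable abbrev stdBasis (i : Fin d) : EuclideanSpace ℝ (Fin d) :=
  EuclideanSpace.single i (1 : ℝ)

lemma fderiv_finf (i : Fin d) (x : EuclideanSpace ℝ (Fin d)) :
    fderiv ℝ (finf d) x (stdBasis i) = -(x i) * finf d x := by
  have h1 : HasFDerivAt (fun y : EuclideanSpace ℝ (Fin d) => -‖y‖ ^ 2 / 2)
      (-(innerSL ℝ x)) x := by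
    have := ((hasStrictFDerivAt_norm_sq x).hasFDerivAt.neg).mul_const (2⁻¹ : ℝ)
    refine (this.congr_fderiv ?_).congr_of_eventuallyEq (Eventually.of_forall fun y => ?_)
    · ext y; simp
    · simp [div_eq_mul_inv]
  have h2 := (h1.exp.const_mul ((2 * Real.pi) ^ (-(d : ℝ) / 2)))
  rw [show finf d = fun y => (2 * Real.pi) ^ (-(d : ℝ) / 2) * Real.exp (-‖y‖ ^ 2 / 2) from rfl,
    h2.fderiv]
  simp [EuclideanSpace.inner_single_right]
  ring

/-- Gaussian integration by parts in the direction of a coordinate. -/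
lemma integral_fderiv_mul_stdGaussian {a b : EuclideanSpace ℝ (Fin d) → ℝ} (i : Fin d)
    (ha : Differentiable ℝ a) (hb : Differentiable ℝ b)
    (h1 : Integrable (fun x => fderiv ℝ a x (stdBasis i) * b x) (stdGaussian _))
    (h2 : Integrable (fun x => a x * (x i * b x - fderiv ℝ b x (stdBasis i))) (stdGaussian _))
    (h3 : Integrable (fun x => a x * b x) (stdGaussian _)) :
    ∫ x, fderiv ℝ a x (stdBasis i) * b x ∂stdGaussian (EuclideanSpace ℝ (Fin d)) =
      ∫ x, a x * (x i * b x - fderiv ℝ b x (stdBasis i)) ∂stdGaussian _ := by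
  rw [integral_stdGaussian, integral_stdGaussian]
  rw [integrable_stdGaussian_iff] at h1 h2 h3
  have hf : Differentiable ℝ (finf d) := contDiff_finf.differentiable (by simp)
  have hd : ∀ x, fderiv ℝ (fun y => b y * finf d y) x (stdBasis i) =
      -(x i * b x - fderiv ℝ b x (stdBasis i)) * finf d x := by
    intro x
    rw [fderiv_fun_mul (hb x) (hf x)]
    simp only [add_apply, smul_apply, smul_eq_mul,
      fderiv_finf]
    ring
  have := integral_mul_fderiv_eq_neg_fderiv_mul_of_integrable (μ := volume) (f := a)
    (g := fun y => b y * finf d y) (v := stdBasis i) (by simpa [mul_assoc] using h1)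
    (by simp only [hd]; convert h2.neg using 1; ext x; simp; ring)
    (by simpa [mul_assoc] using h3) (fun x _ => ha x) (fun x _ => (hb x).mul (hf x))
  simp only [hd] at this
  have e1 : ∫ x, fderiv ℝ a x (stdBasis i) * b x * finf d x =
      ∫ x, fderiv ℝ a x (stdBasis i) * (b x * finf d x) := by simp only [mul_assoc]
  have e2 : ∫ x, a x * (x i * b x - fderiv ℝ b x (stdBasis i)) * finf d x =
      - ∫ x, a x * (-(x i * b x - fderiv ℝ b x (stdBasis i)) * finf d x) := by
    rw [← integral_neg]; congr 1; ext x; ring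
  rw [e1, e2, this, neg_neg]

lemma memLp_norm_stdGaussian (p : ℝ≥0∞) (hp : p ≠ ⊤) :
    MemLp (fun x : EuclideanSpace ℝ (Fin d) => ‖x‖) p (stdGaussian _) :=
  (IsGaussian.memLp_id _ p hp).norm

lemma memLp_coord_stdGaussian (i : Fin d) (p : ℝ≥0∞) (hp : p ≠ ⊤) :
    MemLp (fun x : EuclideanSpace ℝ (Fin d) => x i) p (stdGaussian _) :=
  (memLp_norm_stdGaussian p hp).mono (by fun_prop)
    (ae_of_all _ fun x => by simpa using PiLp.norm_apply_le x i)

end Gaussian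

/-! ### The Gaussian Poincaré inequality with sharp constant -/

section Poincare

open ProbabilityTheory

lemma sq_sub_le_mul_integral_deriv_sq {w : ℝ → ℝ} (hw : ContDiff ℝ 1 w) {y x : ℝ} (h : y ≤ x) :
    (w x - w y) ^ 2 ≤ (x - y) * ∫ s in y..x, deriv w s ^ 2 := by
  have hc : Continuous (deriv w) := hw.continuous_deriv le_rfl
  have hI : ∫ s in y..x, deriv w s = w x - w y :=
    intervalIntegral.integral_deriv_eq_sub (fun s _ => (hw.differentiable one_ne_zero) s)
      (hc.intervalIntegrable _ _)
  rcases h.eq_or_lt with rfl | hlt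
  · simp
  have hxy : 0 < x - y := sub_pos.2 hlt
  -- Cauchy–Schwarz, as nonnegativity of the variance of `w'` about its mean `c`
  set c : ℝ := (w x - w y) / (x - y) with hcdef
  have h0 : 0 ≤ ∫ s in y..x, (deriv w s - c) ^ 2 :=
    intervalIntegral.integral_nonneg h fun s _ => sq_nonneg _
  have h1 : ∫ s in y..x, (deriv w s - c) ^ 2 =
      (∫ s in y..x, deriv w s ^ 2) - 2 * c * (w x - w y) + c ^ 2 * (x - y) := by
    have : ∀ s, (deriv w s - c) ^ 2 = deriv w s ^ 2 - 2 * c * deriv w s + c ^ 2 := fun s => by ring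
    simp only [this]
    rw [intervalIntegral.integral_add ((by fun_prop : Continuous fun s =>
        deriv w s ^ 2 - 2 * c * deriv w s).intervalIntegrable _ _) (by simp),
      intervalIntegral.integral_sub ((by fun_prop : Continuous fun s =>
        deriv w s ^ 2).intervalIntegrable _ _)
        ((hc.const_mul _).intervalIntegrable _ _), intervalIntegral.integral_const_mul, hI]
    simp [mul_comm]
  have h2 : c * (x - y) = w x - w y := by rw [hcdef]; field_simp
  have h3 : 0 ≤ (x - y) * (∫ s in y..x, (deriv w s - c) ^ 2) := mul_nonneg hxy.le h0
  rw [h1] at h3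
  nlinarith [h2]

/-- The first moment of the standard Gaussian over a half-line. -/
lemma setIntegral_Ioi_id_gaussianReal (s : ℝ) :
    ∫ x in Ioi s, x ∂gaussianReal 0 1 = gaussianPDFReal 0 1 s := by
  have hd : ∀ x : ℝ,
      HasDerivAt (fun y => -gaussianPDFReal 0 1 y) (x * gaussianPDFReal 0 1 x) x := by
    intro x
    have h1 : HasDerivAt (fun y : ℝ => -(y - 0) ^ 2 / (2 * ((1 : NNReal) : ℝ))) (-x) x := by
      have := (((hasDerivAt_id x).sub_const 0).pow 2).neg.div_const (2 * ((1 : NNReal) : ℝ))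
      refine this.congr_deriv ?_
      simp; ring
    have h2 := (h1.exp.const_mul (√(2 * Real.pi * ((1 : NNReal) : ℝ)))⁻¹).neg
    refine h2.congr_deriv ?_
    simp only [gaussianPDFReal]
    ring
  have hint : Integrable (fun x : ℝ => x * gaussianPDFReal 0 1 x) := by
    have : Integrable (fun x : ℝ => x) (gaussianReal 0 1) :=
      (memLp_id_gaussianReal (μ := 0) (v := 1) 1).integrable (by norm_num)
    rw [gaussianReal_of_var_ne_zero _ one_ne_zero, integrable_withDensity_iff
      (measurable_gaussianPDF _ _) (by simp [gaussianPDF])] at this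
    simpa using this
  have hlim : Tendsto (fun y => -gaussianPDFReal 0 1 y) atTop (𝓝 0) := by
    have h1 : Tendsto (fun y : ℝ => -(y - 0) ^ 2 / (2 * ((1 : NNReal) : ℝ))) atTop atBot := by
      have : Tendsto (fun y : ℝ => y ^ 2 / 2) atTop atTop :=
        (tendsto_pow_atTop two_ne_zero).atTop_div_const (by norm_num)
      refine (tendsto_neg_atTop_atBot.comp this).congr fun y => ?_
      simp [neg_div]
    have h2 := ((Real.tendsto_exp_atBot.comp h1).const_mul
      (√(2 * Real.pi * ((1 : NNReal) : ℝ)))⁻¹).neg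
    simpa [gaussianPDFReal] using h2
  have := integral_Ioi_of_hasDerivAt_of_tendsto' (a := s) (fun x _ => hd x) hint.integrableOn hlim
  rw [gaussianReal_of_var_ne_zero _ one_ne_zero, setIntegral_withDensity_eq_setIntegral_toReal_smul
    (measurable_gaussianPDF _ _) (by simp [gaussianPDF]) _ measurableSet_Ioi]
  simp only [toReal_gaussianPDF, smul_eq_mul]
  simp only [mul_comm (gaussianPDFReal 0 1 _)]
  rw [this]; ring

/-- The mass of `|X - Y|` over the event that a point `s` separates two independent standard
Gaussians `X`, `Y` is the Gaussian density at `s`; this identity makes the constant in the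
one-dimensional Poincaré inequality sharp. -/
lemma lintegral_lintegral_separated (s : ℝ) :
    ∫⁻ x in Ici s, ∫⁻ y in Iio s, ENNReal.ofReal (x - y) ∂gaussianReal 0 1 ∂gaussianReal 0 1 =
      gaussianPDF 0 1 s := by
  set μ := gaussianReal 0 1
  have hid : Integrable (fun x : ℝ => x) μ :=
    (memLp_id_gaussianReal (μ := 0) (v := 1) 1).integrable (by norm_num)
  have hint : Integrable (fun p : ℝ × ℝ => p.1 - p.2)
      ((μ.restrict (Ici s)).prod (μ.restrict (Iio s))) :=
    (hid.restrict.comp_fst _).sub (hid.restrict.comp_snd _)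
  have hnn : 0 ≤ᵐ[(μ.restrict (Ici s)).prod (μ.restrict (Iio s))] fun p : ℝ × ℝ => p.1 - p.2 := by
    rw [Measure.prod_restrict]
    refine (ae_restrict_iff' (measurableSet_Ici.prod measurableSet_Iio)).2 (ae_of_all _ ?_)
    rintro ⟨x, y⟩ ⟨hx, hy⟩
    simp only [mem_Ici, mem_Iio] at hx hy
    simp only [Pi.zero_apply]; linarith
  have hm : Measurable fun p : ℝ × ℝ => ENNReal.ofReal (p.1 - p.2) := by fun_prop
  rw [← lintegral_prod (fun p : ℝ × ℝ => ENNReal.ofReal (p.1 - p.2)) hm.aemeasurable,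
    ← ofReal_integral_eq_lintegral_ofReal hint hnn, gaussianPDF]
  congr 1
  rw [integral_sub (hid.restrict.comp_fst _) (hid.restrict.comp_snd _),
    integral_fun_fst (fun x : ℝ => x), integral_fun_snd (fun x : ℝ => x)]
  have h1 : ∫ x in Ici s, x ∂μ = gaussianPDFReal 0 1 s := by
    have : NullSingletonClass μ := nullSingletonClass_gaussianReal one_ne_zero
    rw [integral_Ici_eq_integral_Ioi, setIntegral_Ioi_id_gaussianReal]
  have h2 : ∫ x in Iio s, x ∂μ = -gaussianPDFReal 0 1 s := by
    have h := integral_add_compl (measurableSet_Ici (a := s)) hid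
    rw [compl_Ici, h1, integral_id_gaussianReal] at h
    linarith
  have h3 : μ.real (Iio s) + μ.real (Ici s) = 1 := by
    have := probReal_add_probReal_compl (μ := μ) (measurableSet_Iio (a := s))
    simpa [compl_Iio] using this
  rw [h1, h2]
  simp only [smul_eq_mul, measureReal_restrict_apply_univ]
  linear_combination gaussianPDFReal 0 1 s * h3

/-- The mean square difference of `w` over two independent standard Gaussians: bound
`(w x - w y)²` by `|x - y| ∫ w'²` over the interval between `x` and `y`, and exchange the
integrals. -/
lemma lintegral_sq_sub_le_gaussianReal {w : ℝ → ℝ} (hw : ContDiff ℝ 1 w) :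
    ∫⁻ x, ∫⁻ y, ENNReal.ofReal ((w x - w y) ^ 2) ∂gaussianReal 0 1 ∂gaussianReal 0 1 ≤
      2 * ∫⁻ s, ENNReal.ofReal (deriv w s ^ 2) ∂gaussianReal 0 1 := by
  set μ := gaussianReal 0 1
  have hc : Continuous (deriv w) := hw.continuous_deriv le_rfl
  have hq : Measurable fun s => ENNReal.ofReal (deriv w s ^ 2) := by fun_prop
  -- `K x y s` is `x - y` if `y < s ≤ x`, and `0` otherwise
  let K : ℝ → ℝ → ℝ → ℝ≥0∞ := fun x y s =>
    (Ici s).indicator (fun _ => (Iio s).indicator (fun y => ENNReal.ofReal (x - y)) y) x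
  have hKm : Measurable fun p : ℝ × ℝ × ℝ => K p.1 p.2.1 p.2.2 := by
    have : (fun p : ℝ × ℝ × ℝ => K p.1 p.2.1 p.2.2) =
        {p : ℝ × ℝ × ℝ | p.2.2 ≤ p.1 ∧ p.2.1 < p.2.2}.indicator
          fun p => ENNReal.ofReal (p.1 - p.2.1) := by
      ext ⟨x, y, s⟩
      simp only [K, indicator, mem_Ici, mem_Iio, mem_ofPred_eq]
      split_ifs <;> simp_all
    rw [this]
    refine Measurable.indicator (by fun_prop) ?_
    exact MeasurableSet.inter (s₁ := {p : ℝ × ℝ × ℝ | p.2.2 ≤ p.1})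
      (s₂ := {p : ℝ × ℝ × ℝ | p.2.1 < p.2.2}) (measurableSet_le (by fun_prop) (by fun_prop))
      (measurableSet_lt (by fun_prop) (by fun_prop))
  have key : ∀ x y, ENNReal.ofReal ((w x - w y) ^ 2) ≤
      ∫⁻ s, (K x y s + K y x s) * ENNReal.ofReal (deriv w s ^ 2) := by
    have aux : ∀ x y, y ≤ x → ENNReal.ofReal ((w x - w y) ^ 2) ≤
        ∫⁻ s, K x y s * ENNReal.ofReal (deriv w s ^ 2) := by
      intro x y hxy
      have hK : ∀ s, K x y s * ENNReal.ofReal (deriv w s ^ 2) =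
          (Ioc y x).indicator
            (fun s => ENNReal.ofReal (x - y) * ENNReal.ofReal (deriv w s ^ 2)) s := by
        intro s
        simp only [K, indicator, mem_Ici, mem_Iio, mem_Ioc]
        split_ifs <;> simp_all
      simp only [hK]
      rw [lintegral_indicator measurableSet_Ioc, lintegral_const_mul _ hq,
        ← ofReal_integral_eq_lintegral_ofReal
          ((by fun_prop : Continuous fun s => deriv w s ^ 2).integrableOn_Ioc)
          (ae_of_all _ fun _ => sq_nonneg _), ← ENNReal.ofReal_mul (sub_nonneg.2 hxy),
        ← intervalIntegral.integral_of_le hxy]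
      exact ENNReal.ofReal_le_ofReal (sq_sub_le_mul_integral_deriv_sq hw hxy)
    intro x y
    rcases le_total y x with h | h
    · exact (aux x y h).trans (lintegral_mono fun s => by gcongr; exact le_self_add)
    · rw [show (w x - w y) ^ 2 = (w y - w x) ^ 2 by ring]
      exact (aux y x h).trans (lintegral_mono fun s => by gcongr; exact le_add_self)
  have hK1 : ∀ s, ∫⁻ x, ∫⁻ y, K x y s ∂μ ∂μ = gaussianPDF 0 1 s := by
    intro s
    rw [← lintegral_lintegral_separated s, ← lintegral_indicator measurableSet_Ici]
    refine lintegral_congr fun x => ?_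
    by_cases hx : x ∈ Ici s
    · simp only [K, indicator_of_mem hx]
      rw [lintegral_indicator measurableSet_Iio]
    · simp [K, indicator_of_notMem hx]
  have hK2 : ∀ s, ∫⁻ x, ∫⁻ y, K y x s ∂μ ∂μ = gaussianPDF 0 1 s := by
    intro s
    rw [lintegral_lintegral_swap, hK1 s]
    exact (hKm.comp (by fun_prop : Measurable fun p : ℝ × ℝ => (p.2, p.1, s))).aemeasurable
  calc ∫⁻ x, ∫⁻ y, ENNReal.ofReal ((w x - w y) ^ 2) ∂μ ∂μ
      ≤ ∫⁻ x, ∫⁻ y, ∫⁻ s, (K x y s + K y x s) * ENNReal.ofReal (deriv w s ^ 2)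
          ∂volume ∂μ ∂μ :=
        lintegral_mono fun x => lintegral_mono fun y => key x y
    _ = ∫⁻ x, ∫⁻ s, ∫⁻ y, (K x y s + K y x s) * ENNReal.ofReal (deriv w s ^ 2)
          ∂μ ∂volume ∂μ := by
        refine lintegral_congr fun x => lintegral_lintegral_swap ?_
        refine Measurable.aemeasurable (Measurable.mul (Measurable.add ?_ ?_) (by fun_prop))
        · exact hKm.comp (by fun_prop : Measurable fun p : ℝ × ℝ => (x, p.1, p.2))
        · exact hKm.comp (by fun_prop : Measurable fun p : ℝ × ℝ => (p.1, x, p.2))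
    _ = ∫⁻ s, ∫⁻ x, ∫⁻ y, (K x y s + K y x s) * ENNReal.ofReal (deriv w s ^ 2) ∂μ ∂μ := by
        refine lintegral_lintegral_swap ?_
        have hm : Measurable fun q : (ℝ × ℝ) × ℝ => (K q.1.1 q.2 q.1.2 + K q.2 q.1.1 q.1.2) *
            ENNReal.ofReal (deriv w q.1.2 ^ 2) := by
          refine Measurable.mul (Measurable.add ?_ ?_) (by fun_prop)
          · exact hKm.comp (by fun_prop : Measurable fun p : (ℝ × ℝ) × ℝ => (p.1.1, p.2, p.1.2))
          · exact hKm.comp (by fun_prop : Measurable fun p : (ℝ × ℝ) × ℝ => (p.2, p.1.1, p.1.2))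
        exact hm.lintegral_prod_right'.aemeasurable
    _ = ∫⁻ s, 2 * (gaussianPDF 0 1 s * ENNReal.ofReal (deriv w s ^ 2)) := by
        refine lintegral_congr fun s => ?_
        have m1 : Measurable fun p : ℝ × ℝ => K p.1 p.2 s :=
          hKm.comp (by fun_prop : Measurable fun p : ℝ × ℝ => (p.1, p.2, s))
        have m2 : Measurable fun p : ℝ × ℝ => K p.2 p.1 s :=
          hKm.comp (by fun_prop : Measurable fun p : ℝ × ℝ => (p.2, p.1, s))
        have : ∀ x, ∫⁻ y, (K x y s + K y x s) * ENNReal.ofReal (deriv w s ^ 2) ∂μ =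
            (∫⁻ y, K x y s ∂μ + ∫⁻ y, K y x s ∂μ) * ENNReal.ofReal (deriv w s ^ 2) := by
          intro x
          rw [lintegral_mul_const, lintegral_add_left]
          · exact m1.comp (by fun_prop : Measurable fun y : ℝ => (x, y))
          · exact (m1.comp (by fun_prop : Measurable fun y : ℝ => (x, y))).add
              (m2.comp (by fun_prop : Measurable fun y : ℝ => (x, y)))
        simp only [this]
        rw [lintegral_mul_const, lintegral_add_left, hK1, hK2]
        · ring
        · exact m1.lintegral_prod_right
        · exact m1.lintegral_prod_right.add m2.lintegral_prod_right
    _ = 2 * ∫⁻ s, ENNReal.ofReal (deriv w s ^ 2) ∂μ := by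
        rw [lintegral_const_mul _ (by fun_prop)]
        simp only [μ]
        rw [gaussianReal_of_var_ne_zero _ one_ne_zero,
          lintegral_withDensity_eq_lintegral_mul _ (measurable_gaussianPDF _ _) hq]
        rfl

/-- The one-dimensional Gaussian Poincaré inequality. -/
lemma poincare_gaussianReal {w : ℝ → ℝ} (hw : ContDiff ℝ 1 w)
    (h2 : MemLp w 2 (gaussianReal 0 1)) (h2' : MemLp (deriv w) 2 (gaussianReal 0 1)) :
    ∫ x, w x ^ 2 ∂gaussianReal 0 1 - (∫ x, w x ∂gaussianReal 0 1) ^ 2 ≤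
      ∫ x, deriv w x ^ 2 ∂gaussianReal 0 1 := by
  set μ := gaussianReal 0 1
  have hi : Integrable w μ := h2.integrable (by norm_num)
  have i1 : Integrable (fun p : ℝ × ℝ => w p.1 ^ 2) (μ.prod μ) := h2.integrable_sq.comp_fst μ
  have i2 : Integrable (fun p : ℝ × ℝ => w p.2 ^ 2) (μ.prod μ) := h2.integrable_sq.comp_snd μ
  have i3 : Integrable (fun p : ℝ × ℝ => w p.1 * w p.2) (μ.prod μ) := hi.mul_prod hi
  have e : ∀ p : ℝ × ℝ, (w p.1 - w p.2) ^ 2 = w p.1 ^ 2 + w p.2 ^ 2 - 2 * (w p.1 * w p.2) :=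
    fun p => by ring
  have i4 : Integrable (fun p : ℝ × ℝ => (w p.1 - w p.2) ^ 2) (μ.prod μ) := by
    simp only [e]; exact (i1.add i2).sub (i3.const_mul 2)
  have i12 : Integrable (fun p : ℝ × ℝ => w p.1 ^ 2 + w p.2 ^ 2) (μ.prod μ) := i1.add i2
  have hval : ∫ p : ℝ × ℝ, (w p.1 - w p.2) ^ 2 ∂μ.prod μ =
      2 * (∫ x, w x ^ 2 ∂μ - (∫ x, w x ∂μ) ^ 2) := by
    simp only [e]
    rw [integral_sub i12 (i3.const_mul 2), integral_add i1 i2, integral_const_mul,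
      integral_prod_mul, integral_fun_fst (fun x => w x ^ 2), integral_fun_snd (fun x => w x ^ 2)]
    simp; ring
  have hle := lintegral_sq_sub_le_gaussianReal hw
  rw [← lintegral_prod (fun p : ℝ × ℝ => ENNReal.ofReal ((w p.1 - w p.2) ^ 2))
      (by have := hw.continuous; fun_prop),
    ← ofReal_integral_eq_lintegral_ofReal i4 (ae_of_all _ fun _ => sq_nonneg _),
    ← ofReal_integral_eq_lintegral_ofReal h2'.integrable_sq (ae_of_all _ fun _ => sq_nonneg _),
    hval, show (2 : ℝ≥0∞) = ENNReal.ofReal 2 by simp, ← ENNReal.ofReal_mul (by norm_num),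
    ENNReal.ofReal_le_ofReal_iff (by have := integral_nonneg (μ := μ) (f := fun x => deriv w x ^ 2)
                                       (fun _ => sq_nonneg _); positivity)] at hle
  linarith

lemma sq_integral_le_integral_sq {α : Type*} [MeasurableSpace α] {μ : Measure α}
    [IsProbabilityMeasure μ] {w : α → ℝ} (h : MemLp w 2 μ) :
    (∫ x, w x ∂μ) ^ 2 ≤ ∫ x, w x ^ 2 ∂μ := by
  have hi : Integrable w μ := h.integrable (by norm_num)
  set c := ∫ x, w x ∂μ with hc
  have h0 : 0 ≤ ∫ x, (w x - c) ^ 2 ∂μ := integral_nonneg fun _ => sq_nonneg _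
  have e : ∀ x, (w x - c) ^ 2 = (w x ^ 2 - 2 * c * w x) + c ^ 2 := fun x => by ring
  have i1 : Integrable (fun x => w x ^ 2 - 2 * c * w x) μ := h.integrable_sq.sub (hi.const_mul _)
  simp only [e] at h0
  rw [integral_add i1 (integrable_const _), integral_sub h.integrable_sq (hi.const_mul _),
    integral_const_mul, ← hc] at h0
  simp only [integral_const, probReal_univ, one_smul] at h0
  linarith

/-- Tensorization of the variance: a variance bound in each factor gives one on the product. With
`m`, `n` the two marginal means of `w`, the inequality expresses `(∫ r)² ≤ ∫ r²` for
`r = w - m - n`. -/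
lemma variance_prod_le {α β : Type*} [MeasurableSpace α] [MeasurableSpace β] {μ : Measure α}
    {ν : Measure β} [IsProbabilityMeasure μ] [IsProbabilityMeasure ν] {w A B : α × β → ℝ}
    (hw : MemLp w 2 (μ.prod ν)) (hA : Integrable A (μ.prod ν)) (hB : Integrable B (μ.prod ν))
    (h1 : ∀ᵐ y ∂ν, ∫ x, w (x, y) ^ 2 ∂μ - (∫ x, w (x, y) ∂μ) ^ 2 ≤ ∫ x, A (x, y) ∂μ)
    (h2 : ∀ᵐ x ∂μ, ∫ y, w (x, y) ^ 2 ∂ν - (∫ y, w (x, y) ∂ν) ^ 2 ≤ ∫ y, B (x, y) ∂ν) :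
    ∫ p, w p ^ 2 ∂μ.prod ν - (∫ p, w p ∂μ.prod ν) ^ 2 ≤
      ∫ p, A p ∂μ.prod ν + ∫ p, B p ∂μ.prod ν := by
  have hi : Integrable w (μ.prod ν) := hw.integrable (by norm_num)
  have hq : Integrable (fun p => w p ^ 2) (μ.prod ν) := hw.integrable_sq
  set m : β → ℝ := fun y => ∫ x, w (x, y) ∂μ
  set n : α → ℝ := fun x => ∫ y, w (x, y) ∂ν
  have him : Integrable m ν := hi.integral_prod_right
  have hin : Integrable n μ := hi.integral_prod_left
  have hWm : ∫ y, m y ∂ν = ∫ p, w p ∂μ.prod ν := (integral_prod_symm w hi).symm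
  have hWn : ∫ x, n x ∂μ = ∫ p, w p ∂μ.prod ν := (integral_prod w hi).symm
  set W := ∫ p, w p ∂μ.prod ν with hW
  have slm : ∀ᵐ y ∂ν, MemLp (fun x => w (x, y)) 2 μ := by
    filter_upwards [hq.prod_left_ae, hw.1.prodMk_right] with y hy hy'
    exact (memLp_two_iff_integrable_sq hy').2 hy
  have sln : ∀ᵐ x ∂μ, MemLp (fun y => w (x, y)) 2 ν := by
    filter_upwards [hq.prod_right_ae, hw.1.prodMk_left] with x hy hy'
    exact (memLp_two_iff_integrable_sq hy').2 hy
  have hm2 : Integrable (fun y => m y ^ 2) ν := by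
    refine hq.integral_prod_right.mono' (him.1.pow 2) ?_
    filter_upwards [slm] with y hy
    rw [Real.norm_of_nonneg (sq_nonneg _)]
    exact sq_integral_le_integral_sq hy
  have hn2 : Integrable (fun x => n x ^ 2) μ := by
    refine hq.integral_prod_left.mono' (hin.1.pow 2) ?_
    filter_upwards [sln] with y hy
    rw [Real.norm_of_nonneg (sq_nonneg _)]
    exact sq_integral_le_integral_sq hy
  have Lm : MemLp (fun p : α × β => m p.2) 2 (μ.prod ν) :=
    ((memLp_two_iff_integrable_sq him.1).2 hm2).comp_snd μ
  have Ln : MemLp (fun p : α × β => n p.1) 2 (μ.prod ν) :=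
    ((memLp_two_iff_integrable_sq hin.1).2 hn2).comp_fst ν
  have iwm : Integrable (fun p => w p * m p.2) (μ.prod ν) := hw.integrable_mul Lm
  have iwn : Integrable (fun p => w p * n p.1) (μ.prod ν) := hw.integrable_mul Ln
  have inm : Integrable (fun p : α × β => n p.1 * m p.2) (μ.prod ν) := Ln.integrable_mul Lm
  have vwm : ∫ p, w p * m p.2 ∂μ.prod ν = ∫ y, m y ^ 2 ∂ν := by
    rw [integral_prod_symm _ iwm]
    simp only [integral_mul_const, sq]
    rfl
  have vwn : ∫ p, w p * n p.1 ∂μ.prod ν = ∫ x, n x ^ 2 ∂μ := by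
    rw [integral_prod _ iwn]
    simp only [integral_mul_const, sq]
    rfl
  have vnm : ∫ p : α × β, n p.1 * m p.2 ∂μ.prod ν = W ^ 2 := by
    rw [integral_prod_mul, hWm, hWn, sq]
  have vm2 : ∫ p : α × β, m p.2 ^ 2 ∂μ.prod ν = ∫ y, m y ^ 2 ∂ν := by
    rw [integral_fun_snd (fun y => m y ^ 2)]; simp
  have vn2 : ∫ p : α × β, n p.1 ^ 2 ∂μ.prod ν = ∫ x, n x ^ 2 ∂μ := by
    rw [integral_fun_fst (fun y => n y ^ 2)]; simp
  have key : (∫ p, (w p - m p.2 - n p.1) ∂μ.prod ν) ^ 2 ≤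
      ∫ p, (w p - m p.2 - n p.1) ^ 2 ∂μ.prod ν :=
    sq_integral_le_integral_sq ((hw.sub Lm).sub Ln)
  have e1 : ∫ p, (w p - m p.2 - n p.1) ∂μ.prod ν = -W := by
    have i1 : Integrable (fun p => w p - m p.2) (μ.prod ν) := hi.sub (him.comp_snd μ)
    rw [integral_sub i1 (hin.comp_fst ν), integral_sub hi (him.comp_snd μ),
      integral_fun_snd m, integral_fun_fst n, hWm, hWn, ← hW]
    simp
  have e2 : ∫ p, (w p - m p.2 - n p.1) ^ 2 ∂μ.prod ν =
      ∫ p, w p ^ 2 ∂μ.prod ν - ∫ y, m y ^ 2 ∂ν - ∫ x, n x ^ 2 ∂μ + 2 * W ^ 2 := by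
    have e : ∀ p : α × β, (w p - m p.2 - n p.1) ^ 2 = (w p ^ 2 + m p.2 ^ 2 + n p.1 ^ 2) -
        2 * (w p * m p.2 + w p * n p.1 - n p.1 * m p.2) := fun p => by ring
    have j1 : Integrable (fun p => w p ^ 2 + m p.2 ^ 2) (μ.prod ν) := hq.add (hm2.comp_snd μ)
    have j2 : Integrable (fun p => w p ^ 2 + m p.2 ^ 2 + n p.1 ^ 2) (μ.prod ν) :=
      j1.add (hn2.comp_fst ν)
    have j3 : Integrable (fun p => w p * m p.2 + w p * n p.1) (μ.prod ν) := iwm.add iwn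
    have j4 : Integrable (fun p => w p * m p.2 + w p * n p.1 - n p.1 * m p.2) (μ.prod ν) :=
      j3.sub inm
    simp only [e]
    rw [integral_sub j2 (j4.const_mul 2), integral_add j1 (hn2.comp_fst ν),
      integral_add hq (hm2.comp_snd μ), integral_const_mul, integral_sub j3 inm,
      integral_add iwm iwn, vwm, vwn, vnm, vm2, vn2]
    ring
  have b1 : ∫ p, w p ^ 2 ∂μ.prod ν - ∫ y, m y ^ 2 ∂ν ≤ ∫ p, A p ∂μ.prod ν := by
    rw [integral_prod_symm _ hq, integral_prod_symm _ hA, ← integral_sub hq.integral_prod_right hm2]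
    exact integral_mono_ae (hq.integral_prod_right.sub hm2) hA.integral_prod_right h1
  have b2 : ∫ p, w p ^ 2 ∂μ.prod ν - ∫ y, n y ^ 2 ∂μ ≤ ∫ p, B p ∂μ.prod ν := by
    rw [integral_prod _ hq, integral_prod _ hB, ← integral_sub hq.integral_prod_left hn2]
    exact integral_mono_ae (hq.integral_prod_left.sub hn2) hB.integral_prod_left h2
  rw [e1, e2] at key
  linarith

lemma poincare_pi_gaussianReal (n : ℕ) {f : (Fin n → ℝ) → ℝ} (hf : ContDiff ℝ 1 f)
    (h2 : MemLp f 2 (Measure.pi fun _ => gaussianReal 0 1))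
    (h2' : ∀ i, MemLp (fun x => fderiv ℝ f x (Pi.single i 1)) 2
      (Measure.pi fun _ => gaussianReal 0 1)) :
    ∫ x, f x ^ 2 ∂(Measure.pi fun _ => gaussianReal 0 1) -
        (∫ x, f x ∂(Measure.pi fun _ => gaussianReal 0 1)) ^ 2 ≤
      ∑ i, ∫ x, fderiv ℝ f x (Pi.single i 1) ^ 2 ∂(Measure.pi fun _ => gaussianReal 0 1) := by
  induction n with
  | zero =>
    have : f = fun _ => f 0 := funext fun x => congrArg f (Subsingleton.elim _ _)
    rw [this]
    simp
  | succ n ih =>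
    set μ := gaussianReal 0 1
    set ν : Measure (Fin n → ℝ) := Measure.pi fun _ => μ
    -- split off the coordinate `0`
    let c : ℝ × (Fin n → ℝ) → (Fin (n + 1) → ℝ) := fun p => Fin.cons p.1 p.2
    have hmp : MeasurePreserving c (μ.prod ν) (Measure.pi fun _ => μ) := by
      have := (measurePreserving_piFinSuccAbove (fun _ : Fin (n + 1) => μ) 0).symm
      convert this using 1
      ext p i
      simp [c, MeasurableEquiv.piFinSuccAbove, Fin.insertNthEquiv]
    have hemb : MeasurableEmbedding c := by
      have := (MeasurableEquiv.piFinSuccAbove (fun _ : Fin (n + 1) => ℝ) 0).symm.measurableEmbedding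
      convert this using 1
      ext p i
      simp [c, MeasurableEquiv.piFinSuccAbove, Fin.insertNthEquiv]
    have hdf : Differentiable ℝ f := hf.differentiable one_ne_zero
    have d1 : ∀ (y : Fin n → ℝ) (x : ℝ),
        HasFDerivAt (fun x : ℝ => c (x, y)) (ContinuousLinearMap.pi
          (Fin.cons (ContinuousLinearMap.id ℝ ℝ) fun _ => 0)) x := by
      intro y x
      rw [hasFDerivAt_pi']
      intro i
      refine Fin.cases ?_ (fun j => ?_) i
      · exact hasFDerivAt_id x
      · exact hasFDerivAt_const _ _
    have d2 : ∀ (x : ℝ) (y : Fin n → ℝ),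
        HasFDerivAt (fun y : Fin n → ℝ => c (x, y)) (ContinuousLinearMap.pi
          (Fin.cons (0 : (Fin n → ℝ) →L[ℝ] ℝ) fun j =>
            (ContinuousLinearMap.proj j : (Fin n → ℝ) →L[ℝ] ℝ))) y := by
      intro x y
      rw [hasFDerivAt_pi']
      intro i
      refine Fin.cases ?_ (fun j => ?_) i
      · exact hasFDerivAt_const _ _
      · exact hasFDerivAt_apply j y
    have D1 : ∀ y x, deriv (fun x => f (c (x, y))) x = fderiv ℝ f (c (x, y)) (Pi.single 0 1) := by
      intro y x
      rw [← fderiv_apply_one_eq_deriv]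
      have := ((hdf (c (x, y))).hasFDerivAt.comp x (d1 y x)).fderiv
      simp only [Function.comp_def] at this
      rw [this, ContinuousLinearMap.comp_apply]
      congr 1
      ext i
      refine Fin.cases ?_ (fun j => ?_) i <;> simp
    have D2 : ∀ x y i, fderiv ℝ (fun y => f (c (x, y))) y (Pi.single i 1) =
        fderiv ℝ f (c (x, y)) (Pi.single i.succ 1) := by
      intro x y i
      have := ((hdf (c (x, y))).hasFDerivAt.comp y (d2 x y)).fderiv
      simp only [Function.comp_def] at this
      rw [this, ContinuousLinearMap.comp_apply]
      congr 1
      ext k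
      refine Fin.cases ?_ (fun j => ?_) k
      · simp
      · simp [Pi.single_apply]
    have C1 : ∀ y, ContDiff ℝ 1 fun x => f (c (x, y)) := fun y =>
      hf.comp (contDiff_pi.2 fun i => by
        refine Fin.cases ?_ (fun j => ?_) i <;> simp only [c, Fin.cons_zero, Fin.cons_succ] <;>
          fun_prop)
    have C2 : ∀ x, ContDiff ℝ 1 fun y => f (c (x, y)) := fun y =>
      hf.comp (contDiff_pi.2 fun i => by
        refine Fin.cases ?_ (fun j => ?_) i <;> simp only [c, Fin.cons_zero, Fin.cons_succ] <;>
          fun_prop)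
    have M : ∀ {u : (Fin (n + 1) → ℝ) → ℝ}, MemLp u 2 (Measure.pi fun _ => μ) →
        MemLp (fun p => u (c p)) 2 (μ.prod ν) := fun hu => hu.comp_measurePreserving hmp
    have S1 : ∀ {u : (Fin (n + 1) → ℝ) → ℝ}, MemLp u 2 (Measure.pi fun _ => μ) →
        ∀ᵐ y ∂ν, MemLp (fun x => u (c (x, y))) 2 μ := by
      intro u hu
      filter_upwards [(M hu).integrable_sq.prod_left_ae, (M hu).1.prodMk_right] with y hy hy'
      exact (memLp_two_iff_integrable_sq hy').2 hy
    have S2 : ∀ {u : (Fin (n + 1) → ℝ) → ℝ}, MemLp u 2 (Measure.pi fun _ => μ) →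
        ∀ᵐ x ∂μ, MemLp (fun y => u (c (x, y))) 2 ν := by
      intro u hu
      filter_upwards [(M hu).integrable_sq.prod_right_ae, (M hu).1.prodMk_left] with y hy hy'
      exact (memLp_two_iff_integrable_sq hy').2 hy
    have I : ∀ u : (Fin (n + 1) → ℝ) → ℝ, ∫ x, u x ∂(Measure.pi fun _ => μ) =
        ∫ p, u (c p) ∂μ.prod ν := fun u => (hmp.integral_comp hemb u).symm
    rw [Fin.sum_univ_succ]
    simp only [I]
    rw [← integral_finsetSum _ fun i _ => (M (h2' i.succ)).integrable_sq]
    refine variance_prod_le (M h2) (M (h2' 0)).integrable_sq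
      (integrable_finsetSum _ fun i _ => (M (h2' i.succ)).integrable_sq) ?_ ?_
    · filter_upwards [S1 h2, S1 (h2' 0)] with y hy hy'
      have := poincare_gaussianReal (C1 y) hy (by
        rw [show deriv (fun x => f (c (x, y))) = _ from funext (D1 y)]; exact hy')
      simpa only [D1] using this
    · filter_upwards [S2 h2, ae_all_iff.2 fun i : Fin n => S2 (h2' i.succ)] with x hx hx'
      have := ih (C2 x) hx (fun i => by simpa only [D2] using hx' i)
      rw [integral_finsetSum _ fun i _ => (hx' i).integrable_sq]
      simpa only [D2] using this

/-- The Gaussian Poincaré inequality with its sharp constant `1`. -/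
lemma poincare_stdGaussian {d : ℕ} {f : EuclideanSpace ℝ (Fin d) → ℝ} (hf : ContDiff ℝ 1 f)
    (h2 : MemLp f 2 (stdGaussian _))
    (h2' : ∀ i, MemLp (fun x => fderiv ℝ f x (stdBasis i)) 2 (stdGaussian _)) :
    ∫ x, f x ^ 2 ∂stdGaussian (EuclideanSpace ℝ (Fin d)) -
        (∫ x, f x ∂stdGaussian (EuclideanSpace ℝ (Fin d))) ^ 2 ≤
      ∑ i, ∫ x, fderiv ℝ f x (stdBasis i) ^ 2 ∂stdGaussian (EuclideanSpace ℝ (Fin d)) := by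
  have hmp : MeasurePreserving (WithLp.toLp 2) (Measure.pi fun _ : Fin d => gaussianReal 0 1)
      (stdGaussian (EuclideanSpace ℝ (Fin d))) :=
    ⟨(PiLp.volume_preserving_toLp (Fin d)).measurable, map_pi_eq_stdGaussian⟩
  have hemb : MeasurableEmbedding (WithLp.toLp 2 : (Fin d → ℝ) → EuclideanSpace ℝ (Fin d)) :=
    (MeasurableEquiv.toLp 2 (Fin d → ℝ)).measurableEmbedding
  let L := (PiLp.continuousLinearEquiv 2 ℝ (fun _ : Fin d => ℝ)).symm
  have D : ∀ x i, fderiv ℝ (fun y => f (WithLp.toLp 2 y)) x (Pi.single i 1) =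
      fderiv ℝ f (WithLp.toLp 2 x) (stdBasis i) := by
    intro x i
    have := ((hf.differentiable one_ne_zero (L x)).hasFDerivAt.comp x
      L.toContinuousLinearMap.hasFDerivAt).fderiv
    change fderiv ℝ (f ∘ L) x _ = _
    erw [this]
    rfl
  have := poincare_pi_gaussianReal d (f := fun y => f (WithLp.toLp 2 y))
    (hf.comp (L.toContinuousLinearMap.contDiff))
    (h2.comp_measurePreserving hmp)
    (fun i => by simp only [D]; exact (h2' i).comp_measurePreserving hmp)
  simp only [D] at this
  rw [← hmp.integral_comp hemb, ← hmp.integral_comp hemb]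
  simp only [← hmp.integral_comp hemb (fun x => fderiv ℝ f x (stdBasis _) ^ 2)]
  exact this

end Poincare

/-! ### Calculus on space-time and the Ornstein–Uhlenbeck generator -/

section Generator

variable {d : ℕ}

/-- The open half-space `t > 0` of space-time. -/
def halfSpace (d : ℕ) : Set (ℝ × EuclideanSpace ℝ (Fin d)) := Ioi 0 ×ˢ univ

lemma mem_halfSpace {p : ℝ × EuclideanSpace ℝ (Fin d)} : p ∈ halfSpace d ↔ 0 < p.1 := by
  simp [halfSpace]

lemma isOpen_halfSpace : IsOpen (halfSpace d) := isOpen_Ioi.prod isOpen_univ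

/-- Smoothness on the half-space `t > 0`. Nothing is required of the values at `t ≤ 0`. -/
def Smooth (W : ℝ × EuclideanSpace ℝ (Fin d) → ℝ) : Prop := ContDiffOn ℝ ∞ W (halfSpace d)

/-- The derivative in a fixed space-time direction `v`. -/
noncomputable def dirDeriv (v : ℝ × EuclideanSpace ℝ (Fin d))
    (W : ℝ × EuclideanSpace ℝ (Fin d) → ℝ) (p : ℝ × EuclideanSpace ℝ (Fin d)) : ℝ :=
  fderiv ℝ W p v

/-- The spatial partial derivative `∂_i` of a function on space-time. -/
noncomputable abbrev pd (i : Fin d) (W : ℝ × EuclideanSpace ℝ (Fin d) → ℝ) :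
    ℝ × EuclideanSpace ℝ (Fin d) → ℝ :=
  dirDeriv (0, stdBasis i) W

/-- The time derivative `∂_t` of a function on space-time. -/
noncomputable abbrev td (W : ℝ × EuclideanSpace ℝ (Fin d) → ℝ) :
    ℝ × EuclideanSpace ℝ (Fin d) → ℝ :=
  dirDeriv (1, 0) W

variable {W W' : ℝ × EuclideanSpace ℝ (Fin d) → ℝ} {p v v' : ℝ × EuclideanSpace ℝ (Fin d)}

lemma Smooth.contDiffAt (h : Smooth W) (hp : p ∈ halfSpace d) : ContDiffAt ℝ ∞ W p :=
  ContDiffOn.contDiffAt h (isOpen_halfSpace.mem_nhds hp)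

lemma Smooth.differentiableAt (h : Smooth W) (hp : p ∈ halfSpace d) : DifferentiableAt ℝ W p :=
  (h.contDiffAt hp).differentiableAt (by simp)

lemma Smooth.derivDir (h : Smooth W) : Smooth (dirDeriv v W) :=
  (ContDiffOn.fderiv_of_isOpen h isOpen_halfSpace (m := ∞) (by simp)).clm_apply contDiffOn_const

lemma Smooth.add (h : Smooth W) (h' : Smooth W') : Smooth (fun p => W p + W' p) :=
  ContDiffOn.add h h'

lemma Smooth.sub (h : Smooth W) (h' : Smooth W') : Smooth (fun p => W p - W' p) :=
  ContDiffOn.sub h h'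

lemma Smooth.mul (h : Smooth W) (h' : Smooth W') : Smooth (fun p => W p * W' p) :=
  ContDiffOn.mul h h'

lemma smooth_const (c : ℝ) : Smooth (fun _ : ℝ × EuclideanSpace ℝ (Fin d) => c) :=
  contDiffOn_const

lemma Smooth.neg (h : Smooth W) : Smooth (fun p => -W p) := ContDiffOn.neg h

lemma Smooth.sum {ι : Type*} {s : Finset ι} {F : ι → ℝ × EuclideanSpace ℝ (Fin d) → ℝ}
    (h : ∀ i ∈ s, Smooth (F i)) : Smooth (fun p => ∑ i ∈ s, F i p) :=
  ContDiffOn.sum h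

lemma smooth_coord (i : Fin d) : Smooth (fun p : ℝ × EuclideanSpace ℝ (Fin d) => p.2 i) := by
  unfold Smooth; fun_prop

lemma Smooth.comp {Φ : ℝ → ℝ} (hΦ : ContDiff ℝ ∞ Φ) (h : Smooth W) : Smooth (fun p => Φ (W p)) :=
  hΦ.comp_contDiffOn h

lemma Smooth.continuousOn (h : Smooth W) : ContinuousOn W (halfSpace d) :=
  ContDiffOn.continuousOn h

lemma dirDeriv_congr (h : EqOn W W' (halfSpace d)) (hp : p ∈ halfSpace d) :
    dirDeriv v W p = dirDeriv v W' p := by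
  unfold dirDeriv
  rw [(h.eventuallyEq_of_mem (isOpen_halfSpace.mem_nhds hp)).fderiv_eq]

lemma dirDeriv_add (h : Smooth W) (h' : Smooth W') (hp : p ∈ halfSpace d) :
    dirDeriv v (fun q => W q + W' q) p = dirDeriv v W p + dirDeriv v W' p := by
  unfold dirDeriv
  rw [fderiv_fun_add (h.differentiableAt hp) (h'.differentiableAt hp), add_apply]

lemma dirDeriv_sub (h : Smooth W) (h' : Smooth W') (hp : p ∈ halfSpace d) :
    dirDeriv v (fun q => W q - W' q) p = dirDeriv v W p - dirDeriv v W' p := by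
  unfold dirDeriv
  rw [fderiv_fun_sub (h.differentiableAt hp) (h'.differentiableAt hp), sub_apply]

lemma dirDeriv_mul (h : Smooth W) (h' : Smooth W') (hp : p ∈ halfSpace d) :
    dirDeriv v (fun q => W q * W' q) p = dirDeriv v W p * W' p + W p * dirDeriv v W' p := by
  unfold dirDeriv
  rw [fderiv_fun_mul (h.differentiableAt hp) (h'.differentiableAt hp)]
  simp only [add_apply, smul_apply, smul_eq_mul]
  ring

lemma dirDeriv_const (c : ℝ) : dirDeriv v (fun _ => c) p = 0 := by
  simp [dirDeriv]

lemma dirDeriv_const_mul (c : ℝ) (h : Smooth W) (hp : p ∈ halfSpace d) :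
    dirDeriv v (fun q => c * W q) p = c * dirDeriv v W p := by
  rw [dirDeriv_mul (smooth_const c) h hp, dirDeriv_const]; ring

lemma dirDeriv_sum {ι : Type*} {s : Finset ι} {F : ι → ℝ × EuclideanSpace ℝ (Fin d) → ℝ}
    (h : ∀ i ∈ s, Smooth (F i)) (hp : p ∈ halfSpace d) :
    dirDeriv v (fun q => ∑ i ∈ s, F i q) p = ∑ i ∈ s, dirDeriv v (F i) p := by
  unfold dirDeriv
  rw [fderiv_fun_sum fun i hi => (h i hi).differentiableAt hp, sum_apply]

lemma dirDeriv_comp {Φ : ℝ → ℝ} (hΦ : ContDiff ℝ ∞ Φ) (h : Smooth W) (hp : p ∈ halfSpace d) :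
    dirDeriv v (fun q => Φ (W q)) p = deriv Φ (W p) * dirDeriv v W p := by
  unfold dirDeriv
  have := ((hΦ.differentiable (by simp) (W p)).hasDerivAt.comp_hasFDerivAt p
    (h.differentiableAt hp).hasFDerivAt).fderiv
  simp only [Function.comp_def] at this
  rw [this]; simp

lemma pd_coord (i j : Fin d) :
    pd i (fun q => q.2 j) p = if i = j then 1 else 0 := by
  have : HasFDerivAt (fun q : ℝ × EuclideanSpace ℝ (Fin d) => q.2 j)
      ((EuclideanSpace.proj j).comp (ContinuousLinearMap.snd ℝ ℝ (EuclideanSpace ℝ (Fin d)))) p :=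
    ContinuousLinearMap.hasFDerivAt
      ((EuclideanSpace.proj j).comp (ContinuousLinearMap.snd ℝ ℝ (EuclideanSpace ℝ (Fin d))))
  unfold pd dirDeriv
  rw [this.fderiv]
  simp [eq_comm]

lemma td_coord (j : Fin d) : td (fun q => q.2 j) p = 0 := by
  have : HasFDerivAt (fun q : ℝ × EuclideanSpace ℝ (Fin d) => q.2 j)
      ((EuclideanSpace.proj j).comp (ContinuousLinearMap.snd ℝ ℝ (EuclideanSpace ℝ (Fin d)))) p :=
    ContinuousLinearMap.hasFDerivAt
      ((EuclideanSpace.proj j).comp (ContinuousLinearMap.snd ℝ ℝ (EuclideanSpace ℝ (Fin d))))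
  unfold td dirDeriv
  rw [this.fderiv]
  simp

lemma dirDeriv_comm (h : Smooth W) (hp : p ∈ halfSpace d) :
    dirDeriv v (dirDeriv v' W) p = dirDeriv v' (dirDeriv v W) p := by
  have hs : IsSymmSndFDerivAt ℝ W p :=
    ((h.contDiffAt hp).of_le (m := 2)
      (WithTop.coe_le_coe.2 (le_top : (2 : ℕ∞) ≤ ⊤))).isSymmSndFDerivAt (by simp)
  have hd : DifferentiableAt ℝ (fderiv ℝ W) p :=
    ((h.contDiffAt hp).fderiv_right (m := ∞) (by simp)).differentiableAt (by simp)
  have e : ∀ u u', dirDeriv u (dirDeriv u' W) p = fderiv ℝ (fderiv ℝ W) p u u' := by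
    intro u u'
    unfold dirDeriv
    rw [fderiv_clm_apply hd (by fun_prop)]
    simp
  rw [e, e, hs.eq]

lemma Smooth.contDiff_slice (h : Smooth W) {t : ℝ} (ht : 0 < t) :
    ContDiff ℝ ∞ fun x => W (t, x) := by
  rw [contDiff_iff_contDiffAt]
  intro x
  exact (h.contDiffAt (p := (t, x)) (mem_halfSpace.2 ht)).comp x
    (contDiffAt_const.prodMk contDiffAt_id)

lemma Smooth.fderiv_slice (h : Smooth W) {t : ℝ} (ht : 0 < t) (x : EuclideanSpace ℝ (Fin d))
    (i : Fin d) : fderiv ℝ (fun y => W (t, y)) x (stdBasis i) = pd i W (t, x) := by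
  have h1 : HasFDerivAt (fun y : EuclideanSpace ℝ (Fin d) => (t, y))
      (ContinuousLinearMap.inr ℝ ℝ (EuclideanSpace ℝ (Fin d))) x := hasFDerivAt_prodMk_right t x
  have := ((h.differentiableAt (p := (t, x)) (mem_halfSpace.2 ht)).hasFDerivAt.comp x h1).fderiv
  simp only [Function.comp_def] at this
  rw [this]
  simp [dirDeriv]

lemma Smooth.hasDerivAt_slice (h : Smooth W) {t : ℝ} (ht : 0 < t)
    (x : EuclideanSpace ℝ (Fin d)) : HasDerivAt (fun s => W (s, x)) (td W (t, x)) t := by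
  have h1 : HasDerivAt (fun s : ℝ => (s, x)) (1, 0) t :=
    (hasDerivAt_id t).prodMk (hasDerivAt_const t x)
  exact (h.differentiableAt (p := (t, x)) (mem_halfSpace.2 ht)).hasFDerivAt.comp_hasDerivAt t h1

variable (D C : Matrix (Fin d) (Fin d) ℝ)

/-- The Ornstein–Uhlenbeck generator `L W = ∑ D_ij ∂_i ∂_j W - (Cᵀ x) · ∇ W`, the operator
governing the quotient of a solution of the Fokker–Planck equation by `f_∞`. It acts on functions
on space-time, slice by slice. -/
noncomputable def gen (W : ℝ × EuclideanSpace ℝ (Fin d) → ℝ) (p : ℝ × EuclideanSpace ℝ (Fin d)) :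
    ℝ :=
  ∑ i, ∑ j, D i j * pd i (pd j W) p - ∑ j, (∑ i, C i j * p.2 i) * pd j W p

/-- The carré du champ `∇ aᵀ D ∇ b` of the generator. -/
noncomputable def carre (a b : ℝ × EuclideanSpace ℝ (Fin d) → ℝ)
    (p : ℝ × EuclideanSpace ℝ (Fin d)) : ℝ :=
  ∑ i, ∑ j, D i j * (pd i a p * pd j b p)

/-- `w` is a smooth solution of `∂_t w = L w + α` for `t > 0`, with smooth source `α`. -/
structure HasSource (w α : ℝ × EuclideanSpace ℝ (Fin d) → ℝ) : Prop where
  smooth : Smooth w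
  smooth_source : Smooth α
  eq : ∀ p ∈ halfSpace d, td w p = gen D C w p + α p

variable {D C}

lemma Smooth.generator (h : Smooth W) : Smooth (gen D C W) := by
  unfold gen
  refine Smooth.sub (Smooth.sum fun i _ => Smooth.sum fun j _ => (smooth_const _).mul
    h.derivDir.derivDir) (Smooth.sum fun j _ => Smooth.mul (Smooth.sum fun i _ =>
      (smooth_const _).mul (smooth_coord i)) h.derivDir)

lemma Smooth.carreDuChamp (h : Smooth W) (h' : Smooth W') : Smooth (carre D W W') := by
  unfold carre
  exact Smooth.sum fun i _ => Smooth.sum fun j _ => (smooth_const _).mul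
    (h.derivDir.mul h'.derivDir)

lemma HasSource.td_eqOn {w α : ℝ × EuclideanSpace ℝ (Fin d) → ℝ} (h : HasSource D C w α) :
    EqOn (td w) (fun p => gen D C w p + α p) (halfSpace d) := h.eq

/-- The partial derivatives of a solution solve the same equation, with the commutator of `∂_k`
and the drift added to the source. -/
lemma HasSource.partialDeriv {w α : ℝ × EuclideanSpace ℝ (Fin d) → ℝ} (h : HasSource D C w α)
    (k : Fin d) :
    HasSource D C (pd k w) (fun p => pd k α p - ∑ j, C k j * pd j w p) where
  smooth := h.smooth.derivDir
  smooth_source := h.smooth_source.derivDir.sub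
    (Smooth.sum fun j _ => (smooth_const _).mul h.smooth.derivDir)
  eq := by
    intro p hp
    have s1 : ∀ i j, Smooth fun q => D i j * pd i (pd j w) q :=
      fun i j => (smooth_const _).mul h.smooth.derivDir.derivDir
    have s2 : ∀ j, Smooth fun q : ℝ × EuclideanSpace ℝ (Fin d) => ∑ i, C i j * q.2 i :=
      fun j => Smooth.sum fun i _ => (smooth_const _).mul (smooth_coord i)
    have s3 : ∀ j, Smooth fun q => (∑ i, C i j * q.2 i) * pd j w q :=
      fun j => (s2 j).mul h.smooth.derivDir
    have e0 : pd k (gen D C w) p = ∑ i, ∑ j, D i j * pd i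
        (pd j (pd k w)) p - ∑ j, (C k j * pd j w p +
          (∑ i, C i j * p.2 i) * pd j (pd k w) p) := by
      unfold gen pd
      rw [dirDeriv_sub (Smooth.sum fun i _ => Smooth.sum fun j _ => s1 i j)
        (Smooth.sum fun j _ => s3 j) hp, dirDeriv_sum (fun i _ => Smooth.sum fun j _ => s1 i j) hp,
        dirDeriv_sum (fun j _ => s3 j) hp]
      congr 1
      · refine Finset.sum_congr rfl fun i _ => ?_
        rw [dirDeriv_sum (fun j _ => s1 i j) hp]
        refine Finset.sum_congr rfl fun j _ => ?_
        rw [dirDeriv_const_mul _ h.smooth.derivDir.derivDir hp,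
          dirDeriv_comm h.smooth.derivDir hp,
          dirDeriv_congr (fun q hq => dirDeriv_comm h.smooth hq) hp]
      · refine Finset.sum_congr rfl fun j _ => ?_
        rw [dirDeriv_mul (s2 j) h.smooth.derivDir hp,
          dirDeriv_sum (fun i _ => (smooth_const _).mul (smooth_coord i)) hp,
          dirDeriv_comm h.smooth hp]
        congr 2
        rw [Finset.sum_eq_single k]
        · rw [dirDeriv_const_mul _ (smooth_coord k) hp]
          have := pd_coord (p := p) k k
          simp only [pd] at this
          rw [this]; simp
        · intro i _ hik
          rw [dirDeriv_const_mul _ (smooth_coord i) hp]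
          have := pd_coord (p := p) k i
          simp only [pd] at this
          rw [this, if_neg (Ne.symm hik)]; simp
        · simp
    have e1 : td (pd k w) p =
        pd k (gen D C w) p + pd k α p := by
      unfold td pd
      rw [dirDeriv_comm h.smooth hp, dirDeriv_congr h.td_eqOn hp,
        dirDeriv_add h.smooth.generator h.smooth_source hp]
    rw [e1, e0, Finset.sum_add_distrib]
    unfold gen
    ring

/-- The product rule `(∂_t - L)(a b) = a (∂_t - L) b + b (∂_t - L) a - 2 ∇aᵀ D ∇b`. -/
lemma HasSource.mul (hD : Dᵀ = D) {a b α β : ℝ × EuclideanSpace ℝ (Fin d) → ℝ}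
    (ha : HasSource D C a α) (hb : HasSource D C b β) :
    HasSource D C (fun p => a p * b p)
      (fun p => a p * β p + α p * b p - 2 * carre D a b p) where
  smooth := ha.smooth.mul hb.smooth
  smooth_source := ((ha.smooth.mul hb.smooth_source).add (ha.smooth_source.mul hb.smooth)).sub
    ((smooth_const 2).mul (ha.smooth.carreDuChamp hb.smooth))
  eq := by
    intro p hp
    have e1 : ∀ j, ∀ q ∈ halfSpace d, pd j (fun p => a p * b p) q =
        pd j a q * b q + a q * pd j b q := fun j q hq =>
      dirDeriv_mul ha.smooth hb.smooth hq
    have e2 : ∀ i j, pd i (pd j (fun p => a p * b p)) p =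
        pd i (pd j a) p * b p +
          pd j a p * pd i b p +
          (pd i a p * pd j b p +
            a p * pd i (pd j b) p) := by
      intro i j
      unfold pd at e1 ⊢
      rw [dirDeriv_congr (e1 j) hp, dirDeriv_add (ha.smooth.derivDir.mul hb.smooth)
        (ha.smooth.mul hb.smooth.derivDir) hp, dirDeriv_mul ha.smooth.derivDir hb.smooth hp,
        dirDeriv_mul ha.smooth hb.smooth.derivDir hp]
    have hsym : ∑ i, ∑ j, D i j * (pd j a p * pd i b p) =
        carre D a b p := by
      unfold carre
      rw [Finset.sum_comm]
      refine Finset.sum_congr rfl fun i _ => Finset.sum_congr rfl fun j _ => ?_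
      rw [show D j i = D i j from congrFun (congrFun hD i) j]
    have e3 : gen D C (fun p => a p * b p) p =
        gen D C a p * b p + a p * gen D C b p + 2 * carre D a b p := by
      have : 2 * carre D a b p = carre D a b p +
        ∑ i, ∑ j, D i j * (pd j a p * pd i b p) := by rw [hsym]; ring
      rw [this]
      unfold gen carre
      simp only [e2, e1 _ p hp, sub_mul, mul_sub, Finset.sum_mul, Finset.mul_sum, mul_add,
        Finset.sum_add_distrib]
      have r1 : ∀ i j, D i j * (pd i (pd j a) p * b p) =
        D i j * pd i (pd j a) p * b p := fun i j => by ring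
      have r2 : ∀ i j, D i j * (a p * pd i (pd j b) p) =
        a p * (D i j * pd i (pd j b) p) := fun i j => by ring
      have r3 : ∀ i j, C i j * p.2 i * (pd j a p * b p) =
        C i j * p.2 i * pd j a p * b p := fun i j => by ring
      have r4 : ∀ i j, C i j * p.2 i * (a p * pd j b p) =
        a p * (C i j * p.2 i * pd j b p) := fun i j => by ring
      simp only [r1, r2, r3, r4]
      ring
    have e4 : td (fun p => a p * b p) p = td a p * b p + a p * td b p :=
      dirDeriv_mul ha.smooth hb.smooth hp
    rw [e4, ha.eq p hp, hb.eq p hp, e3]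
    ring

/-- The chain rule `(∂_t - L) Φ(w) = -Φ''(w) ∇wᵀ D ∇w` when `(∂_t - L) w = 0`. -/
lemma HasSource.comp {Φ : ℝ → ℝ} (hΦ : ContDiff ℝ ∞ Φ) {w : ℝ × EuclideanSpace ℝ (Fin d) → ℝ}
    (hw : HasSource D C w (fun _ => 0)) :
    HasSource D C (fun p => Φ (w p)) (fun p => - (deriv (deriv Φ) (w p) * carre D w w p)) where
  smooth := Smooth.comp hΦ hw.smooth
  smooth_source := (Smooth.mul (Smooth.comp (contDiff_infty_iff_deriv.1
    (contDiff_infty_iff_deriv.1 hΦ).2).2 hw.smooth) (hw.smooth.carreDuChamp hw.smooth)).neg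
  eq := by
    intro p hp
    have hΦ' : ContDiff ℝ ∞ (deriv Φ) := (contDiff_infty_iff_deriv.1 hΦ).2
    have e1 : ∀ j, ∀ q ∈ halfSpace d, pd j (fun p => Φ (w p)) q =
        deriv Φ (w q) * pd j w q := fun j q hq => dirDeriv_comp hΦ hw.smooth hq
    have e2 : ∀ i j, pd i (pd j (fun p => Φ (w p))) p =
        deriv (deriv Φ) (w p) * pd i w p * pd j w p +
          deriv Φ (w p) * pd i (pd j w) p := by
      intro i j
      unfold pd at e1 ⊢
      rw [dirDeriv_congr (e1 j) hp, dirDeriv_mul (Smooth.comp hΦ' hw.smooth) hw.smooth.derivDir hp,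
        dirDeriv_comp hΦ' hw.smooth hp]
    have e3 : gen D C (fun p => Φ (w p)) p =
        deriv Φ (w p) * gen D C w p + deriv (deriv Φ) (w p) * carre D w w p := by
      unfold gen carre
      simp only [e2, e1 _ p hp, mul_sub, Finset.sum_mul, Finset.mul_sum, mul_add,
        Finset.sum_add_distrib]
      have r1 : ∀ i j, D i j * (deriv (deriv Φ) (w p) * pd i w p *
          pd j w p) = deriv (deriv Φ) (w p) *
          (D i j * (pd i w p * pd j w p)) := fun i j => by ring
      have r2 : ∀ i j, D i j * (deriv Φ (w p) * pd i (pd j w) p) =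
        deriv Φ (w p) * (D i j * pd i (pd j w) p) := fun i j => by ring
      have r3 : ∀ i j, C i j * p.2 i * (deriv Φ (w p) * pd j w p) =
        deriv Φ (w p) * (C i j * p.2 i * pd j w p) := fun i j => by ring
      simp only [r1, r2, r3]
      ring
    have e4 : td (fun p => Φ (w p)) p = deriv Φ (w p) * td w p := dirDeriv_comp hΦ hw.smooth hp
    rw [e4, hw.eq p hp, e3]
    ring

/-- The coordinate functions do not depend on time and satisfy `L x_k = -(Cᵀ x)_k`. -/
lemma hasSource_coord (k : Fin d) :
    HasSource D C (fun p => p.2 k) (fun p => ∑ i, C i k * p.2 i) where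
  smooth := smooth_coord k
  smooth_source := Smooth.sum fun i _ => (smooth_const _).mul (smooth_coord i)
  eq := by
    intro p hp
    have e1 : ∀ j, pd j (fun q => q.2 k) = fun _ => if j = k then 1 else 0 :=
      fun j => funext fun q => pd_coord j k
    rw [td_coord]
    unfold gen
    simp only [e1]
    simp [pd, dirDeriv_const]

end Generator

/-! ### Integration by parts and cutoffs -/

section Duality

variable {d : ℕ}

/-- The standard Gaussian measure `f_∞ dx`. -/
noncomputable abbrev gauss (d : ℕ) : Measure (EuclideanSpace ℝ (Fin d)) :=
  ProbabilityTheory.stdGaussian (EuclideanSpace ℝ (Fin d))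

/-- The partial derivative `∂_i` of a function on `ℝ^d`. -/
noncomputable def sd (i : Fin d) (u : EuclideanSpace ℝ (Fin d) → ℝ)
    (x : EuclideanSpace ℝ (Fin d)) : ℝ :=
  fderiv ℝ u x (stdBasis i)

/-- The adjoint `L* χ = ∑ D_ij ∂_i ∂_j χ - (C x) · ∇ χ` of the Ornstein–Uhlenbeck generator in
`L²` of the Gaussian measure, when `C + Cᵀ = 2 D`. -/
noncomputable def adjGen (D C : Matrix (Fin d) (Fin d) ℝ) (χ : EuclideanSpace ℝ (Fin d) → ℝ)
    (x : EuclideanSpace ℝ (Fin d)) : ℝ :=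
  ∑ i, ∑ j, D i j * sd i (sd j χ) x - ∑ i, (∑ j, C i j * x j) * sd i χ x

lemma contDiff_sd {u : EuclideanSpace ℝ (Fin d) → ℝ} (hu : ContDiff ℝ ∞ u) (i : Fin d) :
    ContDiff ℝ ∞ (sd i u) :=
  (hu.fderiv_right (m := ∞) (by simp)).clm_apply contDiff_const

lemma hasCompactSupport_sd {u : EuclideanSpace ℝ (Fin d) → ℝ} (hu : HasCompactSupport u)
    (i : Fin d) : HasCompactSupport (sd i u) :=
  hu.fderiv_apply ℝ _

lemma sd_eq_zero_of_notMem_tsupport {u : EuclideanSpace ℝ (Fin d) → ℝ}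
    {x : EuclideanSpace ℝ (Fin d)} (hx : x ∉ tsupport u) {i : Fin d} : sd i u x = 0 := by
  unfold sd
  rw [(notMem_tsupport_iff_eventuallyEq.1 hx).fderiv_eq]
  simp

lemma sd_sd_eq_zero_of_notMem_tsupport {u : EuclideanSpace ℝ (Fin d) → ℝ}
    {x : EuclideanSpace ℝ (Fin d)} (hx : x ∉ tsupport u) {i j : Fin d} :
    sd i (sd j u) x = 0 := by
  have : sd j u =ᶠ[𝓝 x] fun _ => 0 :=
    Filter.eventuallyEq_of_mem ((isClosed_tsupport _).isOpen_compl.mem_nhds hx)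
      fun _ hz => sd_eq_zero_of_notMem_tsupport hz
  rw [sd, this.fderiv_eq]
  simp

lemma integral_sd_mul {a b : EuclideanSpace ℝ (Fin d) → ℝ} (i : Fin d) (ha : ContDiff ℝ ∞ a)
    (hb : ContDiff ℝ ∞ b) (hbc : HasCompactSupport b) :
    ∫ x, sd i a x * b x ∂gauss d =
      ∫ x, a x * (x i * b x) ∂gauss d - ∫ x, a x * sd i b x ∂gauss d := by
  have c1 := (contDiff_sd ha i).continuous
  have c2 := (contDiff_sd hb i).continuous
  have c3 := ha.continuous
  have c4 := hb.continuous
  have i1 : Integrable (fun x => a x * (x i * b x)) (gauss d) :=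
    Continuous.integrable_of_hasCompactSupport (by fun_prop) (hbc.mul_left.mul_left)
  have i2 : Integrable (fun x => a x * sd i b x) (gauss d) :=
    Continuous.integrable_of_hasCompactSupport (by fun_prop) (hasCompactSupport_sd hbc i).mul_left
  rw [← integral_sub i1 i2]
  have := integral_fderiv_mul_stdGaussian i (ha.differentiable (by simp))
    (hb.differentiable (by simp))
    (Continuous.integrable_of_hasCompactSupport (c1.mul c4) hbc.mul_left)
    (by simp only [mul_sub]; exact i1.sub i2)
    (Continuous.integrable_of_hasCompactSupport (c3.mul c4) hbc.mul_left)
  simp only [sd]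
  rw [this]
  simp only [mul_sub]

lemma sum_sum_eq_zero_of_antisymm {F : Fin d → Fin d → ℝ} (hF : ∀ i j, F i j + F j i = 0) :
    ∑ i, ∑ j, F i j = 0 := by
  have : 2 * ∑ i, ∑ j, F i j = 0 := by
    calc 2 * ∑ i, ∑ j, F i j = ∑ i, ∑ j, F i j + ∑ i, ∑ j, F j i := by
          rw [two_mul]; congr 1; exact Finset.sum_comm
      _ = 0 := by simp only [← Finset.sum_add_distrib, hF, Finset.sum_const_zero]
  linarith

lemma sd_coord_mul {b : EuclideanSpace ℝ (Fin d) → ℝ} (hb : ContDiff ℝ ∞ b) (i j : Fin d)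
    (x : EuclideanSpace ℝ (Fin d)) :
    sd j (fun y => y i * b y) x = (if i = j then 1 else 0) * b x + x i * sd j b x := by
  have h1 : HasFDerivAt (𝕜 := ℝ) (fun y : EuclideanSpace ℝ (Fin d) => (y i : ℝ))
      (EuclideanSpace.proj i : EuclideanSpace ℝ (Fin d) →L[ℝ] ℝ) x :=
    (EuclideanSpace.proj i : EuclideanSpace ℝ (Fin d) →L[ℝ] ℝ).hasFDerivAt
  unfold sd
  rw [(h1.fun_mul (hb.differentiable (by simp) x).hasFDerivAt).fderiv]
  simp
  ring

/-- Duality of the generator and `adjGen` in `L²` of the Gaussian measure. Both sides become sums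
over pairs `(i, j)` after moving all derivatives onto the test function; they agree after
symmetrization, where `C + Cᵀ = 2 D` enters. -/
lemma integral_gen_mul {D C : Matrix (Fin d) (Fin d) ℝ} (hDC : ∀ i j, 2 * D i j = C i j + C j i)
    {u χ : EuclideanSpace ℝ (Fin d) → ℝ} (hu : ContDiff ℝ ∞ u) (hχ : ContDiff ℝ ∞ χ)
    (hc : HasCompactSupport χ) :
    ∫ x, (∑ i, ∑ j, D i j * sd i (sd j u) x - ∑ j, (∑ i, C i j * x i) * sd j u x) * χ x ∂gauss d =
      ∫ x, u x * adjGen D C χ x ∂gauss d := by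
  have cu := hu.continuous
  have cχ := hχ.continuous
  have c1 := fun i => (contDiff_sd hu i).continuous
  have c2 := fun i j => (contDiff_sd (contDiff_sd hu j) i).continuous
  have c3 := fun i => (contDiff_sd hχ i).continuous
  have c4 := fun i j => (contDiff_sd (contDiff_sd hχ j) i).continuous
  have hx : ∀ i, ContDiff ℝ ∞ fun y : EuclideanSpace ℝ (Fin d) => y i * χ y := fun i => by fun_prop
  have hxc : ∀ i, HasCompactSupport fun y : EuclideanSpace ℝ (Fin d) => y i * χ y :=
    fun i => hc.mul_left
  have I1 : ∀ i j, Integrable (fun x => sd i (sd j u) x * χ x) (gauss d) := fun i j =>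
    Continuous.integrable_of_hasCompactSupport ((c2 i j).mul cχ) hc.mul_left
  have I2 : ∀ i j, Integrable (fun x => sd j u x * (x i * χ x)) (gauss d) := fun i j =>
    Continuous.integrable_of_hasCompactSupport ((c1 j).mul (hx i).continuous) (hxc i).mul_left
  have J1 : ∀ i j, Integrable (fun x => u x * (x j * (x i * χ x))) (gauss d) := fun i j =>
    Continuous.integrable_of_hasCompactSupport (by fun_prop) (hxc i).mul_left.mul_left
  have J2 : ∀ i j, Integrable (fun x => u x * ((if i = j then 1 else 0) * χ x + x i * sd j χ x))
      (gauss d) := fun i j =>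
    Continuous.integrable_of_hasCompactSupport
      (cu.mul ((continuous_const.mul cχ).add (Continuous.mul (by fun_prop) (c3 j))))
      (HasCompactSupport.mul_left (hc.mul_left.add (hasCompactSupport_sd hc j).mul_left))
  have J3 : ∀ i j, Integrable (fun x => u x * (x j * sd i χ x)) (gauss d) := fun i j =>
    Continuous.integrable_of_hasCompactSupport
      (cu.mul (Continuous.mul (by fun_prop) (c3 i))) (hasCompactSupport_sd hc i).mul_left.mul_left
  have J4 : ∀ i j, Integrable (fun x => u x * sd j (sd i χ) x) (gauss d) := fun i j =>
    Continuous.integrable_of_hasCompactSupport (cu.mul (c4 j i))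
      (hasCompactSupport_sd (hasCompactSupport_sd hc i) j).mul_left
  have E1 : ∀ i j, ∫ x, sd i (sd j u) x * χ x ∂gauss d =
      ∫ x, sd j u x * (x i * χ x) ∂gauss d -
        (∫ x, u x * (x j * sd i χ x) ∂gauss d - ∫ x, u x * sd j (sd i χ) x ∂gauss d) := by
    intro i j
    rw [integral_sd_mul i (contDiff_sd hu j) hχ hc,
      integral_sd_mul j hu (contDiff_sd hχ i) (hasCompactSupport_sd hc i)]
  have E2 : ∀ i j, ∫ x, sd j u x * (x i * χ x) ∂gauss d =
      ∫ x, u x * (x j * (x i * χ x)) ∂gauss d -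
        ∫ x, u x * ((if i = j then 1 else 0) * χ x + x i * sd j χ x) ∂gauss d := by
    intro i j
    rw [integral_sd_mul j hu (hx i) (hxc i)]
    simp only [sd_coord_mul hχ]
  have L : ∀ x, (∑ i, ∑ j, D i j * sd i (sd j u) x - ∑ j, (∑ i, C i j * x i) * sd j u x) * χ x =
      ∑ i, ∑ j, (D i j * (sd i (sd j u) x * χ x) - C i j * (sd j u x * (x i * χ x))) := by
    intro x
    simp only [Finset.sum_sub_distrib, sub_mul, Finset.sum_mul]
    congr 1
    · exact Finset.sum_congr rfl fun i _ => Finset.sum_congr rfl fun j _ => by ring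
    · rw [Finset.sum_comm]
      exact Finset.sum_congr rfl fun i _ => Finset.sum_congr rfl fun j _ => by ring
  have R : ∀ x, u x * adjGen D C χ x = ∑ i, ∑ j, (D i j * ((u x * (x j * (x i * χ x)) -
        u x * ((if i = j then 1 else 0) * χ x + x i * sd j χ x)) -
        (u x * (x j * sd i χ x) - u x * sd j (sd i χ) x)) -
      C i j * (u x * (x j * (x i * χ x)) -
        u x * ((if i = j then 1 else 0) * χ x + x i * sd j χ x))) := by
    intro x
    have e : u x * adjGen D C χ x = ∑ i, ∑ j, (u x * (D i j * sd i (sd j χ) x) -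
        u x * (C i j * x j * sd i χ x)) := by
      unfold adjGen
      simp only [Finset.sum_sub_distrib, mul_sub, Finset.mul_sum, Finset.sum_mul]
    rw [e, ← sub_eq_zero, ← Finset.sum_sub_distrib]
    simp only [← Finset.sum_sub_distrib]
    -- the `(i, j)` and `(j, i)` terms cancel because `D` is the symmetric part of `C`
    set F : Fin d → Fin d → ℝ := fun i j => u x * (D i j * sd i (sd j χ) x) -
      u x * (C i j * x j * sd i χ x) - (D i j * ((u x * (x j * (x i * χ x)) -
        u x * ((if i = j then 1 else 0) * χ x + x i * sd j χ x)) -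
        (u x * (x j * sd i χ x) - u x * sd j (sd i χ) x)) -
      C i j * (u x * (x j * (x i * χ x)) -
        u x * ((if i = j then 1 else 0) * χ x + x i * sd j χ x))) with hF
    have hanti : ∀ i j, F i j + F j i = 0 := by
      intro i j
      have h1 : D i j = (C i j + C j i) / 2 := by linarith [hDC i j]
      have h2 : D j i = (C i j + C j i) / 2 := by linarith [hDC j i]
      have h3 : (if j = i then (1 : ℝ) else 0) = if i = j then 1 else 0 := by simp [eq_comm]
      simp only [hF, h1, h2, h3]
      ring
    exact sum_sum_eq_zero_of_antisymm hanti
  have J12 : ∀ i j, Integrable (fun x => u x * (x j * (x i * χ x)) -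
        u x * ((if i = j then 1 else 0) * χ x + x i * sd j χ x)) (gauss d) :=
    fun i j => (J1 i j).sub (J2 i j)
  have J34 : ∀ i j, Integrable (fun x => u x * (x j * sd i χ x) - u x * sd j (sd i χ) x)
      (gauss d) := fun i j => (J3 i j).sub (J4 i j)
  have J14 : ∀ i j, Integrable (fun x => u x * (x j * (x i * χ x)) -
        u x * ((if i = j then 1 else 0) * χ x + x i * sd j χ x) -
        (u x * (x j * sd i χ x) - u x * sd j (sd i χ) x)) (gauss d) :=
    fun i j => (J12 i j).sub (J34 i j)
  have T1 : ∀ i j, Integrable (fun x => D i j * (sd i (sd j u) x * χ x) -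
      C i j * (sd j u x * (x i * χ x))) (gauss d) :=
    fun i j => ((I1 i j).const_mul _).sub ((I2 i j).const_mul _)
  have T2 : ∀ i j, Integrable (fun x => D i j * ((u x * (x j * (x i * χ x)) -
        u x * ((if i = j then 1 else 0) * χ x + x i * sd j χ x)) -
        (u x * (x j * sd i χ x) - u x * sd j (sd i χ) x)) -
      C i j * (u x * (x j * (x i * χ x)) -
        u x * ((if i = j then 1 else 0) * χ x + x i * sd j χ x))) (gauss d) :=
    fun i j => ((J14 i j).const_mul _).sub ((J12 i j).const_mul _)
  rw [integral_congr_ae (ae_of_all _ L), integral_congr_ae (ae_of_all _ R),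
    integral_finsetSum _ fun i _ => integrable_finsetSum _ fun j _ => T1 i j,
    integral_finsetSum _ fun i _ => integrable_finsetSum _ fun j _ => T2 i j]
  refine Finset.sum_congr rfl fun i _ => ?_
  rw [integral_finsetSum _ fun j _ => T1 i j, integral_finsetSum _ fun j _ => T2 i j]
  refine Finset.sum_congr rfl fun j _ => ?_
  rw [integral_sub ((I1 i j).const_mul _) ((I2 i j).const_mul _),
    integral_sub ((J14 i j).const_mul _) ((J12 i j).const_mul _)]
  simp only [integral_const_mul]
  rw [integral_sub (J12 i j) (J34 i j), integral_sub (J1 i j) (J2 i j),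
    integral_sub (J3 i j) (J4 i j), E1, E2]

lemma sd_comp_smul {u : EuclideanSpace ℝ (Fin d) → ℝ} (hu : Differentiable ℝ u) (r : ℝ)
    (i : Fin d) : sd i (fun x => u (r • x)) = fun x => r * sd i u (r • x) := by
  ext x
  have h1 : HasFDerivAt (fun y : EuclideanSpace ℝ (Fin d) => r • y)
      (r • ContinuousLinearMap.id ℝ _) x := (hasFDerivAt_id x).const_smul r
  have := ((hu (r • x)).hasFDerivAt.comp x h1).fderiv
  simp only [Function.comp_def] at this
  unfold sd
  rw [this]
  simp

/-- A sequence of cutoffs `χ_n(x) = φ(x / (n + 1))`. Since `C x` grows only linearly, `L* χ_n`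
stays bounded, and it vanishes near every fixed point for large `n`. -/
lemma exists_cutoff (D C : Matrix (Fin d) (Fin d) ℝ) :
    ∃ (χ : ℕ → EuclideanSpace ℝ (Fin d) → ℝ) (K : ℝ), (∀ n, ContDiff ℝ ∞ (χ n)) ∧
      (∀ n, HasCompactSupport (χ n)) ∧ (∀ n x, 0 ≤ χ n x) ∧ (∀ n x, χ n x ≤ 1) ∧
      (∀ x, Tendsto (fun n => χ n x) atTop (𝓝 1)) ∧ (∀ n x, |adjGen D C (χ n) x| ≤ K) ∧
      (∀ x, Tendsto (fun n => adjGen D C (χ n) x) atTop (𝓝 0)) := by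
  let φ : ContDiffBump (0 : EuclideanSpace ℝ (Fin d)) := ⟨1, 2, by norm_num, by norm_num⟩
  have hφ : ContDiff ℝ ∞ φ := φ.contDiff
  have hφc : HasCompactSupport φ := φ.hasCompactSupport
  have c1 := fun i => (contDiff_sd hφ i).continuous
  have c2 := fun i j => (contDiff_sd (contDiff_sd hφ j) i).continuous
  let a : EuclideanSpace ℝ (Fin d) → ℝ := fun y => ∑ i, ∑ j, D i j * sd i (sd j φ) y
  let b : EuclideanSpace ℝ (Fin d) → ℝ := fun y => ∑ i, (∑ j, C i j * y j) * sd i φ y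
  have hball : ∀ y ∈ Metric.ball (0 : EuclideanSpace ℝ (Fin d)) 1, φ y = 1 := fun y hy =>
    φ.one_of_mem_closedBall (Metric.ball_subset_closedBall hy)
  have hs : ∀ i, ∀ y ∈ Metric.ball (0 : EuclideanSpace ℝ (Fin d)) 1, sd i φ y = 0 := by
    intro i y hy
    have : (φ : EuclideanSpace ℝ (Fin d) → ℝ) =ᶠ[𝓝 y] fun _ => 1 :=
      Filter.eventuallyEq_of_mem (Metric.isOpen_ball.mem_nhds hy) hball
    unfold sd
    rw [this.fderiv_eq]; simp
  have hss : ∀ i j, ∀ y ∈ Metric.ball (0 : EuclideanSpace ℝ (Fin d)) 1, sd i (sd j φ) y = 0 := by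
    intro i j y hy
    have : sd j φ =ᶠ[𝓝 y] fun _ => 0 :=
      Filter.eventuallyEq_of_mem (Metric.isOpen_ball.mem_nhds hy) (hs j)
    rw [sd, this.fderiv_eq]; simp
  have hac : Continuous a := continuous_finsetSum _ fun i _ => continuous_finsetSum _ fun j _ =>
    continuous_const.mul (c2 i j)
  have hbc : Continuous b := continuous_finsetSum _ fun i _ =>
    Continuous.mul (by fun_prop) (c1 i)
  have hsupp : ∀ y, y ∉ tsupport φ → a y = 0 ∧ b y = 0 := by
    intro y hy
    simp [a, b, sd_eq_zero_of_notMem_tsupport hy, sd_sd_eq_zero_of_notMem_tsupport hy]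
  obtain ⟨Ka, hKa⟩ := hac.bounded_above_of_compact_support
    (HasCompactSupport.intro hφc fun y hy => (hsupp y hy).1)
  obtain ⟨Kb, hKb⟩ := hbc.bounded_above_of_compact_support
    (HasCompactSupport.intro hφc fun y hy => (hsupp y hy).2)
  let r : ℕ → ℝ := fun n => ((n : ℝ) + 1)⁻¹
  have hr0 : ∀ n, 0 < r n := fun n => by positivity
  have hr1 : ∀ n, r n ≤ 1 := fun n => inv_le_one_of_one_le₀ (by simp)
  have hrt : Tendsto r atTop (𝓝 0) := by
    have := tendsto_one_div_add_atTop_nhds_zero_nat (𝕜 := ℝ)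
    simpa [r] using this
  have hev : ∀ x : EuclideanSpace ℝ (Fin d), ∀ᶠ n in atTop, r n • x ∈ Metric.ball 0 1 := by
    intro x
    have : Tendsto (fun n => r n • x) atTop (𝓝 0) := by simpa using hrt.smul_const x
    exact this.eventually (Metric.ball_mem_nhds _ one_pos)
  have hadj : ∀ n x, adjGen D C (fun x => φ (r n • x)) x = r n ^ 2 * a (r n • x) - b (r n • x) := by
    intro n x
    unfold adjGen
    have e2 : ∀ i j, sd i (sd j (fun x => φ (r n • x))) x =
        r n ^ 2 * sd i (sd j φ) (r n • x) := by
      intro i j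
      rw [sd_comp_smul (hφ.differentiable (by simp))]
      have h := sd_comp_smul ((contDiff_sd hφ j).differentiable (by simp)) (r n) i
      have hd : DifferentiableAt ℝ (fun x => sd j φ (r n • x)) x :=
        (((contDiff_sd hφ j).comp (contDiff_const_smul (r n))).differentiable (by simp)) x
      have : sd i (fun x => r n * sd j φ (r n • x)) x =
          r n * sd i (fun x => sd j φ (r n • x)) x := by
        unfold sd at hd ⊢
        rw [fderiv_const_mul hd]; simp
      rw [this, h]; ring
    simp only [e2, a, b, Finset.mul_sum]
    simp only [sd_comp_smul (hφ.differentiable (by simp))]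
    congr 1
    · exact Finset.sum_congr rfl fun i _ => Finset.sum_congr rfl fun j _ => by ring
    · refine Finset.sum_congr rfl fun i _ => ?_
      simp only [PiLp.smul_apply, smul_eq_mul, Finset.sum_mul]
      exact Finset.sum_congr rfl fun j _ => by ring
  refine ⟨fun n x => φ (r n • x), Ka + Kb, fun n => hφ.comp (contDiff_const_smul (r n)),
    fun n => hφc.comp_smul (hr0 n).ne', fun n x => φ.nonneg, fun n x => φ.le_one, fun x => ?_,
    fun n x => ?_, fun x => ?_⟩
  · refine tendsto_const_nhds.congr' ?_
    filter_upwards [hev x] with n hn using (hball _ hn).symm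
  · rw [hadj]
    have h1 := hKa (r n • x)
    have h2 := hKb (r n • x)
    rw [Real.norm_eq_abs] at h1 h2
    calc |r n ^ 2 * a (r n • x) - b (r n • x)| ≤ |r n ^ 2 * a (r n • x)| + |b (r n • x)| :=
          abs_sub _ _
      _ ≤ 1 * Ka + Kb := by
          rw [abs_mul, abs_of_nonneg (sq_nonneg (r n))]
          have : r n ^ 2 ≤ 1 := pow_le_one₀ (hr0 n).le (hr1 n)
          gcongr
      _ = Ka + Kb := by ring
  · refine tendsto_const_nhds.congr' ?_
    filter_upwards [hev x] with n hn
    rw [hadj]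
    simp [a, b, hs _ _ hn, hss _ _ _ hn]

end Duality

/-! ### Mass balance and energy estimates -/

section Energy

variable {d : ℕ}

/-- The product of Lebesgue measure on the time interval `(s, t]` with the Gaussian measure. -/
noncomputable abbrev slab (d : ℕ) (s t : ℝ) : Measure (ℝ × EuclideanSpace ℝ (Fin d)) :=
  ((volume : Measure ℝ).restrict (Ioc s t)).prod (gauss d)

lemma slab_eq_restrict (s t : ℝ) :
    slab d s t = ((volume : Measure ℝ).prod (gauss d)).restrict (Ioc s t ×ˢ univ) := by
  rw [← Measure.prod_restrict, Measure.restrict_univ]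

lemma slab_mono {s s' t : ℝ} (h : s' ≤ s) : slab d s t ≤ slab d s' t := by
  rw [slab_eq_restrict, slab_eq_restrict]
  exact Measure.restrict_mono_set _ (prod_mono (Ioc_subset_Ioc_left h) subset_rfl)

lemma ae_slab_mem (s t : ℝ) : ∀ᵐ p ∂slab d s t, p.1 ∈ Ioc s t := by
  rw [slab_eq_restrict]
  filter_upwards [ae_restrict_mem (measurableSet_Ioc.prod MeasurableSet.univ)] with p hp using hp.1

lemma ae_slab_halfSpace {s : ℝ} (hs : 0 < s) (t : ℝ) : ∀ᵐ p ∂slab d s t, p ∈ halfSpace d := by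
  filter_upwards [ae_slab_mem s t] with p hp using mem_halfSpace.2 (hs.trans hp.1)

lemma Smooth.aestronglyMeasurable {W : ℝ × EuclideanSpace ℝ (Fin d) → ℝ} (h : Smooth W) {s : ℝ}
    (hs : 0 < s) (t : ℝ) : AEStronglyMeasurable W (slab d s t) := by
  rw [slab_eq_restrict]
  refine (h.continuousOn.mono ?_).aestronglyMeasurable (measurableSet_Ioc.prod MeasurableSet.univ)
  rintro p ⟨hp, -⟩
  exact mem_halfSpace.2 (hs.trans hp.1)

lemma Smooth.aestronglyMeasurable_slice {W : ℝ × EuclideanSpace ℝ (Fin d) → ℝ} (h : Smooth W)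
    {t : ℝ} (ht : 0 < t) : AEStronglyMeasurable (fun x => W (t, x)) (gauss d) :=
  (h.contDiff_slice ht).continuous.aestronglyMeasurable

lemma Smooth.integrable_mul_cutoff {W : ℝ × EuclideanSpace ℝ (Fin d) → ℝ} (h : Smooth W) {s : ℝ}
    (hs : 0 < s) (t : ℝ) {χ : EuclideanSpace ℝ (Fin d) → ℝ} (hχ : Continuous χ)
    (hc : HasCompactSupport χ) : Integrable (fun p => W p * χ p.2) (slab d s t) := by
  have hK : IsCompact (Icc s t ×ˢ tsupport χ) := isCompact_Icc.prod hc
  have hcont : ContinuousOn (fun p => W p * χ p.2) (Icc s t ×ˢ tsupport χ) := by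
    refine (h.continuousOn.mono ?_).mul (by fun_prop)
    rintro p ⟨hp, -⟩
    exact mem_halfSpace.2 (hs.trans_le hp.1)
  obtain ⟨M, hM⟩ := hK.exists_bound_of_continuousOn hcont
  refine Integrable.of_bound ((h.aestronglyMeasurable hs t).mul
    (by fun_prop : Continuous fun p : ℝ × EuclideanSpace ℝ (Fin d) => χ p.2).aestronglyMeasurable)
    (max M 0) ?_
  filter_upwards [ae_slab_mem s t] with p hp
  by_cases hx : p.2 ∈ tsupport χ
  · exact (hM p ⟨Ioc_subset_Icc_self hp, hx⟩).trans (le_max_left _ _)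
  · simp [image_eq_zero_of_notMem_tsupport hx]

lemma Smooth.integrable_slice_mul_cutoff {W : ℝ × EuclideanSpace ℝ (Fin d) → ℝ} (h : Smooth W)
    {t : ℝ} (ht : 0 < t) {χ : EuclideanSpace ℝ (Fin d) → ℝ} (hχ : Continuous χ)
    (hc : HasCompactSupport χ) : Integrable (fun x => W (t, x) * χ x) (gauss d) :=
  Continuous.integrable_of_hasCompactSupport ((h.contDiff_slice ht).continuous.mul hχ) hc.mul_left

lemma adjGen_continuous {D C : Matrix (Fin d) (Fin d) ℝ} {χ : EuclideanSpace ℝ (Fin d) → ℝ}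
    (hχ : ContDiff ℝ ∞ χ) : Continuous (adjGen D C χ) := by
  refine Continuous.sub (continuous_finsetSum _ fun i _ => continuous_finsetSum _ fun j _ =>
    continuous_const.mul (contDiff_sd (contDiff_sd hχ j) i).continuous) (continuous_finsetSum _
      fun i _ => Continuous.mul (by fun_prop) (contDiff_sd hχ i).continuous)

lemma adjGen_hasCompactSupport {D C : Matrix (Fin d) (Fin d) ℝ}
    {χ : EuclideanSpace ℝ (Fin d) → ℝ} (hc : HasCompactSupport χ) :
    HasCompactSupport (adjGen D C χ) := by
  refine HasCompactSupport.intro hc fun y hy => ?_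
  simp [adjGen, sd_eq_zero_of_notMem_tsupport hy, sd_sd_eq_zero_of_notMem_tsupport hy]

variable {D C : Matrix (Fin d) (Fin d) ℝ}

lemma Smooth.integral_gen_mul_cutoff (hDC : ∀ i j, 2 * D i j = C i j + C j i)
    {u : ℝ × EuclideanSpace ℝ (Fin d) → ℝ} (hu : Smooth u) {t : ℝ} (ht : 0 < t)
    {χ : EuclideanSpace ℝ (Fin d) → ℝ} (hχ : ContDiff ℝ ∞ χ) (hc : HasCompactSupport χ) :
    ∫ x, gen D C u (t, x) * χ x ∂gauss d = ∫ x, u (t, x) * adjGen D C χ x ∂gauss d := by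
  rw [← integral_gen_mul hDC (hu.contDiff_slice ht) hχ hc]
  have e1 : ∀ j, sd j (fun x => u (t, x)) = fun x => pd j u (t, x) := fun j =>
    funext fun x => hu.fderiv_slice ht x j
  have e2 : ∀ i j x, sd i (fun x => pd j u (t, x)) x = pd i (pd j u) (t, x) := fun i j x =>
    hu.derivDir.fderiv_slice ht x i
  simp only [e1, e2]
  rfl

/-- The weak form of `∂_t u = L u + R` against a compactly supported test function. -/
lemma HasSource.integral_mul_cutoff (hDC : ∀ i j, 2 * D i j = C i j + C j i)
    {u R : ℝ × EuclideanSpace ℝ (Fin d) → ℝ} (hu : HasSource D C u R) {s t : ℝ} (hs : 0 < s)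
    (hst : s ≤ t) {χ : EuclideanSpace ℝ (Fin d) → ℝ} (hχ : ContDiff ℝ ∞ χ)
    (hc : HasCompactSupport χ) :
    ∫ x, u (t, x) * χ x ∂gauss d - ∫ x, u (s, x) * χ x ∂gauss d =
      ∫ p, u p * adjGen D C χ p.2 ∂slab d s t + ∫ p, R p * χ p.2 ∂slab d s t := by
  have ht : 0 < t := hs.trans_le hst
  have i0 : Integrable (fun p => td u p * χ p.2) (slab d s t) :=
    hu.smooth.derivDir.integrable_mul_cutoff hs t hχ.continuous hc
  have i1 : Integrable (fun p => u p * adjGen D C χ p.2) (slab d s t) :=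
    hu.smooth.integrable_mul_cutoff hs t (adjGen_continuous hχ) (adjGen_hasCompactSupport hc)
  have i2 : Integrable (fun p => R p * χ p.2) (slab d s t) :=
    hu.smooth_source.integrable_mul_cutoff hs t hχ.continuous hc
  have i12 : Integrable (fun p => u p * adjGen D C χ p.2 + R p * χ p.2) (slab d s t) := i1.add i2
  have hpt : ∀ x, u (t, x) * χ x - u (s, x) * χ x = ∫ τ in Ioc s t, td u (τ, x) * χ x := by
    intro x
    rw [← intervalIntegral.integral_of_le hst]
    refine (intervalIntegral.integral_eq_sub_of_hasDerivAt (f := fun τ => u (τ, x) * χ x)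
      (fun τ hτ => ?_) (ContinuousOn.intervalIntegrable ?_)).symm
    · rw [uIcc_of_le hst] at hτ
      exact (hu.smooth.hasDerivAt_slice (hs.trans_le hτ.1) x).mul_const _
    · rw [uIcc_of_le hst]
      refine ContinuousOn.mul (hu.smooth.derivDir.continuousOn.comp (by fun_prop) ?_)
        continuousOn_const
      intro τ hτ
      exact mem_halfSpace.2 (hs.trans_le hτ.1)
  rw [← integral_sub (hu.smooth.integrable_slice_mul_cutoff ht hχ.continuous hc)
    (hu.smooth.integrable_slice_mul_cutoff hs hχ.continuous hc),
    integral_congr_ae (ae_of_all _ hpt),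
    ← integral_prod_symm (fun p => td u p * χ p.2) i0, ← integral_add i1 i2,
    integral_prod _ i0, integral_prod _ i12]
  refine setIntegral_congr_fun measurableSet_Ioc fun τ hτ => ?_
  have hτ0 : 0 < τ := hs.trans hτ.1
  have e : ∀ x, td u (τ, x) * χ x = gen D C u (τ, x) * χ x + R (τ, x) * χ x := fun x => by
    rw [hu.eq (τ, x) (mem_halfSpace.2 hτ0), add_mul]
  simp only [e]
  rw [integral_add (hu.smooth.generator.integrable_slice_mul_cutoff hτ0 hχ.continuous hc)
      (hu.smooth_source.integrable_slice_mul_cutoff hτ0 hχ.continuous hc),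
    integral_add (hu.smooth.integrable_slice_mul_cutoff hτ0 (adjGen_continuous hχ)
      (adjGen_hasCompactSupport hc))
      (hu.smooth_source.integrable_slice_mul_cutoff hτ0 hχ.continuous hc),
    hu.smooth.integral_gen_mul_cutoff hDC hτ0 hχ hc]

lemma tendsto_integral_mul_of_bounded {α : Type*} [MeasurableSpace α] {μ : Measure α} {F : α → ℝ}
    (hF : Integrable F μ) {c : ℕ → α → ℝ} {c' : α → ℝ} {K : ℝ}
    (hm : ∀ n, AEStronglyMeasurable (c n) μ) (hb : ∀ n x, |c n x| ≤ K)
    (hlim : ∀ x, Tendsto (fun n => c n x) atTop (𝓝 (c' x))) :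
    Tendsto (fun n => ∫ x, F x * c n x ∂μ) atTop (𝓝 (∫ x, F x * c' x ∂μ)) := by
  refine tendsto_integral_of_dominated_convergence (fun x => |F x| * K)
    (fun n => hF.1.mul (hm n)) (hF.abs.mul_const K) (fun n => ae_of_all _ fun x => ?_)
    (ae_of_all _ fun x => (hlim x).const_mul _)
  rw [norm_mul, Real.norm_eq_abs, Real.norm_eq_abs]
  exact mul_le_mul_of_nonneg_left (hb n x) (abs_nonneg _)

/-- Fatou's lemma along cutoffs. -/
lemma integrable_of_integral_mul_le {α : Type*} [MeasurableSpace α] {μ : Measure α} {F : α → ℝ}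
    (hF : AEStronglyMeasurable F μ) (hF0 : ∀ᵐ x ∂μ, 0 ≤ F x) {c : ℕ → α → ℝ}
    (hc0 : ∀ n x, 0 ≤ c n x) (hlim : ∀ x, Tendsto (fun n => c n x) atTop (𝓝 1))
    (hi : ∀ n, Integrable (fun x => F x * c n x) μ) {M : ℝ}
    (hM : ∀ n, ∫ x, F x * c n x ∂μ ≤ M) : Integrable F μ := by
  refine ⟨hF, ?_⟩
  rw [hasFiniteIntegral_iff_ofReal hF0]
  have h1 : ∀ᵐ x ∂μ, Tendsto (fun n => ENNReal.ofReal (F x * c n x)) atTop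
      (𝓝 (ENNReal.ofReal (F x))) := ae_of_all _ fun x =>
    (ENNReal.continuous_ofReal.tendsto _).comp (by simpa using (hlim x).const_mul (F x))
  calc ∫⁻ x, ENNReal.ofReal (F x) ∂μ
      = ∫⁻ x, liminf (fun n => ENNReal.ofReal (F x * c n x)) atTop ∂μ :=
        lintegral_congr_ae (h1.mono fun x hx => hx.liminf_eq.symm)
    _ ≤ liminf (fun n => ∫⁻ x, ENNReal.ofReal (F x * c n x) ∂μ) atTop :=
        lintegral_liminf_le' fun n => (hi n).1.aemeasurable.ennreal_ofReal
    _ ≤ ENNReal.ofReal M := by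
        refine liminf_le_of_le (by isBoundedDefault) fun b hb => ?_
        obtain ⟨n, hn⟩ := hb.exists
        refine hn.trans ?_
        rw [← ofReal_integral_eq_lintegral_ofReal (hi n)
          (hF0.mono fun x hx => mul_nonneg hx (hc0 n x))]
        exact ENNReal.ofReal_le_ofReal (hM n)
    _ < ⊤ := ENNReal.ofReal_lt_top

/-- Mass balance for `∂_t u = L u + R`, valid once `u` and `R` are integrable. -/
lemma HasSource.integral_sub_integral (hDC : ∀ i j, 2 * D i j = C i j + C j i)
    {u R : ℝ × EuclideanSpace ℝ (Fin d) → ℝ} (hu : HasSource D C u R) {s t : ℝ} (hs : 0 < s)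
    (hst : s ≤ t) (hui : Integrable u (slab d s t)) (hRi : Integrable R (slab d s t))
    (hut : Integrable (fun x => u (t, x)) (gauss d))
    (hus : Integrable (fun x => u (s, x)) (gauss d)) :
    ∫ x, u (t, x) ∂gauss d - ∫ x, u (s, x) ∂gauss d = ∫ p, R p ∂slab d s t := by
  obtain ⟨χ, K, hχ, hc, h0, h1, hlim, hK, hlim'⟩ := exists_cutoff D C
  have habs : ∀ n x, |χ n x| ≤ 1 := fun n x => by rw [abs_of_nonneg (h0 n x)]; exact h1 n x
  have mχ : ∀ n, Continuous (χ n) := fun n => (hχ n).continuous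
  have T1 := tendsto_integral_mul_of_bounded hut (c := χ) (fun n => (mχ n).aestronglyMeasurable)
    habs hlim
  have T2 := tendsto_integral_mul_of_bounded hus (c := χ) (fun n => (mχ n).aestronglyMeasurable)
    habs hlim
  have T3 := tendsto_integral_mul_of_bounded hui (c := fun n p => adjGen D C (χ n) p.2)
    (fun n => ((adjGen_continuous (hχ n)).comp continuous_snd).aestronglyMeasurable)
    (fun n p => hK n p.2) (fun p => hlim' p.2)
  have T4 := tendsto_integral_mul_of_bounded hRi (c := fun n p => χ n p.2)
    (fun n => ((mχ n).comp continuous_snd).aestronglyMeasurable)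
    (fun n p => habs n p.2) (fun p => hlim p.2)
  simp only [mul_one, mul_zero, integral_zero] at T1 T2 T3 T4
  refine tendsto_nhds_unique (T1.sub T2) ?_
  have := T3.add T4
  rw [zero_add] at this
  refine this.congr fun n => ?_
  exact (hu.integral_mul_cutoff hDC hs hst (hχ n) (hc n)).symm

/-- Mass balance for a nonnegative `u` with `∂_t u = L u + ρ - σ` and `σ ≥ 0`: the
integrability of `u` at the later time and of the dissipation `σ` is part of the conclusion. -/
lemma HasSource.integrable_of_dissipation (hDC : ∀ i j, 2 * D i j = C i j + C j i)
    {u ρ σ : ℝ × EuclideanSpace ℝ (Fin d) → ℝ} (hu : HasSource D C u fun p => ρ p - σ p)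
    (hρs : Smooth ρ) (hσs : Smooth σ) (hu0 : ∀ p ∈ halfSpace d, 0 ≤ u p)
    (hσ0 : ∀ p ∈ halfSpace d, 0 ≤ σ p) {s t : ℝ} (hs : 0 < s)
    (hst : s ≤ t) (hui : Integrable u (slab d s t)) (hρi : Integrable ρ (slab d s t))
    (hus : Integrable (fun x => u (s, x)) (gauss d)) :
    Integrable (fun x => u (t, x)) (gauss d) ∧ Integrable σ (slab d s t) ∧
      ∫ x, u (t, x) ∂gauss d + ∫ p, σ p ∂slab d s t =
        ∫ x, u (s, x) ∂gauss d + ∫ p, ρ p ∂slab d s t := by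
  have ht : 0 < t := hs.trans_le hst
  obtain ⟨χ, K, hχ, hc, h0, h1, hlim, hK, hlim'⟩ := exists_cutoff D C
  have habs : ∀ n x, |χ n x| ≤ 1 := fun n x => by rw [abs_of_nonneg (h0 n x)]; exact h1 n x
  have mχ : ∀ n, Continuous (χ n) := fun n => (hχ n).continuous
  have T2 := tendsto_integral_mul_of_bounded hus (c := χ) (fun n => (mχ n).aestronglyMeasurable)
    habs hlim
  have T3 := tendsto_integral_mul_of_bounded hui (c := fun n p => adjGen D C (χ n) p.2)
    (fun n => ((adjGen_continuous (hχ n)).comp continuous_snd).aestronglyMeasurable)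
    (fun n p => hK n p.2) (fun p => hlim' p.2)
  have T4 := tendsto_integral_mul_of_bounded hρi (c := fun n p => χ n p.2)
    (fun n => ((mχ n).comp continuous_snd).aestronglyMeasurable)
    (fun n p => habs n p.2) (fun p => hlim p.2)
  obtain ⟨M, hM⟩ := ((T2.add T3).add T4).bddAbove_range
  have iu : ∀ n, Integrable (fun x => u (t, x) * χ n x) (gauss d) := fun n =>
    hu.smooth.integrable_slice_mul_cutoff ht (mχ n) (hc n)
  have iσ : ∀ n, Integrable (fun p => σ p * χ n p.2) (slab d s t) := fun n =>
    hσs.integrable_mul_cutoff hs t (mχ n) (hc n)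
  have iρ : ∀ n, Integrable (fun p => ρ p * χ n p.2) (slab d s t) := fun n =>
    hρs.integrable_mul_cutoff hs t (mχ n) (hc n)
  have bal : ∀ n, ∫ x, u (t, x) * χ n x ∂gauss d + ∫ p, σ p * χ n p.2 ∂slab d s t ≤ M := by
    intro n
    have := hu.integral_mul_cutoff hDC hs hst (hχ n) (hc n)
    simp only [sub_mul] at this
    rw [integral_sub (iρ n) (iσ n)] at this
    have h2 := hM (mem_range_self n)
    linarith
  have hunn : ∀ᵐ x ∂gauss d, 0 ≤ u (t, x) := ae_of_all _ fun x => hu0 _ (mem_halfSpace.2 ht)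
  have hσnn : ∀ᵐ p ∂slab d s t, 0 ≤ σ p := (ae_slab_halfSpace hs t).mono hσ0
  have n1 : ∀ n, 0 ≤ ∫ x, u (t, x) * χ n x ∂gauss d := fun n =>
    integral_nonneg_of_ae (hunn.mono fun x hx => mul_nonneg hx (h0 n x))
  have n2 : ∀ n, 0 ≤ ∫ p, σ p * χ n p.2 ∂slab d s t := fun n =>
    integral_nonneg_of_ae (hσnn.mono fun x hx => mul_nonneg hx (h0 n x.2))
  have r1 : Integrable (fun x => u (t, x)) (gauss d) :=
    integrable_of_integral_mul_le (hu.smooth.aestronglyMeasurable_slice ht) hunn h0 hlim iu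
      (M := M) fun n => by linarith [bal n, n2 n]
  have r2 : Integrable σ (slab d s t) :=
    integrable_of_integral_mul_le (hσs.aestronglyMeasurable hs t) hσnn
      (c := fun n p => χ n p.2) (fun n p => h0 n p.2) (fun p => hlim p.2) iσ
      (M := M) fun n => by linarith [bal n, n1 n]
  refine ⟨r1, r2, ?_⟩
  have := hu.integral_sub_integral hDC hs hst hui (hρi.sub r2) r1 hus
  rw [integral_sub hρi r2] at this
  linarith

/-- Square-integrability on all time slabs bounded away from time `0`. -/
def LocL2 (W : ℝ × EuclideanSpace ℝ (Fin d) → ℝ) : Prop :=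
  ∀ s t : ℝ, 0 < s → MemLp W 2 (slab d s t)

lemma LocL2.sub {a b : ℝ × EuclideanSpace ℝ (Fin d) → ℝ} (ha : LocL2 a) (hb : LocL2 b) :
    LocL2 fun p => a p - b p := fun s t hs => (ha s t hs).sub (hb s t hs)

lemma LocL2.const_mul {a : ℝ × EuclideanSpace ℝ (Fin d) → ℝ} (c : ℝ) (ha : LocL2 a) :
    LocL2 fun p => c * a p := fun s t hs => (ha s t hs).const_mul c

lemma LocL2.sum {ι : Type*} {S : Finset ι} {F : ι → ℝ × EuclideanSpace ℝ (Fin d) → ℝ}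
    (h : ∀ i ∈ S, LocL2 (F i)) : LocL2 fun p => ∑ i ∈ S, F i p := fun s t hs =>
  memLp_finsetSum _ fun i hi => h i hi s t hs

lemma locL2_zero : LocL2 (fun _ : ℝ × EuclideanSpace ℝ (Fin d) => 0) := fun _ _ _ =>
  MemLp.zero'

lemma locL2_coord (i : Fin d) : LocL2 (fun p : ℝ × EuclideanSpace ℝ (Fin d) => p.2 i) :=
  fun _ _ _ => (memLp_coord_stdGaussian i 2 (by simp)).comp_snd _

lemma LocL2.carre_integrable {a b : ℝ × EuclideanSpace ℝ (Fin d) → ℝ}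
    (ha : ∀ i, LocL2 (pd i a)) (hb : ∀ i, LocL2 (pd i b)) {s t : ℝ} (hs : 0 < s) :
    Integrable (carre D a b) (slab d s t) :=
  integrable_finsetSum _ fun i _ => integrable_finsetSum _ fun j _ =>
    ((ha i s t hs).integrable_mul (hb j s t hs)).const_mul _

/-- Energy estimate: a solution that is square-integrable over time slabs, with such a source, is
square-integrable at every positive time, and its gradient is square-integrable over time slabs.
The estimate starts at some earlier time at which the solution is square-integrable. -/
lemma HasSource.energy (hDC : ∀ i j, 2 * D i j = C i j + C j i) (hDs : Dᵀ = D) {c : ℝ}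
    (hc : 0 < c) (hD : ∀ y : Fin d → ℝ, c * ∑ i, y i ^ 2 ≤ ∑ i, ∑ j, D i j * (y i * y j))
    {w α : ℝ × EuclideanSpace ℝ (Fin d) → ℝ} (hw : HasSource D C w α) (hw2 : LocL2 w)
    (hα2 : LocL2 α) :
    (∀ t, 0 < t → MemLp (fun x => w (t, x)) 2 (gauss d)) ∧ ∀ i, LocL2 (pd i w) := by
  have hu : HasSource D C (fun p => w p * w p)
      (fun p => (w p * α p + α p * w p) - 2 * carre D w w p) := hw.mul hDs hw
  have hσ : Smooth fun p => 2 * carre D w w p :=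
    (smooth_const 2).mul (hw.smooth.carreDuChamp hw.smooth)
  have hcarre : ∀ p, c * ∑ i, pd i w p ^ 2 ≤ carre D w w p := fun p => hD fun i => pd i w p
  have hcarre0 : ∀ p, 0 ≤ carre D w w p := fun p =>
    (mul_nonneg hc.le (Finset.sum_nonneg fun i _ => sq_nonneg _)).trans (hcarre p)
  have main : ∀ s t : ℝ, 0 < s → s < t → Integrable (fun x => w (t, x) * w (t, x)) (gauss d) ∧
      Integrable (fun p => 2 * carre D w w p) (slab d s t) := by
    intro s t hs hst
    have hi : Integrable (fun p => w p * w p) (slab d (s / 2) s) :=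
      (hw2 _ _ (by positivity)).integrable_mul (hw2 _ _ (by positivity))
    -- almost every time in `(s / 2, s]` is a suitable initial time
    obtain ⟨r, hr, hri⟩ : ∃ r ∈ Ioc (s / 2) s,
        Integrable (fun x => w (r, x) * w (r, x)) (gauss d) := by
      have h1 := hi.prod_right_ae
      have h2 : ∀ᵐ r ∂(volume : Measure ℝ).restrict (Ioc (s / 2) s), r ∈ Ioc (s / 2) s :=
        ae_restrict_mem measurableSet_Ioc
      have : ((volume : Measure ℝ).restrict (Ioc (s / 2) s)) ≠ 0 := by
        rw [Ne, Measure.restrict_eq_zero, Real.volume_Ioc]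
        simp; linarith
      have : NeBot (ae ((volume : Measure ℝ).restrict (Ioc (s / 2) s))) := ae_neBot.2 this
      obtain ⟨r, h⟩ := (h2.and h1).exists
      exact ⟨r, h.1, h.2⟩
    have hr0 : 0 < r := by linarith [hr.1]
    have hi' : Integrable (fun p => w p * w p) (slab d r t) :=
      (hw2 _ _ hr0).integrable_mul (hw2 _ _ hr0)
    have hα' : Integrable (fun p => w p * α p + α p * w p) (slab d r t) :=
      ((hw2 _ _ hr0).integrable_mul (hα2 _ _ hr0)).add
        ((hα2 _ _ hr0).integrable_mul (hw2 _ _ hr0))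
    obtain ⟨h1, h2, -⟩ := hu.integrable_of_dissipation hDC
      ((hw.smooth.mul hw.smooth_source).add (hw.smooth_source.mul hw.smooth)) hσ
      (fun p _ => mul_self_nonneg _) (fun p _ => mul_nonneg zero_le_two (hcarre0 p)) hr0
      (hr.2.trans hst.le) hi' hα' hri
    exact ⟨h1, h2.mono_measure (slab_mono hr.2)⟩
  refine ⟨fun t ht => ?_, fun i s t hs => ?_⟩
  · refine (memLp_two_iff_integrable_sq (hw.smooth.aestronglyMeasurable_slice ht)).2 ?_
    simpa only [sq] using (main (t / 2) t (by positivity) (by linarith)).1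
  · rcases lt_or_ge s t with hst | hst
    · refine (memLp_two_iff_integrable_sq (hw.smooth.derivDir.aestronglyMeasurable hs t)).2 ?_
      refine ((main s t hs hst).2.const_mul (1 / c)).mono'
        ((hw.smooth.derivDir.aestronglyMeasurable hs t).pow 2) (ae_of_all _ fun p => ?_)
      rw [Real.norm_of_nonneg (sq_nonneg _)]
      have h1 : pd i w p ^ 2 ≤ ∑ i, pd i w p ^ 2 :=
        Finset.single_le_sum (f := fun i => pd i w p ^ 2) (fun _ _ => sq_nonneg _)
          (Finset.mem_univ i)
      have h2 := hcarre p
      have h3 := hcarre0 p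
      rw [one_div, inv_mul_eq_div, le_div_iff₀ hc]
      nlinarith
    · simp [slab, Ioc_eq_empty_of_le hst]

/-- Energy identity: the evolution of `∫ a b dγ` for two solutions. -/
lemma HasSource.integral_mul_sub (hDC : ∀ i j, 2 * D i j = C i j + C j i) (hDs : Dᵀ = D)
    {a b α β : ℝ × EuclideanSpace ℝ (Fin d) → ℝ} (ha : HasSource D C a α)
    (hb : HasSource D C b β) (ha2 : LocL2 a) (hb2 : LocL2 b) (hα2 : LocL2 α) (hβ2 : LocL2 β)
    (hat : ∀ t, 0 < t → MemLp (fun x => a (t, x)) 2 (gauss d))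
    (hbt : ∀ t, 0 < t → MemLp (fun x => b (t, x)) 2 (gauss d))
    (ha' : ∀ i, LocL2 (pd i a)) (hb' : ∀ i, LocL2 (pd i b)) {s t : ℝ} (hs : 0 < s) (hst : s ≤ t) :
    Integrable (fun p => a p * β p + α p * b p - 2 * carre D a b p) (slab d s t) ∧
    ∫ x, a (t, x) * b (t, x) ∂gauss d - ∫ x, a (s, x) * b (s, x) ∂gauss d =
      ∫ τ in s..t, ∫ x, (a (τ, x) * β (τ, x) + α (τ, x) * b (τ, x) - 2 * carre D a b (τ, x))
        ∂gauss d := by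
  have hi : Integrable (fun p => a p * β p + α p * b p - 2 * carre D a b p) (slab d s t) :=
    (((ha2 _ _ hs).integrable_mul (hβ2 _ _ hs)).add ((hα2 _ _ hs).integrable_mul
      (hb2 _ _ hs))).sub ((LocL2.carre_integrable ha' hb' hs).const_mul 2)
  refine ⟨hi, ?_⟩
  rw [(ha.mul hDs hb).integral_sub_integral hDC hs hst
      ((ha2 _ _ hs).integrable_mul (hb2 _ _ hs)) hi
      ((hat t (hs.trans_le hst)).integrable_mul (hbt t (hs.trans_le hst)))
      ((hat s hs).integrable_mul (hbt s hs)), intervalIntegral.integral_of_le hst,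
    integral_prod _ hi]

end Energy

/-! ### The quotient of a solution by the equilibrium -/

section Quotient

variable {d : ℕ}

lemma gradient_apply {u : EuclideanSpace ℝ (Fin d) → ℝ} (x : EuclideanSpace ℝ (Fin d)) (i : Fin d) :
    (gradient u x).ofLp i = sd i u x := by
  have h : inner ℝ (gradient u x) (stdBasis i) = fderiv ℝ u x (stdBasis i) := by
    unfold gradient
    exact InnerProductSpace.toDual_symm_apply
  rw [sd, ← h, EuclideanSpace.inner_single_right]
  simp

lemma sd_mul {a b : EuclideanSpace ℝ (Fin d) → ℝ} (ha : ContDiff ℝ ∞ a) (hb : ContDiff ℝ ∞ b)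
    (i : Fin d) (x : EuclideanSpace ℝ (Fin d)) :
    sd i (fun y => a y * b y) x = sd i a x * b x + a x * sd i b x := by
  unfold sd
  rw [fderiv_fun_mul (ha.differentiable (by simp) x) (hb.differentiable (by simp) x)]
  simp only [add_apply, smul_apply, smul_eq_mul]
  ring

/-- Conjugation by `f_∞` turns the Fokker–Planck operator into the Ornstein–Uhlenbeck generator. -/
lemma fokkerPlanckOp_mul_finf {D C : Matrix (Fin d) (Fin d) ℝ}
    (hDC : ∀ i j, 2 * D i j = C i j + C j i) {h : EuclideanSpace ℝ (Fin d) → ℝ}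
    (hh : ContDiff ℝ ∞ h) (x : EuclideanSpace ℝ (Fin d)) :
    fokkerPlanckOp D C (fun y => h y * finf d y) x =
      (∑ i, ∑ j, D i j * sd i (sd j h) x - ∑ j, (∑ i, C i j * x i) * sd j h x) * finf d x := by
  let G : Fin d → EuclideanSpace ℝ (Fin d) → ℝ := fun i y =>
    ∑ j, (D i j * (sd j h y - y j * h y) + C i j * (y j * h y))
  have hy : ∀ j, ContDiff ℝ ∞ fun y : EuclideanSpace ℝ (Fin d) => y j * h y := fun j => by fun_prop
  have hG : ∀ i, ContDiff ℝ ∞ (G i) := fun i => ContDiff.sum fun j _ =>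
    (contDiff_const.mul ((contDiff_sd hh j).sub (hy j))).add (contDiff_const.mul (hy j))
  have hF : ∀ i y, (WithLp.toLp 2 (D *ᵥ (gradient (fun y => h y * finf d y) y).ofLp +
      (h y * finf d y) • (C *ᵥ y.ofLp)) : EuclideanSpace ℝ (Fin d)) i = G i y * finf d y := by
    intro i y
    simp only [Pi.add_apply, Pi.smul_apply, Matrix.mulVec, dotProduct, gradient_apply,
      sd_mul hh contDiff_finf, smul_eq_mul, G, Finset.sum_mul, Finset.mul_sum]
    rw [← Finset.sum_add_distrib]
    refine Finset.sum_congr rfl fun j _ => ?_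
    rw [show sd j (finf d) y = -(y j) * finf d y from fderiv_finf j y]
    ring
  have hsG : ∀ i, sd i (G i) x = ∑ j, (D i j * (sd i (sd j h) x -
      ((if i = j then 1 else 0) * h x + x j * sd i h x)) +
      C i j * ((if i = j then 1 else 0) * h x + x j * sd i h x)) := by
    intro i
    have d1 : ∀ j, HasFDerivAt (sd j h) (fderiv ℝ (sd j h) x) x := fun j =>
      ((contDiff_sd hh j).differentiable (by simp) x).hasFDerivAt
    have d2 : ∀ j, HasFDerivAt (fun y : EuclideanSpace ℝ (Fin d) => y j * h y)
        (fderiv ℝ (fun y : EuclideanSpace ℝ (Fin d) => y j * h y) x) x := fun j =>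
      ((hy j).differentiable (by simp) x).hasFDerivAt
    have : HasFDerivAt (G i) _ x := HasFDerivAt.fun_sum (u := Finset.univ) fun j _ =>
      (((d1 j).fun_sub (d2 j)).const_mul (D i j)).fun_add ((d2 j).const_mul (C i j))
    rw [sd, this.fderiv]
    simp only [sum_apply, add_apply, smul_apply, sub_apply, smul_eq_mul]
    refine Finset.sum_congr rfl fun j _ => ?_
    have e := sd_coord_mul hh j i x
    rw [show fderiv ℝ (fun y => y j * h y) x (stdBasis i) = sd i (fun y => y j * h y) x from rfl, e,
      show fderiv ℝ (sd j h) x (stdBasis i) = sd i (sd j h) x from rfl]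
    simp [eq_comm]
  have hdiv : fokkerPlanckOp D C (fun y => h y * finf d y) x =
      ∑ i, sd i (fun y => G i y * finf d y) x := by
    unfold fokkerPlanckOp divergence
    refine Finset.sum_congr rfl fun i _ => ?_
    exact congrArg (fun F => fderiv ℝ F x (stdBasis i)) (funext (hF i))
  rw [hdiv]
  have e1 : ∀ i, sd i (fun y => G i y * finf d y) x =
      (∑ j, (D i j * (sd i (sd j h) x - ((if i = j then 1 else 0) * h x + x j * sd i h x)) +
        C i j * ((if i = j then 1 else 0) * h x + x j * sd i h x) -
        x i * (D i j * (sd j h x - x j * h x) + C i j * (x j * h x)))) * finf d x := by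
    intro i
    rw [sd_mul (hG i) contDiff_finf, hsG,
      show sd i (finf d) x = -(x i) * finf d x from fderiv_finf i x, Finset.sum_sub_distrib]
    rw [← Finset.mul_sum]
    simp only [G]
    ring
  have e2 : ∑ i, ∑ j, D i j * sd i (sd j h) x - ∑ j, (∑ i, C i j * x i) * sd j h x =
      ∑ i, ∑ j, (D i j * sd i (sd j h) x - C i j * x i * sd j h x) := by
    simp only [Finset.sum_sub_distrib, Finset.sum_mul]
    rw [Finset.sum_comm (f := fun i j => C i j * x i * sd j h x)]
  simp only [e1]
  rw [← Finset.sum_mul, e2]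
  congr 1
  rw [← sub_eq_zero, ← Finset.sum_sub_distrib]
  simp only [← Finset.sum_sub_distrib]
  -- the `(i, j)` and `(j, i)` terms cancel because `D` is the symmetric part of `C`
  set F : Fin d → Fin d → ℝ := fun i j => D i j * (sd i (sd j h) x -
      ((if i = j then 1 else 0) * h x + x j * sd i h x)) +
      C i j * ((if i = j then 1 else 0) * h x + x j * sd i h x) -
      x i * (D i j * (sd j h x - x j * h x) + C i j * (x j * h x)) -
      (D i j * sd i (sd j h) x - C i j * x i * sd j h x) with hFdef
  have hanti : ∀ i j, F i j + F j i = 0 := by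
    intro i j
    have h1 : D i j = (C i j + C j i) / 2 := by linarith [hDC i j]
    have h2 : D j i = (C i j + C j i) / 2 := by linarith [hDC j i]
    have h3 : (if j = i then (1 : ℝ) else 0) = if i = j then 1 else 0 := by simp [eq_comm]
    simp only [hFdef, h1, h2, h3]
    ring
  exact sum_sum_eq_zero_of_antisymm hanti

/-- The quotient `g / f_∞` as a function on space-time. -/
noncomputable def quot (g : ℝ → EuclideanSpace ℝ (Fin d) → ℝ)
    (p : ℝ × EuclideanSpace ℝ (Fin d)) : ℝ :=
  g p.1 p.2 / finf d p.2

variable {D C : Matrix (Fin d) (Fin d) ℝ} {g₀ : EuclideanSpace ℝ (Fin d) → ℝ}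
  {g : ℝ → EuclideanSpace ℝ (Fin d) → ℝ}

lemma IsSolution.smooth_quot (hg : IsSolution D C g₀ g) : Smooth (quot g) :=
  ContDiffOn.div hg.smooth (contDiff_finf.comp contDiff_snd).contDiffOn
    fun p _ => (finf_pos p.2).ne'

/-- The quotient of a solution by `f_∞` solves the homogeneous Ornstein–Uhlenbeck equation. -/
lemma IsSolution.hasSource (hDC : ∀ i j, 2 * D i j = C i j + C j i) (hg : IsSolution D C g₀ g) :
    HasSource D C (quot g) fun _ => 0 where
  smooth := hg.smooth_quot
  smooth_source := smooth_const 0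
  eq := by
    rintro ⟨t, x⟩ hp
    have ht : 0 < t := mem_halfSpace.1 hp
    have h1 := hg.smooth_quot.hasDerivAt_slice ht x
    have h2 : HasDerivAt (fun s => quot g (s, x)) (fokkerPlanckOp D C (g t) x / finf d x) t :=
      (hg.equation t ht x).div_const (finf d x)
    rw [h1.unique h2]
    have e : g t = fun y => quot g (t, y) * finf d y := by
      ext y; simp [quot, (finf_pos y).ne']
    rw [e, fokkerPlanckOp_mul_finf hDC (hg.smooth_quot.contDiff_slice ht),
      mul_div_cancel_right₀ _ (finf_pos x).ne', add_zero]
    have e1 : ∀ j, sd j (fun x => quot g (t, x)) = fun x => pd j (quot g) (t, x) := fun j =>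
      funext fun x => hg.smooth_quot.fderiv_slice ht x j
    have e2 : ∀ i j x, sd i (fun x => pd j (quot g) (t, x)) x = pd i (pd j (quot g)) (t, x) :=
      fun i j x => hg.smooth_quot.derivDir.fderiv_slice ht x i
    simp only [e1, e2]
    rfl

end Quotient

/-! ### Convex functions of linear growth approximating the square -/

section SoftSquare

/-- The convex function `2a (√(a² + s²) - a)`, which has linear growth and increases to `s²` as
`a → ∞`. -/
noncomputable def softSq (a s : ℝ) : ℝ := 2 * a * (√(a ^ 2 + s ^ 2) - a)

variable {a : ℝ}

lemma contDiff_softSq (ha : 0 < a) : ContDiff ℝ ∞ (softSq a) := by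
  unfold softSq
  exact contDiff_const.mul ((ContDiff.sqrt (by fun_prop) fun s => by positivity).sub contDiff_const)

lemma deriv_deriv_softSq_nonneg (ha : 0 < a) (s : ℝ) : 0 ≤ deriv (deriv (softSq a)) s := by
  have hs : ∀ s, HasDerivAt (fun s => √(a ^ 2 + s ^ 2)) (s / √(a ^ 2 + s ^ 2)) s := by
    intro s
    have h := (((hasDerivAt_id s).pow 2).const_add (a ^ 2)).sqrt (by simp; positivity)
    refine h.congr_deriv ?_
    simp
    ring
  have h1 : deriv (softSq a) = fun s => 2 * a * (s / √(a ^ 2 + s ^ 2)) := by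
    ext s
    exact (((hs s).sub_const a).const_mul (2 * a)).deriv
  rw [h1]
  have hq : 0 < √(a ^ 2 + s ^ 2) := by positivity
  have h2 := (((hasDerivAt_id s).div (hs s) hq.ne').const_mul (2 * a)).deriv
  simp only [id] at h2
  change deriv (fun s => 2 * a * (s / √(a ^ 2 + s ^ 2))) s = _ at h2
  rw [h2]
  have h4 : s * (s / √(a ^ 2 + s ^ 2)) ≤ √(a ^ 2 + s ^ 2) := by
    rw [← mul_div_assoc, div_le_iff₀ hq, Real.mul_self_sqrt (by positivity)]
    nlinarith [sq_nonneg a]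
  have : 0 ≤ 1 * √(a ^ 2 + s ^ 2) - s * (s / √(a ^ 2 + s ^ 2)) := by linarith
  positivity

lemma softSq_nonneg (ha : 0 < a) (s : ℝ) : 0 ≤ softSq a s := by
  have : a ≤ √(a ^ 2 + s ^ 2) := Real.le_sqrt_of_sq_le (by nlinarith [sq_nonneg s])
  unfold softSq
  have := sub_nonneg.2 this
  positivity

/-- The form of `softSq` that shows the bound by `s²` and the limit `a → ∞`. -/
lemma softSq_eq (ha : 0 < a) (s : ℝ) : softSq a s = 2 * s ^ 2 / (√(1 + (s / a) ^ 2) + 1) := by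
  have e : √(a ^ 2 + s ^ 2) = a * √(1 + (s / a) ^ 2) := by
    rw [show a ^ 2 + s ^ 2 = a ^ 2 * (1 + (s / a) ^ 2) by field_simp,
      Real.sqrt_mul (by positivity), Real.sqrt_sq ha.le]
  have h2 : √(1 + (s / a) ^ 2) ^ 2 = 1 + (s / a) ^ 2 := Real.sq_sqrt (by positivity)
  have h3 : (0 : ℝ) < √(1 + (s / a) ^ 2) + 1 := by positivity
  rw [softSq, e, eq_div_iff h3.ne']
  have h4 : a * (s / a) = s := by field_simp
  calc _ = 2 * a ^ 2 * (√(1 + (s / a) ^ 2) ^ 2 - 1) := by ring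
    _ = 2 * (a * (s / a)) ^ 2 := by rw [h2]; ring
    _ = _ := by rw [h4]

lemma softSq_le_sq (ha : 0 < a) (s : ℝ) : softSq a s ≤ s ^ 2 := by
  have h1 : (1 : ℝ) ≤ √(1 + (s / a) ^ 2) := Real.one_le_sqrt.2 (by nlinarith [sq_nonneg (s / a)])
  rw [softSq_eq ha, div_le_iff₀ (by positivity)]
  nlinarith [sq_nonneg s]

lemma abs_softSq_sub_le (ha : 0 < a) (s r : ℝ) : |softSq a s - softSq a r| ≤ 2 * a * |s - r| := by
  unfold softSq
  rw [show 2 * a * (√(a ^ 2 + s ^ 2) - a) - 2 * a * (√(a ^ 2 + r ^ 2) - a) =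
    2 * a * (√(a ^ 2 + s ^ 2) - √(a ^ 2 + r ^ 2)) by ring, abs_mul, abs_of_pos (by positivity)]
  refine mul_le_mul_of_nonneg_left ?_ (by positivity)
  set A := √(a ^ 2 + s ^ 2)
  set B := √(a ^ 2 + r ^ 2)
  have hA0 : 0 < A := by positivity
  have hB0 : 0 < B := by positivity
  have hA2 : A ^ 2 = a ^ 2 + s ^ 2 := Real.sq_sqrt (by positivity)
  have hB2 : B ^ 2 = a ^ 2 + r ^ 2 := Real.sq_sqrt (by positivity)
  have hsA : |s| ≤ A := Real.abs_le_sqrt (by nlinarith [sq_nonneg a])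
  have hrB : |r| ≤ B := Real.abs_le_sqrt (by nlinarith [sq_nonneg a])
  have h1 : |A - B| * (A + B) = |s - r| * |s + r| := by
    rw [← abs_of_pos (add_pos hA0 hB0), ← abs_mul, ← abs_mul]
    congr 1
    linear_combination hA2 - hB2
  have h2 : |s + r| ≤ A + B := (abs_add_le s r).trans (add_le_add hsA hrB)
  have h3 : |A - B| * (A + B) ≤ |s - r| * (A + B) := by
    rw [h1]; exact mul_le_mul_of_nonneg_left h2 (abs_nonneg _)
  exact le_of_mul_le_mul_right h3 (by positivity)

lemma tendsto_softSq (s : ℝ) : Tendsto (fun n : ℕ => softSq ((n : ℝ) + 1) s) atTop (𝓝 (s ^ 2)) := by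
  have h1 : Tendsto (fun n : ℕ => s / ((n : ℝ) + 1)) atTop (𝓝 0) := by
    have := (tendsto_one_div_add_atTop_nhds_zero_nat (𝕜 := ℝ)).const_mul s
    simpa [div_eq_mul_inv] using this
  have h2 : Tendsto (fun z : ℝ => 2 * s ^ 2 / (√(1 + z ^ 2) + 1)) (𝓝 0) (𝓝 (s ^ 2)) := by
    have : ContinuousAt (fun z : ℝ => 2 * s ^ 2 / (√(1 + z ^ 2) + 1)) 0 :=
      ContinuousAt.div (by fun_prop) (by fun_prop) (by positivity)
    convert this.tendsto using 2
    norm_num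
  exact (h2.comp h1).congr fun n => (softSq_eq (by positivity) s).symm

end SoftSquare

/-! ### Bounds inherited from the initial datum -/

section Initial

variable {d : ℕ} {D C : Matrix (Fin d) (Fin d) ℝ} {g₀ : EuclideanSpace ℝ (Fin d) → ℝ}
  {g : ℝ → EuclideanSpace ℝ (Fin d) → ℝ}

lemma integrable_div_finf_iff {φ : EuclideanSpace ℝ (Fin d) → ℝ} :
    Integrable (fun x => φ x / finf d x) (gauss d) ↔ Integrable φ := by
  rw [integrable_stdGaussian_iff]
  simp only [div_mul_cancel₀ _ (finf_pos _).ne']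

lemma integral_abs_div_finf (φ : EuclideanSpace ℝ (Fin d) → ℝ) :
    ∫ x, |φ x / finf d x| ∂gauss d = ∫ x, |φ x| := by
  rw [integral_stdGaussian]
  refine integral_congr_ae (ae_of_all _ fun x => ?_)
  simp only [abs_div, abs_of_pos (finf_pos x)]
  exact div_mul_cancel₀ _ (finf_pos _).ne'

lemma gauss_absolutelyContinuous : gauss d ≪ volume := by
  rw [gauss, stdGaussian_eq_withDensity]
  exact withDensity_absolutelyContinuous _ _

lemma memLp_div_finf (hg₀ : MemLp g₀ 2 (weight d)) :
    MemLp (fun x => g₀ x / finf d x) 2 (gauss d) := by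
  have hm : Measurable fun x : EuclideanSpace ℝ (Fin d) => ENNReal.ofReal (finf d x)⁻¹ :=
    contDiff_finf.continuous.measurable.inv.ennreal_ofReal
  have hac : (volume : Measure (EuclideanSpace ℝ (Fin d))) ≪ weight d :=
    withDensity_absolutelyContinuous' hm.aemeasurable
      (ae_of_all _ fun x => by simpa using finf_pos x)
  have hms : AEStronglyMeasurable g₀ (gauss d) :=
    hg₀.1.mono_ac (gauss_absolutelyContinuous.trans hac)
  have h2 := hg₀.integrable_sq
  rw [weight, integrable_withDensity_iff hm (by simp)] at h2
  have hms' : AEStronglyMeasurable (fun x => g₀ x / finf d x) (gauss d) :=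
    hms.div₀ contDiff_finf.continuous.aestronglyMeasurable
  refine (memLp_two_iff_integrable_sq hms').2 ?_
  rw [integrable_stdGaussian_iff]
  refine h2.congr (ae_of_all _ fun x => ?_)
  have := (finf_pos x).ne'
  simp only [ENNReal.toReal_ofReal (inv_nonneg.2 (finf_pos x).le)]
  field_simp

lemma IsSolution.integrable_quot (hg : IsSolution D C g₀ g) {t : ℝ} (ht : 0 ≤ t) :
    Integrable (fun x => quot g (t, x)) (gauss d) :=
  integrable_div_finf_iff.2 (hg.integrable t ht)

lemma IsSolution.tendsto_quot (hg : IsSolution D C g₀ g) :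
    Tendsto (fun s => ∫ x, |quot g (s, x) - g₀ x / finf d x| ∂gauss d) (𝓝[>] 0) (𝓝 0) := by
  refine ((hg.continuous 0 le_rfl).mono_left (nhdsWithin_mono _ Ioi_subset_Ici_self)).congr
    fun s => ?_
  rw [← integral_abs_div_finf]
  refine integral_congr_ae ?_
  filter_upwards [gauss_absolutelyContinuous.ae_eq hg.initial] with x hx
  simp only [quot]
  rw [hx, sub_div]

lemma IsSolution.continuousOn_integral_abs (hg : IsSolution D C g₀ g) :
    ContinuousOn (fun s => ∫ x, |g s x|) (Ici 0) := by
  intro t ht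
  rw [ContinuousWithinAt, tendsto_iff_norm_sub_tendsto_zero]
  refine squeeze_zero' (Eventually.of_forall fun _ => norm_nonneg _) ?_ (hg.continuous t ht)
  filter_upwards [self_mem_nhdsWithin] with s hs
  rw [← integral_sub (hg.integrable s hs).abs (hg.integrable t ht).abs]
  refine (norm_integral_le_integral_norm _).trans ?_
  refine integral_mono (((hg.integrable s hs).abs.sub (hg.integrable t ht).abs).norm)
    ((hg.integrable s hs).sub (hg.integrable t ht)).abs fun x => ?_
  exact abs_abs_sub_abs_le _ _

lemma IsSolution.integrable_slab (hg : IsSolution D C g₀ g) {s : ℝ} (hs : 0 < s) (t : ℝ) :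
    Integrable (quot g) (slab d s t) := by
  rw [integrable_prod_iff (hg.smooth_quot.aestronglyMeasurable hs t)]
  constructor
  · filter_upwards [ae_restrict_mem measurableSet_Ioc] with τ hτ
    exact hg.integrable_quot (hs.trans hτ.1).le
  · have : ∀ τ, ∫ x, ‖quot g (τ, x)‖ ∂gauss d = ∫ x, |g τ x| := fun τ =>
      integral_abs_div_finf (g τ)
    simp only [this]
    refine IntegrableOn.mono_set (ContinuousOn.integrableOn_Icc (b := t) (a := s)
      (hg.continuousOn_integral_abs.mono ?_)) Ioc_subset_Icc_self
    exact fun τ hτ => hs.le.trans hτ.1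

/-- The relative `L²` norm of a solution never exceeds that of its initial datum. The functional
`∫ Φ(g / f_∞) dγ` decreases for every smooth convex `Φ` of linear growth, for which continuity in
`L¹` suffices to reach time `0`; such functions approximate the square from below. -/
lemma IsSolution.memLp_quot (hDC : ∀ i j, 2 * D i j = C i j + C j i) {c : ℝ}
    (hc : 0 < c) (hD : ∀ y : Fin d → ℝ, c * ∑ i, y i ^ 2 ≤ ∑ i, ∑ j, D i j * (y i * y j))
    (hg : IsSolution D C g₀ g) (hg₀ : MemLp g₀ 2 (weight d)) {t : ℝ} (ht : 0 < t) :
    MemLp (fun x => quot g (t, x)) 2 (gauss d) ∧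
      ∫ x, quot g (t, x) ^ 2 ∂gauss d ≤ ∫ x, (g₀ x / finf d x) ^ 2 ∂gauss d := by
  have h0 := memLp_div_finf hg₀
  have h0i : Integrable (fun x => g₀ x / finf d x) (gauss d) := h0.integrable (by norm_num)
  have hsol := hg.hasSource hDC
  have carre0 : ∀ p, 0 ≤ carre D (quot g) (quot g) p := fun p =>
    (mul_nonneg hc.le (Finset.sum_nonneg fun i _ => sq_nonneg _)).trans
      (hD fun i => pd i (quot g) p)
  set K := ∫ x, (g₀ x / finf d x) ^ 2 ∂gauss d
  have z : ∀ {a : ℝ}, 0 < a → softSq a 0 = 0 := by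
    intro a ha
    simp [softSq, Real.sqrt_sq ha.le]
  have bound : ∀ {a : ℝ}, 0 < a → ∀ s, |softSq a s| ≤ 2 * a * |s| := by
    intro a ha s
    simpa [z ha] using abs_softSq_sub_le ha s 0
  have key : ∀ {a : ℝ}, 0 < a → Integrable (fun x => softSq a (quot g (t, x))) (gauss d) ∧
      ∫ x, softSq a (quot g (t, x)) ∂gauss d ≤ K := by
    intro a ha
    have cΦ := contDiff_softSq ha
    have hI : ∀ {s : ℝ}, 0 < s → Integrable (fun x => softSq a (quot g (s, x))) (gauss d) := by
      intro s hs
      refine ((hg.integrable_quot hs.le).abs.const_mul (2 * a)).mono'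
        (cΦ.continuous.comp_aestronglyMeasurable (hg.integrable_quot hs.le).1)
        (ae_of_all _ fun x => bound ha _)
    have hI0 : Integrable (fun x => softSq a (g₀ x / finf d x)) (gauss d) :=
      (h0i.abs.const_mul (2 * a)).mono'
        (cΦ.continuous.comp_aestronglyMeasurable h0i.1) (ae_of_all _ fun x => bound ha _)
    have hu : HasSource D C (fun p => softSq a (quot g p)) (fun p => (fun _ => (0 : ℝ)) p -
        deriv (deriv (softSq a)) (quot g p) * carre D (quot g) (quot g) p) := by
      have := HasSource.comp cΦ hsol
      simpa only [zero_sub] using this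
    have hσ0 : ∀ p, 0 ≤ deriv (deriv (softSq a)) (quot g p) * carre D (quot g) (quot g) p :=
      fun p => mul_nonneg (deriv_deriv_softSq_nonneg ha _) (carre0 p)
    have hσs : Smooth fun p => deriv (deriv (softSq a)) (quot g p) *
        carre D (quot g) (quot g) p :=
      (Smooth.comp (contDiff_infty_iff_deriv.1 (contDiff_infty_iff_deriv.1 cΦ).2).2
        hsol.smooth).mul (hsol.smooth.carreDuChamp hsol.smooth)
    have mono : ∀ s ∈ Ioo 0 t, ∫ x, softSq a (quot g (t, x)) ∂gauss d ≤
        ∫ x, softSq a (quot g (s, x)) ∂gauss d := by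
      intro s hs
      have hui : Integrable (fun p => softSq a (quot g p)) (slab d s t) :=
        ((hg.integrable_slab hs.1 t).abs.const_mul (2 * a)).mono'
          (hu.smooth.aestronglyMeasurable hs.1 t) (ae_of_all _ fun p => bound ha _)
      obtain ⟨-, -, h⟩ := hu.integrable_of_dissipation hDC (smooth_const 0) hσs
        (fun p _ => softSq_nonneg ha _) (fun p _ => hσ0 p) hs.1 hs.2.le hui (integrable_zero _ _ _)
        (hI hs.1)
      rw [integral_zero, add_zero] at h
      have := integral_nonneg (μ := slab d s t) (f := fun p =>
        deriv (deriv (softSq a)) (quot g p) * carre D (quot g) (quot g) p) hσ0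
      linarith
    have lim : Tendsto (fun s => ∫ x, softSq a (quot g (s, x)) ∂gauss d) (𝓝[>] 0)
        (𝓝 (∫ x, softSq a (g₀ x / finf d x) ∂gauss d)) := by
      rw [tendsto_iff_norm_sub_tendsto_zero]
      have hl := hg.tendsto_quot.const_mul (2 * a)
      rw [mul_zero] at hl
      refine squeeze_zero' (Eventually.of_forall fun _ => norm_nonneg _) ?_ hl
      filter_upwards [self_mem_nhdsWithin] with s hs
      rw [← integral_sub (hI hs) hI0, ← integral_const_mul]
      refine (norm_integral_le_integral_norm _).trans ?_
      exact integral_mono ((hI hs).sub hI0).norm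
        (((hg.integrable_quot (le_of_lt hs)).sub h0i).abs.const_mul _)
        fun x => abs_softSq_sub_le ha _ _
    refine ⟨hI ht, (ge_of_tendsto lim ?_).trans
      (integral_mono hI0 h0.integrable_sq fun x => softSq_le_sq ha _)⟩
    filter_upwards [Ioo_mem_nhdsGT ht] with s hs using mono s hs
  have hfin : ∫⁻ x, ENNReal.ofReal (quot g (t, x) ^ 2) ∂gauss d ≤ ENNReal.ofReal K := by
    have hpt : ∀ x, Tendsto (fun n : ℕ => ENNReal.ofReal (softSq ((n : ℝ) + 1) (quot g (t, x))))
        atTop (𝓝 (ENNReal.ofReal (quot g (t, x) ^ 2))) := fun x =>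
      (ENNReal.continuous_ofReal.tendsto _).comp (tendsto_softSq _)
    calc ∫⁻ x, ENNReal.ofReal (quot g (t, x) ^ 2) ∂gauss d
        = ∫⁻ x, liminf (fun n : ℕ => ENNReal.ofReal (softSq ((n : ℝ) + 1) (quot g (t, x)))) atTop
            ∂gauss d := lintegral_congr fun x => (hpt x).liminf_eq.symm
      _ ≤ liminf (fun n : ℕ => ∫⁻ x, ENNReal.ofReal (softSq ((n : ℝ) + 1) (quot g (t, x)))
            ∂gauss d) atTop := lintegral_liminf_le' fun n =>
          (key (a := (n : ℝ) + 1) (by positivity)).1.1.aemeasurable.ennreal_ofReal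
      _ ≤ ENNReal.ofReal K := by
          refine liminf_le_of_le (by isBoundedDefault) fun b hb => ?_
          obtain ⟨n, hn⟩ := hb.exists
          refine hn.trans ?_
          have hn1 : (0 : ℝ) < (n : ℝ) + 1 := by positivity
          rw [← ofReal_integral_eq_lintegral_ofReal (key hn1).1
            (ae_of_all _ fun x => softSq_nonneg hn1 _)]
          exact ENNReal.ofReal_le_ofReal (key hn1).2
  have hms := hg.smooth_quot.aestronglyMeasurable_slice ht
  have hsq : Integrable (fun x => quot g (t, x) ^ 2) (gauss d) := by
    refine ⟨hms.pow 2, ?_⟩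
    rw [hasFiniteIntegral_iff_ofReal (ae_of_all _ fun x => sq_nonneg _)]
    exact hfin.trans_lt ENNReal.ofReal_lt_top
  refine ⟨(memLp_two_iff_integrable_sq hms).2 hsq, ?_⟩
  rw [← ofReal_integral_eq_lintegral_ofReal hsq (ae_of_all _ fun x => sq_nonneg _)] at hfin
  exact (ENNReal.ofReal_le_ofReal_iff (integral_nonneg fun x => sq_nonneg _)).1 hfin

lemma IsSolution.locL2_quot (hDC : ∀ i j, 2 * D i j = C i j + C j i) {c : ℝ}
    (hc : 0 < c) (hD : ∀ y : Fin d → ℝ, c * ∑ i, y i ^ 2 ≤ ∑ i, ∑ j, D i j * (y i * y j))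
    (hg : IsSolution D C g₀ g) (hg₀ : MemLp g₀ 2 (weight d)) : LocL2 (quot g) := by
  intro s t hs
  have hms := hg.smooth_quot.aestronglyMeasurable hs t
  have hms2 : AEStronglyMeasurable (fun p => quot g p ^ 2) (slab d s t) := hms.pow 2
  rw [memLp_two_iff_integrable_sq hms, integrable_prod_iff hms2]
  constructor
  · filter_upwards [ae_restrict_mem measurableSet_Ioc] with τ hτ
    exact (hg.memLp_quot hDC hc hD hg₀ (hs.trans hτ.1)).1.integrable_sq
  · refine Integrable.of_bound hms2.norm.integral_prod_right'
      (∫ x, (g₀ x / finf d x) ^ 2 ∂gauss d) ?_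
    filter_upwards [ae_restrict_mem measurableSet_Ioc] with τ hτ
    rw [Real.norm_of_nonneg (integral_nonneg fun _ => norm_nonneg _)]
    refine le_trans (le_of_eq ?_) (hg.memLp_quot hDC hc hD hg₀ (hs.trans hτ.1)).2
    exact integral_congr_ae (ae_of_all _ fun x => Real.norm_of_nonneg (sq_nonneg _))

/-- Orthogonality to `V_1` says that the first moments vanish, as `∂_k f_∞ = -x_k f_∞`. -/
lemma integral_mul_coord_eq_zero
    (horth : ∀ φ ∈ V d 1, ∫ x, g₀ x * φ x * (finf d x)⁻¹ = 0) (k : Fin d) :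
    ∫ x, g₀ x / finf d x * x k ∂gauss d = 0 := by
  have hmem : (fun x : EuclideanSpace ℝ (Fin d) => iteratedFDeriv ℝ 1 (finf d) x
      fun _ => EuclideanSpace.single k (1 : ℝ)) ∈ V d 1 :=
    Submodule.subset_span ⟨fun _ => k, rfl⟩
  have h := horth _ hmem
  rw [integral_stdGaussian]
  rw [← neg_eq_zero, ← integral_neg, ← h]
  refine integral_congr_ae (ae_of_all _ fun x => ?_)
  have := (finf_pos x).ne'
  simp only [iteratedFDeriv_one_apply]
  rw [show fderiv ℝ (finf d) x (EuclideanSpace.single k 1) = -(x k) * finf d x from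
    fderiv_finf k x]
  field_simp

/-- The first moments of `g(s)` tend to those of the initial datum: `L¹` convergence together with
a uniform relative `L²` bound controls the unbounded weight `x_k`, by
`|x_k| ≤ R + x_k² / R` with a large `R`. -/
lemma IsSolution.tendsto_moment (hDC : ∀ i j, 2 * D i j = C i j + C j i) {c : ℝ}
    (hc : 0 < c) (hD : ∀ y : Fin d → ℝ, c * ∑ i, y i ^ 2 ≤ ∑ i, ∑ j, D i j * (y i * y j))
    (hg : IsSolution D C g₀ g) (hg₀ : MemLp g₀ 2 (weight d))
    (horth : ∀ φ ∈ V d 1, ∫ x, g₀ x * φ x * (finf d x)⁻¹ = 0) (k : Fin d) :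
    Tendsto (fun s => ∫ x, quot g (s, x) * x k ∂gauss d) (𝓝[>] 0) (𝓝 0) := by
  have h0 := memLp_div_finf hg₀
  have h0i : Integrable (fun x => g₀ x / finf d x) (gauss d) := h0.integrable (by norm_num)
  set K := ∫ x, (g₀ x / finf d x) ^ 2 ∂gauss d
  have hx2 : MemLp (fun x : EuclideanSpace ℝ (Fin d) => x k) 2 (gauss d) :=
    memLp_coord_stdGaussian k 2 (by simp)
  have hx4 : Integrable (fun x : EuclideanSpace ℝ (Fin d) => x k ^ 4) (gauss d) := by
    refine ((memLp_coord_stdGaussian k 4 (by simp)).integrable_norm_pow').congr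
      (ae_of_all _ fun x => ?_)
    simp only [Real.norm_eq_abs]
    exact Even.pow_abs (by decide) _
  set M := 2 * K + ∫ x : EuclideanSpace ℝ (Fin d), x k ^ 4 ∂gauss d with hM
  have hK0 : 0 ≤ K := integral_nonneg fun _ => sq_nonneg _
  have hM0 : 0 ≤ M := add_nonneg (by positivity) (integral_nonneg fun x => by positivity)
  have bound : ∀ R : ℝ, 0 < R → ∀ s : ℝ, 0 < s → |∫ x, quot g (s, x) * x k ∂gauss d| ≤
      R * ∫ x, |quot g (s, x) - g₀ x / finf d x| ∂gauss d + M / R := by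
    intro R hR s hs
    obtain ⟨hs2, hsK⟩ := hg.memLp_quot hDC hc hD hg₀ hs
    have i1 : Integrable (fun x => quot g (s, x) * x k) (gauss d) := hs2.integrable_mul hx2
    have i2 : Integrable (fun x => g₀ x / finf d x * x k) (gauss d) := h0.integrable_mul hx2
    have i3 : Integrable (fun x => |quot g (s, x) - g₀ x / finf d x|) (gauss d) :=
      ((hg.integrable_quot hs.le).sub h0i).abs
    have i4 : Integrable (fun x => 2 * quot g (s, x) ^ 2 + 2 * (g₀ x / finf d x) ^ 2) (gauss d) :=
      (hs2.integrable_sq.const_mul 2).add (h0.integrable_sq.const_mul 2)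
    have i5 : Integrable (fun x => (2 * quot g (s, x) ^ 2 + 2 * (g₀ x / finf d x) ^ 2) + x k ^ 4)
      (gauss d) := i4.add hx4
    have e : ∫ x, quot g (s, x) * x k ∂gauss d =
        ∫ x, (quot g (s, x) * x k - g₀ x / finf d x * x k) ∂gauss d := by
      rw [integral_sub i1 i2, integral_mul_coord_eq_zero horth, sub_zero]
    rw [e]
    refine (abs_integral_le_integral_abs).trans ?_
    have pt : ∀ x : EuclideanSpace ℝ (Fin d), |quot g (s, x) * x k - g₀ x / finf d x * x k| ≤
        R * |quot g (s, x) - g₀ x / finf d x| +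
          (1 / (2 * R)) * ((2 * quot g (s, x) ^ 2 + 2 * (g₀ x / finf d x) ^ 2) + x k ^ 4) := by
      intro x
      rw [← sub_mul, abs_mul]
      set A := quot g (s, x)
      set B := g₀ x / finf d x
      have h1 : |x k| ≤ R + x k ^ 2 / R := by
        rw [← sq_abs, ← sub_nonneg]
        have : R + |x k| ^ 2 / R - |x k| = ((R - |x k| / 2) ^ 2 + 3 / 4 * |x k| ^ 2) / R := by
          field_simp; ring
        rw [this]; positivity
      have h2 : |A - B| * x k ^ 2 ≤ ((2 * A ^ 2 + 2 * B ^ 2) + x k ^ 4) / 2 := by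
        nlinarith [sq_nonneg (|A - B| - x k ^ 2), sq_abs (A - B), sq_nonneg (A + B)]
      calc |A - B| * |x k| ≤ |A - B| * (R + x k ^ 2 / R) :=
            mul_le_mul_of_nonneg_left h1 (abs_nonneg _)
        _ = R * |A - B| + (|A - B| * x k ^ 2) / R := by ring
        _ ≤ R * |A - B| + (((2 * A ^ 2 + 2 * B ^ 2) + x k ^ 4) / 2) / R := by gcongr
        _ = _ := by field_simp
    refine (integral_mono (i1.sub i2).abs ((i3.const_mul R).add (i5.const_mul _)) pt).trans ?_
    simp only [Pi.add_apply]
    rw [integral_add (i3.const_mul R) (i5.const_mul _), integral_const_mul, integral_const_mul,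
      integral_add i4 hx4, integral_add (hs2.integrable_sq.const_mul 2)
        (h0.integrable_sq.const_mul 2), integral_const_mul, integral_const_mul]
    have hx40 : 0 ≤ ∫ x : EuclideanSpace ℝ (Fin d), x k ^ 4 ∂gauss d :=
      integral_nonneg fun x => by positivity
    have : (1 / (2 * R)) * (2 * ∫ x, quot g (s, x) ^ 2 ∂gauss d +
        2 * ∫ x, (g₀ x / finf d x) ^ 2 ∂gauss d +
        ∫ x : EuclideanSpace ℝ (Fin d), x k ^ 4 ∂gauss d) ≤ M / R := by
      rw [div_mul_eq_mul_div, one_mul, div_le_div_iff₀ (by positivity) hR]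
      have : 2 * ∫ x, quot g (s, x) ^ 2 ∂gauss d + 2 * ∫ x, (g₀ x / finf d x) ^ 2 ∂gauss d +
        ∫ x : EuclideanSpace ℝ (Fin d), x k ^ 4 ∂gauss d ≤ 2 * M := by linarith
      nlinarith
    linarith
  rw [Metric.tendsto_nhds]
  intro ε hε
  -- with this `R` the error `M / R` is below `ε / 2`
  set R := 2 * (M + 1) / ε with hR
  have hR0 : 0 < R := by positivity
  have hMR : M / R < ε / 2 := by
    rw [hR, div_div_eq_mul_div, div_lt_div_iff₀ (by positivity) (by positivity)]
    nlinarith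
  have hl := hg.tendsto_quot.const_mul R
  rw [mul_zero] at hl
  filter_upwards [hl.eventually (gt_mem_nhds (half_pos hε)), self_mem_nhdsWithin] with s h1 h2
  rw [Real.dist_eq, sub_zero]
  exact (bound R hR0 s h2).trans_lt (by linarith)

end Initial

/-! ### Solutions of finite energy and the vanishing of the first moments -/

section FiniteEnergySection

variable {d : ℕ} {D C : Matrix (Fin d) (Fin d) ℝ}

/-- A solution of `∂_t w = L w + α` with the integrability needed for the energy identities. -/
structure FiniteEnergy (D C : Matrix (Fin d) (Fin d) ℝ)
    (w α : ℝ × EuclideanSpace ℝ (Fin d) → ℝ) : Prop extends HasSource D C w α where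
  locL2 : LocL2 w
  locL2_source : LocL2 α
  memLp : ∀ t, 0 < t → MemLp (fun x => w (t, x)) 2 (gauss d)
  locL2_pd : ∀ i, LocL2 (pd i w)

lemma LocL2.congr {a b : ℝ × EuclideanSpace ℝ (Fin d) → ℝ} (ha : LocL2 a)
    (h : EqOn a b (halfSpace d)) : LocL2 b := fun s t hs =>
  (memLp_congr_ae ((ae_slab_halfSpace hs t).mono fun _ hp => h hp)).1 (ha s t hs)

lemma HasSource.finiteEnergy (hDC : ∀ i j, 2 * D i j = C i j + C j i) (hDs : Dᵀ = D) {c : ℝ}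
    (hc : 0 < c) (hD : ∀ y : Fin d → ℝ, c * ∑ i, y i ^ 2 ≤ ∑ i, ∑ j, D i j * (y i * y j))
    {w α : ℝ × EuclideanSpace ℝ (Fin d) → ℝ} (hw : HasSource D C w α) (hw2 : LocL2 w)
    (hα2 : LocL2 α) : FiniteEnergy D C w α :=
  ⟨hw, hw2, hα2, (hw.energy hDC hDs hc hD hw2 hα2).1, (hw.energy hDC hDs hc hD hw2 hα2).2⟩

namespace FiniteEnergy

variable {a b α β : ℝ × EuclideanSpace ℝ (Fin d) → ℝ}

lemma partialDeriv (hDC : ∀ i j, 2 * D i j = C i j + C j i) (hDs : Dᵀ = D) {c : ℝ}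
    (hc : 0 < c) (hD : ∀ y : Fin d → ℝ, c * ∑ i, y i ^ 2 ≤ ∑ i, ∑ j, D i j * (y i * y j))
    (ha : FiniteEnergy D C a α) (k : Fin d) (hα : LocL2 (pd k α)) :
    FiniteEnergy D C (pd k a) (fun p => pd k α p - ∑ j, C k j * pd j a p) :=
  (ha.toHasSource.partialDeriv k).finiteEnergy hDC hDs hc hD (ha.locL2_pd k)
    (hα.sub (LocL2.sum fun j _ => (ha.locL2_pd j).const_mul _))

lemma coord (k : Fin d) :
    FiniteEnergy D C (fun p => p.2 k) (fun p => ∑ i, C i k * p.2 i) where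
  toHasSource := hasSource_coord k
  locL2 := locL2_coord k
  locL2_source := LocL2.sum fun i _ => (locL2_coord i).const_mul _
  memLp := fun _ _ => memLp_coord_stdGaussian k 2 (by simp)
  locL2_pd := fun i => by
    rw [show pd i (fun q : ℝ × EuclideanSpace ℝ (Fin d) => q.2 k) = fun _ => if i = k then 1 else 0
      from funext fun q => pd_coord i k]
    exact fun s t _ => memLp_const _

lemma integral_mul_sub (hDC : ∀ i j, 2 * D i j = C i j + C j i) (hDs : Dᵀ = D)
    (ha : FiniteEnergy D C a α) (hb : FiniteEnergy D C b β) {s t : ℝ} (hs : 0 < s) (hst : s ≤ t) :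
    Integrable (fun p => a p * β p + α p * b p - 2 * carre D a b p) (slab d s t) ∧
    ∫ x, a (t, x) * b (t, x) ∂gauss d - ∫ x, a (s, x) * b (s, x) ∂gauss d =
      ∫ τ in s..t, ∫ x, (a (τ, x) * β (τ, x) + α (τ, x) * b (τ, x) - 2 * carre D a b (τ, x))
        ∂gauss d :=
  ha.toHasSource.integral_mul_sub hDC hDs hb.toHasSource ha.locL2 hb.locL2 ha.locL2_source
    hb.locL2_source ha.memLp hb.memLp ha.locL2_pd hb.locL2_pd hs hst

lemma integrable_mul (ha : FiniteEnergy D C a α) (hb : FiniteEnergy D C b β) {t : ℝ} (ht : 0 < t) :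
    Integrable (fun x => a (t, x) * b (t, x)) (gauss d) :=
  (ha.memLp t ht).integrable_mul (hb.memLp t ht)

lemma continuousAt_integral_mul (hDC : ∀ i j, 2 * D i j = C i j + C j i) (hDs : Dᵀ = D)
    (ha : FiniteEnergy D C a α) (hb : FiniteEnergy D C b β) {t : ℝ} (ht : 0 < t) :
    ContinuousAt (fun s => ∫ x, a (s, x) * b (s, x) ∂gauss d) t := by
  have h2 : t / 2 ≤ 2 * t := by linarith
  have hint := (ha.integral_mul_sub hDC hDs hb (s := t / 2) (t := 2 * t) (by positivity) h2).1
  have hI : IntegrableOn (fun τ => ∫ x, (a (τ, x) * β (τ, x) + α (τ, x) * b (τ, x) -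
      2 * carre D a b (τ, x)) ∂gauss d) (uIcc (t / 2) (2 * t)) := by
    rw [uIcc_of_le h2, integrableOn_Icc_iff_integrableOn_Ioc]
    exact hint.integral_prod_left
  have hc := intervalIntegral.continuousOn_primitive_interval hI
  rw [uIcc_of_le h2] at hc
  have hc' := (hc.const_add (∫ x, a (t / 2, x) * b (t / 2, x) ∂gauss d)).continuousAt
    (Icc_mem_nhds (by linarith : t / 2 < t) (by linarith : t < 2 * t))
  refine hc'.congr ?_
  filter_upwards [Ioi_mem_nhds (by linarith : t / 2 < t)] with s hs
  rw [← (ha.integral_mul_sub hDC hDs hb (s := t / 2) (t := s) (by positivity)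
    (le_of_lt hs)).2]
  ring

/-- If the integrand `J` of the energy identity for `∫ a b dγ` is continuous, then it is the
derivative. -/
lemma hasDerivAt_integral_mul (hDC : ∀ i j, 2 * D i j = C i j + C j i) (hDs : Dᵀ = D)
    (ha : FiniteEnergy D C a α) (hb : FiniteEnergy D C b β) {J : ℝ → ℝ}
    (hJ : ∀ τ, 0 < τ → ∫ x, (a (τ, x) * β (τ, x) + α (τ, x) * b (τ, x) -
      2 * carre D a b (τ, x)) ∂gauss d = J τ) (hJc : ∀ τ, 0 < τ → ContinuousAt J τ)
    {t : ℝ} (ht : 0 < t) :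
    HasDerivAt (fun s => ∫ x, a (s, x) * b (s, x) ∂gauss d) (J t) t := by
  have hcont : ContinuousOn J (Ioi 0) := fun τ hτ => (hJc τ hτ).continuousWithinAt
  have hsub : uIcc (t / 2) t ⊆ Ioi 0 := by
    rw [uIcc_of_le (by linarith)]
    intro τ hτ
    exact (by linarith [hτ.1] : (0 : ℝ) < τ)
  have hd := intervalIntegral.integral_hasDerivAt_right (a := t / 2)
    ((hcont.mono hsub).intervalIntegrable)
    (hcont.stronglyMeasurableAtFilter isOpen_Ioi t ht) (hJc t ht)
  refine (hd.const_add (∫ x, a (t / 2, x) * b (t / 2, x) ∂gauss d)).congr_of_eventuallyEq ?_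
  filter_upwards [Ioi_mem_nhds (by linarith : t / 2 < t)] with s hs
  have h1 := (ha.integral_mul_sub hDC hDs hb (s := t / 2) (t := s) (by positivity)
    (le_of_lt hs)).2
  have h2 : ∫ τ in (t / 2)..s, ∫ x, (a (τ, x) * β (τ, x) + α (τ, x) * b (τ, x) -
      2 * carre D a b (τ, x)) ∂gauss d = ∫ τ in (t / 2)..s, J τ := by
    refine intervalIntegral.integral_congr fun τ hτ => hJ τ ?_
    rw [uIcc_of_le (le_of_lt hs)] at hτ
    exact (by linarith [hτ.1] : (0 : ℝ) < τ)
  linarith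

end FiniteEnergy

section Solution

variable {g₀ : EuclideanSpace ℝ (Fin d) → ℝ} {g : ℝ → EuclideanSpace ℝ (Fin d) → ℝ}

lemma IsSolution.finiteEnergy (hDC : ∀ i j, 2 * D i j = C i j + C j i) (hDs : Dᵀ = D) {c : ℝ}
    (hc : 0 < c) (hD : ∀ y : Fin d → ℝ, c * ∑ i, y i ^ 2 ≤ ∑ i, ∑ j, D i j * (y i * y j))
    (hg : IsSolution D C g₀ g) (hg₀ : MemLp g₀ 2 (weight d)) :
    FiniteEnergy D C (quot g) fun _ => 0 :=
  (hg.hasSource hDC).finiteEnergy hDC hDs hc hD (hg.locL2_quot hDC hc hD hg₀) locL2_zero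

lemma FiniteEnergy.pd_of_source_zero (hDC : ∀ i j, 2 * D i j = C i j + C j i) (hDs : Dᵀ = D)
    {c : ℝ} (hc : 0 < c)
    (hD : ∀ y : Fin d → ℝ, c * ∑ i, y i ^ 2 ≤ ∑ i, ∑ j, D i j * (y i * y j))
    {h : ℝ × EuclideanSpace ℝ (Fin d) → ℝ} (hh : FiniteEnergy D C h fun _ => 0) (i : Fin d) :
    FiniteEnergy D C (pd i h) (fun p => -∑ l, C i l * pd l h p) := by
  have e : pd i (fun _ : ℝ × EuclideanSpace ℝ (Fin d) => (0 : ℝ)) = fun _ => 0 :=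
    funext fun _ => dirDeriv_const 0
  have := hh.partialDeriv hDC hDs hc hD i (by rw [e]; exact locL2_zero)
  simpa only [e, zero_sub] using this

/-- Second derivatives of a homogeneous solution have finite energy as well; their source is a
linear combination of second derivatives. -/
lemma FiniteEnergy.pd_pd_of_source_zero (hDC : ∀ i j, 2 * D i j = C i j + C j i) (hDs : Dᵀ = D)
    {c : ℝ} (hc : 0 < c)
    (hD : ∀ y : Fin d → ℝ, c * ∑ i, y i ^ 2 ≤ ∑ i, ∑ j, D i j * (y i * y j))
    {h : ℝ × EuclideanSpace ℝ (Fin d) → ℝ} (hh : FiniteEnergy D C h fun _ => 0) (k i : Fin d) :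
    ∃ α, FiniteEnergy D C (pd k (pd i h)) α := by
  have hv := hh.pd_of_source_zero hDC hDs hc hD
  refine ⟨_, (hv i).partialDeriv hDC hDs hc hD k ?_⟩
  have : LocL2 fun p => ∑ l, -C i l * pd k (pd l h) p :=
    LocL2.sum fun l _ => ((hv l).locL2_pd k).const_mul _
  refine this.congr fun p hp => ?_
  have e : (fun p => -∑ l, C i l * pd l h p) = fun p => ∑ l, -C i l * pd l h p := by
    ext p; rw [← Finset.sum_neg_distrib]; simp only [neg_mul]
  change _ = dirDeriv (0, stdBasis k) _ p
  rw [e, dirDeriv_sum (fun l _ => (smooth_const _).mul hh.smooth.derivDir) hp]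
  exact Finset.sum_congr rfl fun l _ => (dirDeriv_const_mul _ hh.smooth.derivDir hp).symm

lemma FiniteEnergy.integral_pd (hDC : ∀ i j, 2 * D i j = C i j + C j i) (hDs : Dᵀ = D)
    {c : ℝ} (hc : 0 < c)
    (hD : ∀ y : Fin d → ℝ, c * ∑ i, y i ^ 2 ≤ ∑ i, ∑ j, D i j * (y i * y j))
    {h : ℝ × EuclideanSpace ℝ (Fin d) → ℝ} (hh : FiniteEnergy D C h fun _ => 0) (i : Fin d)
    {t : ℝ} (ht : 0 < t) :
    ∫ x, pd i h (t, x) ∂gauss d = ∫ x, h (t, x) * x i ∂gauss d := by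
  have hv := hh.pd_of_source_zero hDC hDs hc hD i
  have i0 : Integrable (fun x => h (t, x)) (gauss d) := (hh.memLp t ht).integrable (by norm_num)
  have i1 : Integrable (fun x => pd i h (t, x)) (gauss d) :=
    (hv.memLp t ht).integrable (by norm_num)
  have i2 : Integrable (fun x => h (t, x) * x i) (gauss d) :=
    hh.integrable_mul (FiniteEnergy.coord (D := D) (C := C) i) ht
  have := integral_fderiv_mul_stdGaussian (a := fun x => h (t, x)) (b := fun _ => 1) i
    ((hh.smooth.contDiff_slice ht).differentiable (by simp)) (differentiable_const 1)
    (by simpa [hh.smooth.fderiv_slice ht] using i1) (by simpa using i2) (by simpa using i0)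
  simpa [hh.smooth.fderiv_slice ht] using this

/-- The first moments `m_k = ∫ x_k h dγ` obey `m' = -C m`, so `|m|²` does not increase; it vanishes
at time `0`. -/
lemma IsSolution.moment_eq_zero (hDC : ∀ i j, 2 * D i j = C i j + C j i) (hDs : Dᵀ = D) {c : ℝ}
    (hc : 0 < c) (hD : ∀ y : Fin d → ℝ, c * ∑ i, y i ^ 2 ≤ ∑ i, ∑ j, D i j * (y i * y j))
    (hg : IsSolution D C g₀ g) (hg₀ : MemLp g₀ 2 (weight d))
    (horth : ∀ φ ∈ V d 1, ∫ x, g₀ x * φ x * (finf d x)⁻¹ = 0) (k : Fin d) {t : ℝ} (ht : 0 < t) :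
    ∫ x, quot g (t, x) * x k ∂gauss d = 0 := by
  have hh := hg.finiteEnergy hDC hDs hc hD hg₀
  set h := quot g
  let m : Fin d → ℝ → ℝ := fun k s => ∫ x, h (s, x) * x k ∂gauss d
  have hx : ∀ k, FiniteEnergy D C (fun p => p.2 k) (fun p => ∑ i, C i k * p.2 i) :=
    FiniteEnergy.coord
  have hv := hh.pd_of_source_zero hDC hDs hc hD
  have hcont : ∀ k τ, 0 < τ → ContinuousAt (m k) τ := fun k τ hτ =>
    hh.continuousAt_integral_mul hDC hDs (hx k) hτ
  have hderiv : ∀ k τ, 0 < τ → HasDerivAt (m k) (-∑ i, C k i * m i τ) τ := by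
    intro k τ hτ
    refine hh.hasDerivAt_integral_mul hDC hDs (hx k) (J := fun τ => -∑ i, C k i * m i τ)
      (fun τ hτ => ?_) (fun τ hτ => ?_) hτ
    · have e : ∀ x : EuclideanSpace ℝ (Fin d), h (τ, x) * ∑ i, C i k * x i + 0 * x k -
          2 * carre D h (fun p => p.2 k) (τ, x) =
          ∑ i, (C i k * (h (τ, x) * x i) - 2 * D i k * pd i h (τ, x)) := by
        intro x
        have e1 : carre D h (fun p => p.2 k) (τ, x) = ∑ i, D i k * pd i h (τ, x) := by
          unfold carre
          simp only [pd_coord]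
          simp
        rw [e1, Finset.sum_sub_distrib, Finset.mul_sum, Finset.mul_sum, zero_mul, add_zero]
        congr 1
        · exact Finset.sum_congr rfl fun i _ => by ring
        · exact Finset.sum_congr rfl fun i _ => by ring
      have j1 : ∀ i, Integrable (fun x => h (τ, x) * x i) (gauss d) := fun i =>
        hh.integrable_mul (hx i) hτ
      have j2 : ∀ i, Integrable (fun x => pd i h (τ, x)) (gauss d) := fun i =>
        ((hv i).memLp τ hτ).integrable (by norm_num)
      have j3 : ∀ i, Integrable (fun x => C i k * (h (τ, x) * x i) - 2 * D i k * pd i h (τ, x))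
          (gauss d) := fun i => ((j1 i).const_mul _).sub ((j2 i).const_mul _)
      rw [integral_congr_ae (ae_of_all _ e), integral_finsetSum _ fun i _ => j3 i,
        ← Finset.sum_neg_distrib]
      refine Finset.sum_congr rfl fun i _ => ?_
      rw [integral_sub ((j1 i).const_mul _) ((j2 i).const_mul _), integral_const_mul,
        integral_const_mul, hh.integral_pd hDC hDs hc hD i hτ]
      have := hDC i k
      simp only [m]
      linear_combination (-(∫ x, h (τ, x) * x i ∂gauss d)) * this
    · exact (tendsto_finsetSum _ fun i _ => (hcont i τ hτ).const_mul (C k i)).neg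
  let N : ℝ → ℝ := fun s => ∑ k, m k s ^ 2
  have hN : ∀ τ, 0 < τ → HasDerivAt N (∑ k, 2 * m k τ * (-∑ i, C k i * m i τ)) τ := by
    intro τ hτ
    refine HasDerivAt.fun_sum fun k _ => ?_
    refine ((hderiv k τ hτ).pow 2).congr_deriv ?_
    simp
  have hN' : ∀ τ, ∑ k, 2 * m k τ * (-∑ i, C k i * m i τ) ≤ 0 := by
    intro τ
    have e : ∑ k, 2 * m k τ * (-∑ i, C k i * m i τ) =
        -(2 * ∑ i, ∑ j, D i j * (m i τ * m j τ)) := by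
      have e1 : ∑ k, 2 * m k τ * (-∑ i, C k i * m i τ) =
          -(2 * ∑ k, ∑ i, C k i * (m k τ * m i τ)) := by
        rw [Finset.mul_sum, ← Finset.sum_neg_distrib]
        refine Finset.sum_congr rfl fun k _ => ?_
        rw [mul_neg, Finset.mul_sum, Finset.mul_sum, neg_inj]
        exact Finset.sum_congr rfl fun i _ => by ring
      have e2 : ∑ k, ∑ i, C k i * (m k τ * m i τ) = ∑ k, ∑ i, C i k * (m k τ * m i τ) := by
        rw [Finset.sum_comm]
        exact Finset.sum_congr rfl fun i _ => Finset.sum_congr rfl fun j _ => by ring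
      have e3 : 2 * ∑ i, ∑ j, D i j * (m i τ * m j τ) =
          ∑ k, ∑ i, C k i * (m k τ * m i τ) + ∑ k, ∑ i, C i k * (m k τ * m i τ) := by
        rw [Finset.mul_sum, ← Finset.sum_add_distrib]
        refine Finset.sum_congr rfl fun i _ => ?_
        rw [Finset.mul_sum, ← Finset.sum_add_distrib]
        exact Finset.sum_congr rfl fun j _ => by
          linear_combination (m i τ * m j τ) * hDC i j
      rw [e1, e3, ← e2]; ring
    rw [e]
    have := (mul_nonneg hc.le (Finset.sum_nonneg fun i (_ : i ∈ Finset.univ) =>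
      sq_nonneg (m i τ))).trans (hD fun i => m i τ)
    linarith
  have hanti : AntitoneOn N (Ioi 0) := by
    refine antitoneOn_of_deriv_nonpos (convex_Ioi 0)
      (fun τ hτ => (hN τ hτ).continuousAt.continuousWithinAt)
      (fun τ hτ => ?_) (fun τ hτ => ?_)
    · rw [interior_Ioi] at hτ
      exact (hN τ hτ).differentiableAt.differentiableWithinAt
    · rw [interior_Ioi] at hτ
      rw [(hN τ hτ).deriv]; exact hN' τ
  have hlim : Tendsto N (𝓝[>] 0) (𝓝 0) := by
    have : Tendsto N (𝓝[>] 0) (𝓝 (∑ _k : Fin d, (0 : ℝ) ^ 2)) :=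
      tendsto_finsetSum _ fun k _ => (hg.tendsto_moment hDC hc hD hg₀ horth k).pow 2
    simpa using this
  have hNt : N t ≤ 0 := by
    refine ge_of_tendsto hlim ?_
    filter_upwards [Ioo_mem_nhdsGT ht] with s hs using hanti hs.1 ht hs.2.le
  have h1 : m k t ^ 2 ≤ N t :=
    Finset.single_le_sum (f := fun k => m k t ^ 2) (fun _ _ => sq_nonneg _) (Finset.mem_univ k)
  exact pow_eq_zero_iff two_ne_zero |>.1 (le_antisymm (h1.trans hNt) (sq_nonneg _))

end Solution

end FiniteEnergySection

/-! ### Evolution of the Fisher information -/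

section Fisher

variable {d : ℕ} {D C : Matrix (Fin d) (Fin d) ℝ}

lemma dotProduct_mulVec_eq_sum (M : Matrix (Fin d) (Fin d) ℝ) (y : Fin d → ℝ) :
    y ⬝ᵥ (M *ᵥ y) = ∑ i, ∑ j, M i j * (y i * y j) := by
  simp only [dotProduct, Matrix.mulVec, Finset.mul_sum]
  exact Finset.sum_congr rfl fun i _ => Finset.sum_congr rfl fun j _ => by ring

lemma sum_mul_nonneg_of_posSemidef {M : Matrix (Fin d) (Fin d) ℝ} (hM : M.PosSemidef)
    (y : Fin d → ℝ) : 0 ≤ ∑ i, ∑ j, M i j * (y i * y j) := by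
  rw [← dotProduct_mulVec_eq_sum]
  simpa using hM.dotProduct_mulVec_nonneg y

lemma dmin_pos (hD : D.PosDef) {dmin : ℝ} (hdmin : IsLeast (spectrum ℝ D) dmin) : 0 < dmin := by
  have h := hdmin.1
  rw [hD.1.spectrum_real_eq_range_eigenvalues] at h
  obtain ⟨i, rfl⟩ := h
  exact hD.eigenvalues_pos i

lemma dmin_mul_le (hD : D.PosDef) {dmin : ℝ} (hdmin : IsLeast (spectrum ℝ D) dmin)
    (y : Fin d → ℝ) : dmin * ∑ i, y i ^ 2 ≤ ∑ i, ∑ j, D i j * (y i * y j) := by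
  set M := D - algebraMap ℝ (Matrix (Fin d) (Fin d) ℝ) dmin with hM
  have hherm : M.IsHermitian := by
    refine hD.1.sub ?_
    rw [Matrix.IsHermitian, Matrix.algebraMap_eq_diagonal, Matrix.diagonal_conjTranspose]
    simp
  have hpsd : M.PosSemidef := by
    rw [hherm.posSemidef_iff_eigenvalues_nonneg]
    intro i
    have hi : hherm.eigenvalues i ∈ spectrum ℝ M := by
      rw [hherm.spectrum_real_eq_range_eigenvalues]; exact ⟨i, rfl⟩
    obtain ⟨a, ha, b, hb, hab⟩ := (spectrum.sub_singleton_eq D dmin).symm.subset hi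
    rw [mem_singleton_iff.1 hb] at hab
    have : 0 ≤ a - dmin := sub_nonneg.2 (hdmin.2 ha)
    have h2 : a - dmin = hherm.eigenvalues i := hab
    simpa [← h2] using this
  have h := sum_mul_nonneg_of_posSemidef hpsd y
  have e : ∑ i, ∑ j, M i j * (y i * y j) =
      ∑ i, ∑ j, D i j * (y i * y j) - dmin * ∑ i, y i ^ 2 := by
    simp only [hM, Matrix.sub_apply, sub_mul, Finset.sum_sub_distrib,
      Matrix.algebraMap_matrix_apply]
    congr 1
    rw [Finset.mul_sum]
    refine Finset.sum_congr rfl fun i _ => ?_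
    simp [sq]
  linarith

lemma sum_sum_mul_integral {F : Fin d → Fin d → EuclideanSpace ℝ (Fin d) → ℝ}
    (hF : ∀ i j, Integrable (F i j) (gauss d)) (Q : Fin d → Fin d → ℝ) :
    ∑ i, ∑ j, Q i j * ∫ x, F i j x ∂gauss d = ∫ x, ∑ i, ∑ j, Q i j * F i j x ∂gauss d := by
  have hi : ∀ i j, Integrable (fun x => Q i j * F i j x) (gauss d) := fun i j =>
    (hF i j).const_mul _
  rw [integral_finsetSum _ fun i _ => integrable_finsetSum _ fun j _ => hi i j]
  refine Finset.sum_congr rfl fun i _ => ?_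
  rw [integral_finsetSum _ fun j _ => hi i j]
  exact Finset.sum_congr rfl fun j _ => (integral_const_mul _ _).symm

/-- The Gram matrix `∫ ∂_i h ∂_j h dγ` of the gradient of `h(t)`, with `γ = f_∞ dx`. -/
noncomputable def gram (h : ℝ × EuclideanSpace ℝ (Fin d) → ℝ) (i j : Fin d) (t : ℝ) : ℝ :=
  ∫ x, pd i h (t, x) * pd j h (t, x) ∂gauss d

lemma sum_mul_gram_nonneg {h : ℝ × EuclideanSpace ℝ (Fin d) → ℝ} {t : ℝ}
    (h2 : ∀ i, MemLp (fun x => pd i h (t, x)) 2 (gauss d)) {Q : Matrix (Fin d) (Fin d) ℝ}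
    (hQ : Q.PosSemidef) : 0 ≤ ∑ i, ∑ j, Q i j * gram h i j t := by
  refine le_of_le_of_eq ?_ (sum_sum_mul_integral (fun i j => (h2 i).integrable_mul (h2 j)) Q).symm
  exact integral_nonneg fun x => sum_mul_nonneg_of_posSemidef hQ fun i => pd i h (t, x)

/-- The Fisher information as a linear functional of the Gram matrix of the gradient. -/
lemma fisherInfo_eq {g : ℝ → EuclideanSpace ℝ (Fin d) → ℝ}
    {h : ℝ × EuclideanSpace ℝ (Fin d) → ℝ} (hg : h = quot g) (hs : Smooth h)
    {t : ℝ} (ht : 0 < t) (h2 : ∀ i, MemLp (fun x => pd i h (t, x)) 2 (gauss d))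
    {Q : Matrix (Fin d) (Fin d) ℝ} (hQ : Q.PosSemidef) :
    fisherInfo Q (g t) = ENNReal.ofReal (∑ i, ∑ j, Q i j * gram h i j t) := by
  have i0 : ∀ i j, Integrable (fun x => pd i h (t, x) * pd j h (t, x)) (gauss d) := fun i j =>
    (h2 i).integrable_mul (h2 j)
  have i2 : Integrable (fun x => ∑ i, ∑ j, Q i j * (pd i h (t, x) * pd j h (t, x))) (gauss d) :=
    integrable_finsetSum _ fun i _ => integrable_finsetSum _ fun j _ => (i0 i j).const_mul _
  have e : ∑ i, ∑ j, Q i j * gram h i j t =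
      ∫ x, ∑ i, ∑ j, Q i j * (pd i h (t, x) * pd j h (t, x)) ∂gauss d :=
    sum_sum_mul_integral i0 Q
  have hc : ∀ i, Continuous fun x => pd i h (t, x) := fun i =>
    (hs.derivDir.contDiff_slice ht).continuous
  rw [e, ofReal_integral_eq_lintegral_ofReal i2
    (ae_of_all _ fun x => sum_mul_nonneg_of_posSemidef hQ fun i => pd i h (t, x)),
    lintegral_stdGaussian (Continuous.measurable (by fun_prop)).ennreal_ofReal]
  unfold fisherInfo
  refine lintegral_congr fun x => ?_
  have hgrad : ∀ i, (gradient (fun y => g t y / finf d y) x).ofLp i = pd i h (t, x) := by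
    intro i
    rw [gradient_apply, ← hs.fderiv_slice ht, hg]
    rfl
  rw [← ENNReal.ofReal_mul (sum_mul_nonneg_of_posSemidef hQ fun i => pd i h (t, x)),
    dotProduct_mulVec_eq_sum]
  simp only [hgrad]

/-- The time derivative of the Gram matrix: a drift part, and the dissipation, which involves the
second derivatives. -/
noncomputable def gramRate (D C : Matrix (Fin d) (Fin d) ℝ)
    (h : ℝ × EuclideanSpace ℝ (Fin d) → ℝ) (i j : Fin d) (t : ℝ) : ℝ :=
  -∑ l, (C j l * gram h i l t + C i l * gram h l j t) -
    2 * ∫ x, carre D (pd i h) (pd j h) (t, x) ∂gauss d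

/-- The energy identity for the pair `∂_i h`, `∂_j h`. Its right-hand side is continuous in time
because the second derivatives have finite energy too. -/
lemma FiniteEnergy.hasDerivAt_gram (hDC : ∀ i j, 2 * D i j = C i j + C j i) (hDs : Dᵀ = D)
    {c : ℝ} (hc : 0 < c)
    (hD : ∀ y : Fin d → ℝ, c * ∑ i, y i ^ 2 ≤ ∑ i, ∑ j, D i j * (y i * y j))
    {h : ℝ × EuclideanSpace ℝ (Fin d) → ℝ} (hh : FiniteEnergy D C h fun _ => 0) (i j : Fin d)
    {t : ℝ} (ht : 0 < t) : HasDerivAt (gram h i j) (gramRate D C h i j t) t := by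
  have hv := hh.pd_of_source_zero hDC hDs hc hD
  have hH := hh.pd_pd_of_source_zero hDC hDs hc hD
  have iv : ∀ i j τ, 0 < τ → Integrable (fun x => pd i h (τ, x) * pd j h (τ, x)) (gauss d) :=
    fun i j τ hτ => (hv i).integrable_mul (hv j) hτ
  have iH : ∀ k l τ, 0 < τ → Integrable (fun x => pd k (pd i h) (τ, x) * pd l (pd j h) (τ, x))
      (gauss d) := fun k l τ hτ => by
    obtain ⟨α, hα⟩ := hH k i
    obtain ⟨β, hβ⟩ := hH l j
    exact hα.integrable_mul hβ hτ
  have iHs : ∀ τ, 0 < τ → Integrable (fun x => carre D (pd i h) (pd j h) (τ, x)) (gauss d) :=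
    fun τ hτ => integrable_finsetSum _ fun k _ => integrable_finsetSum _ fun l _ =>
      (iH k l τ hτ).const_mul _
  have carre_eq : ∀ τ, 0 < τ → ∫ x, carre D (pd i h) (pd j h) (τ, x) ∂gauss d =
      ∑ k, ∑ l, D k l * ∫ x, pd k (pd i h) (τ, x) * pd l (pd j h) (τ, x) ∂gauss d := by
    intro τ hτ
    exact (sum_sum_mul_integral (fun k l => iH k l τ hτ) D).symm
  refine (hv i).hasDerivAt_integral_mul hDC hDs (hv j) (J := gramRate D C h i j)
    (fun τ hτ => ?_) (fun τ hτ => ?_) ht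
  · have e : ∀ x, pd i h (τ, x) * (-∑ l, C j l * pd l h (τ, x)) +
        (-∑ l, C i l * pd l h (τ, x)) * pd j h (τ, x) - 2 * carre D (pd i h) (pd j h) (τ, x) =
        (∑ l, (-C j l * (pd i h (τ, x) * pd l h (τ, x)) +
          -C i l * (pd l h (τ, x) * pd j h (τ, x)))) - 2 * carre D (pd i h) (pd j h) (τ, x) := by
      intro x
      rw [Finset.sum_add_distrib, mul_neg, neg_mul, Finset.mul_sum, Finset.sum_mul,
        ← Finset.sum_neg_distrib, ← Finset.sum_neg_distrib]
      congr 2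
      · exact Finset.sum_congr rfl fun l _ => by ring
      · exact Finset.sum_congr rfl fun l _ => by ring
    have j1 : ∀ l, Integrable (fun x => -C j l * (pd i h (τ, x) * pd l h (τ, x)) +
        -C i l * (pd l h (τ, x) * pd j h (τ, x))) (gauss d) := fun l =>
      ((iv i l τ hτ).const_mul _).add ((iv l j τ hτ).const_mul _)
    rw [integral_congr_ae (ae_of_all _ e),
      integral_sub (integrable_finsetSum _ fun l _ => j1 l) ((iHs τ hτ).const_mul 2),
      integral_finsetSum _ fun l _ => j1 l, integral_const_mul]
    unfold gramRate gram
    rw [← Finset.sum_neg_distrib]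
    congr 1
    refine Finset.sum_congr rfl fun l _ => ?_
    rw [integral_add ((iv i l τ hτ).const_mul _) ((iv l j τ hτ).const_mul _),
      integral_const_mul, integral_const_mul]
    ring
  · have c1 : ∀ a b, ContinuousAt (gram h a b) τ := fun a b =>
      (hv a).continuousAt_integral_mul hDC hDs (hv b) hτ
    have c2 : ∀ k l, ContinuousAt (fun τ => ∫ x, pd k (pd i h) (τ, x) * pd l (pd j h) (τ, x)
        ∂gauss d) τ := fun k l => by
      obtain ⟨α, hα⟩ := hH k i
      obtain ⟨β, hβ⟩ := hH l j
      exact hα.continuousAt_integral_mul hDC hDs hβ hτ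
    have c3 : ContinuousAt (fun τ => ∫ x, carre D (pd i h) (pd j h) (τ, x) ∂gauss d) τ := by
      have : ContinuousAt (fun τ => ∑ k, ∑ l, D k l *
          ∫ x, pd k (pd i h) (τ, x) * pd l (pd j h) (τ, x) ∂gauss d) τ :=
        tendsto_finsetSum _ fun k _ => tendsto_finsetSum _ fun l _ => (c2 k l).const_mul _
      refine this.congr ?_
      filter_upwards [Ioi_mem_nhds hτ] with s hs using (carre_eq s hs).symm
    unfold gramRate
    refine ContinuousAt.sub (ContinuousAt.neg ?_) (c3.const_mul 2)
    exact tendsto_finsetSum _ fun l _ => ((c1 i l).const_mul _).add ((c1 l j).const_mul _)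

/-- For a constant vector `b`, the function `z = b · ∇h` has mean zero, so the sharp Poincaré
inequality bounds its dissipation below by `dmin` times its `L²` norm. -/
lemma FiniteEnergy.poincare_directional (hDC : ∀ i j, 2 * D i j = C i j + C j i) (hDs : Dᵀ = D)
    {c : ℝ} (hc : 0 < c)
    (hD : ∀ y : Fin d → ℝ, c * ∑ i, y i ^ 2 ≤ ∑ i, ∑ j, D i j * (y i * y j))
    {h : ℝ × EuclideanSpace ℝ (Fin d) → ℝ} (hh : FiniteEnergy D C h fun _ => 0) {t : ℝ}
    (ht : 0 < t) (hm : ∀ k, ∫ x, pd k h (t, x) ∂gauss d = 0) (b : Fin d → ℝ) :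
    c * ∑ k, ∑ l, b k * b l * gram h k l t ≤
      ∑ k, ∑ l, b k * b l * ∫ x, carre D (pd k h) (pd l h) (t, x) ∂gauss d := by
  have hv := hh.pd_of_source_zero hDC hDs hc hD
  have hH := hh.pd_pd_of_source_zero hDC hDs hc hD
  have mH : ∀ i k, MemLp (fun x => pd i (pd k h) (t, x)) 2 (gauss d) := fun i k => by
    obtain ⟨α, hα⟩ := hH i k
    exact hα.memLp t ht
  set z : EuclideanSpace ℝ (Fin d) → ℝ := fun x => ∑ k, b k * pd k h (t, x) with hz
  have hzs : ContDiff ℝ ∞ z := ContDiff.sum fun k _ =>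
    contDiff_const.mul (hh.smooth.derivDir.contDiff_slice ht)
  have hz2 : MemLp z 2 (gauss d) := memLp_finsetSum _ fun k _ => ((hv k).memLp t ht).const_mul _
  have hzd : ∀ i x, fderiv ℝ z x (stdBasis i) = ∑ k, b k * pd i (pd k h) (t, x) := by
    intro i x
    have hd : ∀ k, DifferentiableAt ℝ (fun x => pd k h (t, x)) x := fun k =>
      (hh.smooth.derivDir.contDiff_slice ht).differentiable (by simp) x
    rw [hz, fderiv_fun_sum fun k _ => (hd k).const_mul _, sum_apply]
    refine Finset.sum_congr rfl fun k _ => ?_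
    rw [fderiv_const_mul (hd k), smul_apply, hh.smooth.derivDir.fderiv_slice ht, smul_eq_mul]
  have hzd2 : ∀ i, MemLp (fun x => ∑ k, b k * pd i (pd k h) (t, x)) 2 (gauss d) := fun i =>
    memLp_finsetSum _ fun k _ => (mH i k).const_mul _
  have hzm : ∫ x, z x ∂gauss d = 0 := by
    rw [hz, integral_finsetSum _ fun k _ =>
      (((hv k).memLp t ht).integrable (by norm_num)).const_mul _]
    simp [integral_const_mul, hm]
  have hP := poincare_stdGaussian (hzs.of_le (by simp)) hz2
    (fun i => by simp only [hzd]; exact hzd2 i)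
  simp only [hzd] at hP
  rw [hzm] at hP
  have e1 : ∫ x, z x ^ 2 ∂gauss d = ∑ k, ∑ l, b k * b l * gram h k l t := by
    have : ∀ x, z x ^ 2 = ∑ k, ∑ l, b k * b l * (pd k h (t, x) * pd l h (t, x)) := by
      intro x
      rw [sq, hz, Finset.sum_mul_sum]
      exact Finset.sum_congr rfl fun k _ => Finset.sum_congr rfl fun l _ => by ring
    rw [integral_congr_ae (ae_of_all _ this)]
    exact (sum_sum_mul_integral (fun k l => (hv k).integrable_mul (hv l) ht)
      fun k l => b k * b l).symm
  have ic : ∀ k l, Integrable (fun x => carre D (pd k h) (pd l h) (t, x)) (gauss d) :=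
    fun k l => integrable_finsetSum _ fun i _ => integrable_finsetSum _
      fun j _ => ((mH i k).integrable_mul (mH j l)).const_mul _
  have e2 : ∑ k, ∑ l, b k * b l * ∫ x, carre D (pd k h) (pd l h) (t, x) ∂gauss d =
      ∫ x, ∑ k, ∑ l, b k * b l * carre D (pd k h) (pd l h) (t, x) ∂gauss d :=
    sum_sum_mul_integral ic fun k l => b k * b l
  have pt : ∀ x, c * ∑ i, (∑ k, b k * pd i (pd k h) (t, x)) ^ 2 ≤
      ∑ k, ∑ l, b k * b l * carre D (pd k h) (pd l h) (t, x) := by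
    intro x
    refine (hD fun i => ∑ k, b k * pd i (pd k h) (t, x)).trans (le_of_eq ?_)
    have l1 : ∀ i j, D i j * ((∑ k, b k * pd i (pd k h) (t, x)) *
        ∑ l, b l * pd j (pd l h) (t, x)) = ∑ k, ∑ l, b k * b l *
          (D i j * (pd i (pd k h) (t, x) * pd j (pd l h) (t, x))) := by
      intro i j
      rw [Finset.sum_mul_sum, Finset.mul_sum]
      refine Finset.sum_congr rfl fun k _ => ?_
      rw [Finset.mul_sum]
      exact Finset.sum_congr rfl fun l _ => by ring
    simp only [l1]
    simp only [carre, Finset.mul_sum]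
    calc _ = ∑ i, ∑ k, ∑ j, ∑ l, b k * b l *
            (D i j * (pd i (pd k h) (t, x) * pd j (pd l h) (t, x))) :=
          Finset.sum_congr rfl fun i _ => Finset.sum_comm
      _ = ∑ k, ∑ i, ∑ j, ∑ l, b k * b l *
            (D i j * (pd i (pd k h) (t, x) * pd j (pd l h) (t, x))) := Finset.sum_comm
      _ = ∑ k, ∑ i, ∑ l, ∑ j, b k * b l *
            (D i j * (pd i (pd k h) (t, x) * pd j (pd l h) (t, x))) :=
          Finset.sum_congr rfl fun k _ => Finset.sum_congr rfl fun i _ => Finset.sum_comm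
      _ = _ := Finset.sum_congr rfl fun k _ => Finset.sum_comm
  rw [e2, ← e1]
  have isq : ∀ i, Integrable (fun x => (∑ k, b k * pd i (pd k h) (t, x)) ^ 2) (gauss d) :=
    fun i => (hzd2 i).integrable_sq
  have hmono := integral_mono ((integrable_finsetSum _ fun i _ => isq i).const_mul c)
    (integrable_finsetSum _ fun k _ => integrable_finsetSum _ fun l _ => (ic k l).const_mul _) pt
  rw [integral_const_mul, integral_finsetSum _ fun i _ => isq i] at hmono
  refine le_trans (mul_le_mul_of_nonneg_left ?_ hc.le) hmono
  simpa using hP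

/-- The differential inequality for `∑ P_ij ∫ ∂_i h ∂_j h dγ`. The matrix inequality bounds the
drift part; writing `P` as a sum of rank-one matrices `b bᵀ` reduces the dissipation to the
directional Poincaré inequality. -/
lemma FiniteEnergy.sum_gramRate_le (hDC : ∀ i j, 2 * D i j = C i j + C j i) (hDs : Dᵀ = D)
    {c : ℝ} (hc : 0 < c)
    (hD : ∀ y : Fin d → ℝ, c * ∑ i, y i ^ 2 ≤ ∑ i, ∑ j, D i j * (y i * y j))
    {h : ℝ × EuclideanSpace ℝ (Fin d) → ℝ} (hh : FiniteEnergy D C h fun _ => 0) {t : ℝ}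
    (ht : 0 < t) (hm : ∀ k, ∫ x, pd k h (t, x) ∂gauss d = 0)
    {P : Matrix (Fin d) (Fin d) ℝ} (hP : P.PosSemidef) {lam : ℝ}
    (hCP : (Cᵀ * P + P * C - (2 * lam) • P).PosSemidef) :
    ∑ i, ∑ j, P i j * gramRate D C h i j t ≤
      -2 * (lam + c) * ∑ i, ∑ j, P i j * gram h i j t := by
  have hv := hh.pd_of_source_zero hDC hDs hc hD
  -- the drift part
  have drift : 2 * lam * ∑ i, ∑ j, P i j * gram h i j t ≤
      ∑ i, ∑ j, P i j * ∑ l, (C j l * gram h i l t + C i l * gram h l j t) := by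
    set M := Cᵀ * P + P * C - (2 * lam) • P with hM
    have hpos : 0 ≤ ∑ i, ∑ j, M i j * gram h i j t := by
      exact sum_mul_gram_nonneg (fun i => (hv i).memLp t ht) hCP
    have e : ∑ i, ∑ j, M i j * gram h i j t =
        ∑ i, ∑ j, P i j * ∑ l, (C j l * gram h i l t + C i l * gram h l j t) -
          2 * lam * ∑ i, ∑ j, P i j * gram h i j t := by
      have a1 : ∑ i, ∑ j, P i j * ∑ l, (C j l * gram h i l t + C i l * gram h l j t) =
          ∑ i, ∑ j, ∑ l, P i j * C j l * gram h i l t +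
          ∑ i, ∑ j, ∑ l, P i j * C i l * gram h l j t := by
        simp only [Finset.mul_sum, mul_add, Finset.sum_add_distrib, mul_assoc]
      have a2 : ∑ i, ∑ j, (P * C) i j * gram h i j t =
          ∑ i, ∑ j, ∑ l, P i j * C j l * gram h i l t := by
        simp only [Matrix.mul_apply, Finset.sum_mul]
        exact Finset.sum_congr rfl fun i _ => Finset.sum_comm
      have a3 : ∑ i, ∑ j, (Cᵀ * P) i j * gram h i j t =
          ∑ i, ∑ j, ∑ l, P i j * C i l * gram h l j t := by
        simp only [Matrix.mul_apply, Finset.sum_mul, Matrix.transpose_apply]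
        calc ∑ a, ∑ b, ∑ k, C k a * P k b * gram h a b t
            = ∑ a, ∑ k, ∑ b, C k a * P k b * gram h a b t :=
              Finset.sum_congr rfl fun a _ => Finset.sum_comm
          _ = ∑ k, ∑ a, ∑ b, C k a * P k b * gram h a b t := Finset.sum_comm
          _ = ∑ k, ∑ b, ∑ a, C k a * P k b * gram h a b t :=
              Finset.sum_congr rfl fun a _ => Finset.sum_comm
          _ = _ := Finset.sum_congr rfl fun i _ => Finset.sum_congr rfl fun j _ =>
              Finset.sum_congr rfl fun l _ => by ring
      rw [a1, ← a2, ← a3]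
      simp only [hM, Matrix.sub_apply, Matrix.add_apply, Matrix.smul_apply, smul_eq_mul, sub_mul,
        add_mul, Finset.sum_sub_distrib, Finset.sum_add_distrib, Finset.mul_sum]
      have : ∀ i j, 2 * lam * P i j * gram h i j t = 2 * lam * (P i j * gram h i j t) :=
        fun i j => by ring
      simp only [this]
      ring
    linarith
  -- the dissipation
  have diss : c * ∑ i, ∑ j, P i j * gram h i j t ≤
      ∑ i, ∑ j, P i j * ∫ x, carre D (pd i h) (pd j h) (t, x) ∂gauss d := by
    obtain ⟨m, b, hb⟩ := Matrix.posSemidef_iff_eq_sum_vecMulVec.1 hP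
    have hPij : ∀ i j, P i j = ∑ r, b r i * b r j := by
      intro i j
      rw [hb, Matrix.sum_apply]
      simp [Matrix.vecMulVec_apply]
    have swap : ∀ F : Fin d → Fin d → ℝ, ∑ i, ∑ j, P i j * F i j =
        ∑ r, ∑ i, ∑ j, b r i * b r j * F i j := by
      intro F
      simp only [hPij, Finset.sum_mul]
      calc ∑ i, ∑ j, ∑ r, b r i * b r j * F i j = ∑ i, ∑ r, ∑ j, b r i * b r j * F i j :=
            Finset.sum_congr rfl fun i _ => Finset.sum_comm
        _ = _ := Finset.sum_comm
    rw [swap, swap, Finset.mul_sum]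
    exact Finset.sum_le_sum fun r _ => hh.poincare_directional hDC hDs hc hD ht hm (b r)
  have e : ∑ i, ∑ j, P i j * gramRate D C h i j t =
      -∑ i, ∑ j, P i j * ∑ l, (C j l * gram h i l t + C i l * gram h l j t) -
      2 * ∑ i, ∑ j, P i j * ∫ x, carre D (pd i h) (pd j h) (t, x) ∂gauss d := by
    unfold gramRate
    simp only [mul_sub, mul_neg, Finset.sum_sub_distrib, Finset.sum_neg_distrib]
    congr 1
    rw [Finset.mul_sum]
    refine Finset.sum_congr rfl fun i _ => ?_
    rw [Finset.mul_sum]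
    exact Finset.sum_congr rfl fun j _ => by ring
  rw [e]
  linarith

/-- Grönwall's inequality on a half-line open at its left end. -/
lemma le_mul_exp_of_deriv_le {f : ℝ → ℝ} {κ : ℝ} (hf : ∀ t, 0 < t → DifferentiableAt ℝ f t)
    (hf' : ∀ t, 0 < t → deriv f t ≤ κ * f t) {t₀ t : ℝ} (h0 : 0 < t₀) (ht : t₀ ≤ t) :
    f t ≤ f t₀ * Real.exp (κ * (t - t₀)) := by
  have hd : ∀ s, 0 < s → HasDerivAt (fun s => f s * Real.exp (-κ * s))
      (deriv f s * Real.exp (-κ * s) + f s * (Real.exp (-κ * s) * -κ)) s := fun s hs => by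
    have hl : HasDerivAt (fun s => -κ * s) (-κ) s := by
      simpa using hasDerivAt_const_mul (x := s) (-κ)
    exact (hf s hs).hasDerivAt.mul hl.exp
  have hanti : AntitoneOn (fun s => f s * Real.exp (-κ * s)) (Ioi 0) := by
    refine antitoneOn_of_deriv_nonpos (convex_Ioi 0)
      (fun s hs => (hd s hs).continuousAt.continuousWithinAt) (fun s hs => ?_) (fun s hs => ?_)
    · rw [interior_Ioi] at hs
      exact (hd s hs).differentiableAt.differentiableWithinAt
    · rw [interior_Ioi] at hs
      rw [(hd s hs).deriv]
      nlinarith [hf' s hs, Real.exp_pos (-κ * s)]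
  have h := hanti h0 (h0.trans_le ht) ht
  simp only at h
  have e1 : f t = f t * Real.exp (-κ * t) * Real.exp (κ * t) := by
    rw [mul_assoc, ← Real.exp_add]; simp
  have e2 : f t₀ * Real.exp (κ * (t - t₀)) =
      f t₀ * Real.exp (-κ * t₀) * Real.exp (κ * t) := by
    rw [mul_assoc, ← Real.exp_add]; congr 2; ring
  rw [e1, e2]
  exact mul_le_mul_of_nonneg_right h (Real.exp_pos _).le

end Fisher

end FokkerPlanck

theorem theorem3p2 {d : ℕ} (D C : Matrix (Fin d) (Fin d) ℝ)
    (hD : D.PosDef) (hDC : D = (2⁻¹ : ℝ) • (C + Cᵀ))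
    (dmin : ℝ) (hdmin : IsLeast (spectrum ℝ D) dmin)
    (g₀ : EuclideanSpace ℝ (Fin d) → ℝ) (hg₀ : MemLp g₀ 2 (weight d))
    (horth : ∀ φ ∈ V d 1, ∫ x, g₀ x * φ x * (finf d x)⁻¹ = 0)
    (g : ℝ → EuclideanSpace ℝ (Fin d) → ℝ) (hg : IsSolution D C g₀ g)
    (P : Matrix (Fin d) (Fin d) ℝ) (hP : P.PosDef)
    (lam : ℝ) (hlam : 0 < lam)
    (hCP : (Cᵀ * P + P * C - (2 * lam) • P).PosSemidef) :
    0 < dmin ∧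
    (∀ t : ℝ, 0 < t →
      fisherInfo D (g t) < ⊤ ∧ fisherInfo P (g t) < ⊤ ∧
      DifferentiableAt ℝ (fun s => (fisherInfo P (g s)).toReal) t ∧
      deriv (fun s => (fisherInfo P (g s)).toReal) t
        ≤ -2 * (lam + dmin) * (fisherInfo P (g t)).toReal) ∧
    (∀ t₀ : ℝ, 0 < t₀ → ∀ t : ℝ, t₀ ≤ t →
      (fisherInfo P (g t)).toReal
        ≤ (fisherInfo P (g t₀)).toReal * Real.exp (-2 * (lam + dmin) * (t - t₀))) := by
  have hpos := dmin_pos hD hdmin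
  have hDs : D.IsSymm := by simpa using hD.1
  have hDC' : ∀ i j, 2 * D i j = C i j + C j i := by
    intro i j
    rw [hDC]
    simp
  have hell := dmin_mul_le hD hdmin
  have hh := hg.finiteEnergy hDC' hDs hpos hell hg₀
  have hv := hh.pd_of_source_zero hDC' hDs hpos hell
  have hI : ∀ {Q : Matrix (Fin d) (Fin d) ℝ}, Q.PosSemidef → ∀ t, 0 < t →
      fisherInfo Q (g t) = ENNReal.ofReal (∑ i, ∑ j, Q i j * gram (quot g) i j t) :=
    fun hQ t ht => fisherInfo_eq rfl hh.smooth ht (fun i => (hv i).memLp t ht) hQ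
  have hreal : ∀ t, 0 < t → (fisherInfo P (g t)).toReal =
      ∑ i, ∑ j, P i j * gram (quot g) i j t := by
    intro t ht
    rw [hI hP.posSemidef t ht, ENNReal.toReal_ofReal]
    exact sum_mul_gram_nonneg (fun i => (hv i).memLp t ht) hP.posSemidef
  have hderiv : ∀ t, 0 < t → HasDerivAt (fun s => (fisherInfo P (g s)).toReal)
      (∑ i, ∑ j, P i j * gramRate D C (quot g) i j t) t := by
    intro t ht
    have h1 : HasDerivAt (fun s => ∑ i, ∑ j, P i j * gram (quot g) i j s)
        (∑ i, ∑ j, P i j * gramRate D C (quot g) i j t) t :=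
      HasDerivAt.fun_sum fun i _ => HasDerivAt.fun_sum fun j _ =>
        (hh.hasDerivAt_gram hDC' hDs hpos hell i j ht).const_mul _
    refine h1.congr_of_eventuallyEq ?_
    filter_upwards [Ioi_mem_nhds ht] with s hs using hreal s hs
  have hineq : ∀ t, 0 < t → deriv (fun s => (fisherInfo P (g s)).toReal) t ≤
      -2 * (lam + dmin) * (fisherInfo P (g t)).toReal := by
    intro t ht
    rw [(hderiv t ht).deriv, hreal t ht]
    refine hh.sum_gramRate_le hDC' hDs hpos hell ht (fun k => ?_) hP.posSemidef hCP
    rw [hh.integral_pd hDC' hDs hpos hell k ht]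
    exact hg.moment_eq_zero hDC' hDs hpos hell hg₀ horth k ht
  refine ⟨hpos, fun t ht => ⟨?_, ?_, (hderiv t ht).differentiableAt, hineq t ht⟩,
    fun t₀ h0 t ht =>
      le_mul_exp_of_deriv_le (fun s hs => (hderiv s hs).differentiableAt) hineq h0 ht⟩
  · rw [hI hD.posSemidef t ht]; exact ENNReal.ofReal_lt_top
  · rw [hI hP.posSemidef t ht]; exact ENNReal.ofReal_lt_top
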